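/- Let $(V,\omega)$ be a finite-dimensional complex symplectic vector space, let $\Gamma<\operatorname{Sp}(V)$ be a finite group, and let $X:=V/\Gamma=\operatorname{Spec}\mathbf{C}[V]^\Gamma$ with the Poisson structure induced by $\omega$. Let $\mathbf{C}^\times$ act on $V$, and on everything derived from $V$, by dilation. Let $v\in V$, let $\Gamma_0:=\operatorname{Stab}_\Gamma(v)$ (a parabolic subgroup of $\Gamma$), and assume that $\mathbf{C}^\times$ acts freely on the image $\bar v$ of $v$ in $X$, i.e. if $gv=cv$ for some $g\in\Gamma$ and $c\in\mathbf{C}^\times$, then $c=1$. Let $N(\Gamma_0)$ be the normalizer of $\Gamma_0$ in $\Gamma$, let $N(\Gamma_0)^0:=N(\Gamma_0)/\Gamma_0$, and let $X_{\Gamma_0}:=\{w\in V:\operatorname{Stab}_\Gamma(w)=\Gamma_0\}/N(\Gamma_0)^0$ be the symplectic leaf of $\bar v$. It is an open subvariety of $V^{\Gamma_0}/N(\Gamma_0)^0$, with the Poisson structure induced by $\omega|_{V^{\Gamma_0}}$. Let $(V^{\Gamma_0})^\perp$ be the $\omega$-orthogonal complement of $V^{\Gamma_0}$, and let $\widehat{(V^{\Gamma_0})^\perp}$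 be its formal neighborhood of $0$. For a locally closed affine subvariety $Y$ of a variety $Z$, closed in an affine open subset $U$ of $Z$, let $\hat Z_Y:=\operatorname{Spf}\varprojlim_n\mathcal{O}(U)/I_Y^n$ be the formal neighborhood of $Y$ in $Z$; if $Z$ is Poisson, then so is $\hat Z_Y$, by continuity. Let $\hat\times$ denote the completed product of formal schemes, with the product Poisson structure. Then there is a canonical isomorphism of formal schemes over $\mathbf{C}$, $$\hat X_{\mathbf{C}^\times\cdot\bar v}\;\cong\;(\widehat{X_{\Gamma_0}})_{\mathbf{C}^\times\cdot\bar v}\;\hat\times\;\widehat{(V^{\Gamma_0})^\perp}/\Gamma_0,$$ which is $\mathbf{C}^\times$-equivariant and Poisson. Here canonical means the following. The formal neighborhood of $(\mathbf{C}^\times\cdot v)\times\{0\}$ in $V^{\Gamma_0}\times(V^{\Gamma_0})^\perp$ maps to the left-hand side by $(u,w)\mapsto\Gamma\cdot(u+w)$, and to the right-hand side by the product of the quotient maps $V^{\Gamma_0}\to V^{\Gamma_0}/N(\Gamma_0)^0$ and $(V^{\Gamma_0})^\perp\to(V^{\Gamma_0})^\perp/\Gamma_0$. The isomorphism commutes with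 these two maps, and it is the only $\mathbf{C}^\times$-equivariant Poisson isomorphism of formal schemes that does. -/

import Mathlib

noncomputable section

open scoped TensorProduct

namespace FormalQuotient

/-! ### Poisson algebras over `ℂ` -/

/-- A skew-symmetric biderivation of a commutative `ℂ`-algebra. -/
structure SkewBiderivation (R : Type*) [CommRing R] [Algebra ℂ R] where
  bracket : R →ₗ[ℂ] R →ₗ[ℂ] R
  self : ∀ a, bracket a a = 0
  leibniz : ∀ a b c, bracket a (b * c) = bracket a b * c + b * bracket a c

/-- A Poisson bracket on a commutative `ℂ`-algebra: a skew-symmetric biderivation satisfying the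
Jacobi identity. -/
structure PoissonBracket (R : Type*) [CommRing R] [Algebra ℂ R] extends SkewBiderivation R where
  jacobi : ∀ a b c,
    bracket a (bracket b c) + bracket b (bracket c a) + bracket c (bracket a b) = 0

namespace SkewBiderivation

variable {R : Type*} [CommRing R] [Algebra ℂ R] (P : SkewBiderivation R)

theorem skew (a b : R) : P.bracket a b = -P.bracket b a := by
  have h := P.self (a + b)
  simp only [map_add, LinearMap.add_apply, P.self, zero_add, add_zero] at h
  exact eq_neg_of_add_eq_zero_right h

theorem leibniz_left (a b c : R) :
    P.bracket (a * b) c = P.bracket a c * b + a * P.bracket b c := by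
  rw [P.skew, P.leibniz, P.skew c a, P.skew c b]; ring

theorem bracket_one (a : R) : P.bracket a 1 = 0 := by
  have h := P.leibniz a 1 1
  simp only [mul_one, one_mul] at h
  exact left_eq_add.mp h

theorem bracket_algebraMap (a : R) (c : ℂ) : P.bracket a (algebraMap ℂ R c) = 0 := by
  rw [Algebra.algebraMap_eq_smul_one, map_smul, bracket_one, smul_zero]

/-- The derivation `{a, -}`. -/
def ham (a : R) : Derivation ℂ R R :=
  Derivation.mk' (P.bracket a) fun b c => by
    rw [P.leibniz]; simp only [smul_eq_mul]; ring

@[simp] theorem ham_apply (a b : R) : P.ham a b = P.bracket a b := rfl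

/-- `{a,{b,c}} + {b,{c,a}} + {c,{a,b}}`. -/
def jacobiator (a b c : R) : R :=
  P.bracket a (P.bracket b c) + P.bracket b (P.bracket c a) + P.bracket c (P.bracket a b)

theorem jacobiator_rot (a b c : R) : P.jacobiator a b c = P.jacobiator b c a := by
  unfold jacobiator; ring

theorem jacobiator_add (a b c d : R) :
    P.jacobiator (a + b) c d = P.jacobiator a c d + P.jacobiator b c d := by
  unfold jacobiator; simp only [map_add, LinearMap.add_apply]; ring

theorem jacobiator_mul (a b c d : R) :
    P.jacobiator (a * b) c d = a * P.jacobiator b c d + b * P.jacobiator a c d := by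
  unfold jacobiator
  rw [P.leibniz_left a b, P.leibniz d, P.leibniz_left a b]
  simp only [map_add]
  rw [P.leibniz c, P.leibniz c, P.leibniz d, P.leibniz d, P.skew c b, P.skew a c]
  rw [P.skew d b, P.skew d a]
  simp only [map_neg]
  ring

theorem jacobiator_algebraMap (r : ℂ) (c d : R) : P.jacobiator (algebraMap ℂ R r) c d = 0 := by
  unfold jacobiator
  rw [P.skew (algebraMap ℂ R r), P.skew (algebraMap ℂ R r), bracket_algebraMap, bracket_algebraMap,
    bracket_algebraMap]
  simp

/-- To check the Jacobi identity it suffices to check it on a generating set. -/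
theorem jacobiator_eq_zero_of_adjoin (s : Set R) (hs : Algebra.adjoin ℂ s = ⊤)
    (h : ∀ a ∈ s, ∀ b ∈ s, ∀ c ∈ s, P.jacobiator a b c = 0) (a b c : R) :
    P.jacobiator a b c = 0 := by
  have key : ∀ b c : R, (∀ a ∈ s, P.jacobiator a b c = 0) → ∀ a, P.jacobiator a b c = 0 := by
    intro b c hbc a
    have ha : a ∈ Algebra.adjoin ℂ s := hs ▸ Algebra.mem_top
    induction ha using Algebra.adjoin_induction with
    | mem x hx => exact hbc x hx
    | algebraMap r => exact P.jacobiator_algebraMap r b c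
    | add x y _ _ hx hy => rw [P.jacobiator_add, hx, hy, add_zero]
    | mul x y _ _ hx hy => rw [P.jacobiator_mul, hx, hy, mul_zero, mul_zero, add_zero]
  have h1 : ∀ a, ∀ b ∈ s, ∀ c ∈ s, P.jacobiator a b c = 0 := fun a b hb c hc =>
    key b c (fun a ha => h a ha b hb c hc) a
  have h2 : ∀ a b, ∀ c ∈ s, P.jacobiator a b c = 0 := fun a b c hc => by
    rw [P.jacobiator_rot]
    exact key c a (fun b hb => by rw [← P.jacobiator_rot]; exact h1 a b hb c hc) b
  rw [← P.jacobiator_rot]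
  exact key a b (fun c hc => by rw [P.jacobiator_rot]; exact h2 a b c hc) c

end SkewBiderivation

namespace PoissonBracket

variable {R S A : Type*} [CommRing R] [Algebra ℂ R] [CommRing S] [Algebra ℂ S]
  [CommRing A] [Algebra ℂ A]

/-- The underlying operation of `PoissonBracket.induced`. -/
def inducedFun (P : PoissonBracket R) (ι : A →ₐ[ℂ] R)
    (h : ∀ a b, ∃ c, ι c = P.bracket (ι a) (ι b)) (a b : A) : A := (h a b).choose

theorem inducedFun_spec (P : PoissonBracket R) (ι : A →ₐ[ℂ] R)
    (h : ∀ a b, ∃ c, ι c = P.bracket (ι a) (ι b)) (a b : A) :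
    ι (P.inducedFun ι h a b) = P.bracket (ι a) (ι b) := (h a b).choose_spec

/-- The bracket on a subalgebra `ι : A ↪ R` that is closed under the bracket of `R`. -/
def induced (P : PoissonBracket R) (ι : A →ₐ[ℂ] R) (hι : Function.Injective ι)
    (h : ∀ a b, ∃ c, ι c = P.bracket (ι a) (ι b)) : PoissonBracket A where
  bracket := LinearMap.mk₂ ℂ (P.inducedFun ι h)
    (fun a b c => hι (by simp only [inducedFun_spec, map_add, LinearMap.add_apply]))
    (fun r a b => hι (by simp only [inducedFun_spec, map_smul, LinearMap.smul_apply]))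
    (fun a b c => hι (by simp only [inducedFun_spec, map_add]))
    (fun r a b => hι (by simp only [inducedFun_spec, map_smul]))
  self a := hι (by simp only [LinearMap.mk₂_apply, inducedFun_spec, P.self, map_zero])
  leibniz a b c := hι (by
    simp only [LinearMap.mk₂_apply, map_add, map_mul, inducedFun_spec, P.leibniz])
  jacobi a b c := hι (by
    simp only [LinearMap.mk₂_apply, map_add, inducedFun_spec, P.jacobi, map_zero])

theorem induced_spec (P : PoissonBracket R) (ι : A →ₐ[ℂ] R) (hι : Function.Injective ι)
    (h : ∀ a b, ∃ c, ι c = P.bracket (ι a) (ι b)) (a b : A) :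
    ι ((P.induced ι hι h).bracket a b) = P.bracket (ι a) (ι b) :=
  P.inducedFun_spec ι h a b

/-! #### Tensor products -/

/-- `{a ⊗ b, a' ⊗ b'} = {a, a'} ⊗ b b' + a a' ⊗ {b, b'}`, as a bilinear map. -/
def tensorBilin (P : PoissonBracket R) (Q : PoissonBracket S) :
    R ⊗[ℂ] S →ₗ[ℂ] R ⊗[ℂ] S →ₗ[ℂ] R ⊗[ℂ] S :=
  TensorProduct.map₂ P.bracket (LinearMap.mul ℂ S) +
    TensorProduct.map₂ (LinearMap.mul ℂ R) Q.bracket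

theorem tensorBilin_tmul (P : PoissonBracket R) (Q : PoissonBracket S) (a a' : R) (b b' : S) :
    tensorBilin P Q (a ⊗ₜ b) (a' ⊗ₜ b') =
      P.bracket a a' ⊗ₜ[ℂ] (b * b') + (a * a') ⊗ₜ[ℂ] Q.bracket b b' := by
  simp [tensorBilin, TensorProduct.map₂_apply_tmul]

theorem tensorBilin_skew (P : PoissonBracket R) (Q : PoissonBracket S) (x y : R ⊗[ℂ] S) :
    tensorBilin P Q x y = -tensorBilin P Q y x := by
  induction x with
  | zero => simp
  | add x x' hx hx' => rw [map_add, LinearMap.add_apply, hx, hx', map_add, neg_add]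
  | tmul a b =>
    induction y with
    | zero => simp
    | add y y' hy hy' => rw [map_add, hy, hy', map_add, LinearMap.add_apply, neg_add]
    | tmul a' b' =>
      rw [tensorBilin_tmul, tensorBilin_tmul, P.skew a a', Q.skew b b', mul_comm b b',
        mul_comm a a', TensorProduct.neg_tmul, TensorProduct.tmul_neg, neg_add]

theorem tensorBilin_leibniz (P : PoissonBracket R) (Q : PoissonBracket S) (x y z : R ⊗[ℂ] S) :
    tensorBilin P Q x (y * z) = tensorBilin P Q x y * z + y * tensorBilin P Q x z := by
  induction x with
  | zero => simp
  | add x x' hx hx' => simp only [map_add, LinearMap.add_apply, hx, hx']; ring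
  | tmul a b =>
    induction y with
    | zero => simp
    | add y y' hy hy' => simp only [add_mul, map_add, hy, hy']; ring
    | tmul a' b' =>
      induction z with
      | zero => simp
      | add z z' hz hz' => simp only [mul_add, map_add, hz, hz']; ring
      | tmul a'' b'' =>
        simp only [Algebra.TensorProduct.tmul_mul_tmul, tensorBilin_tmul, P.leibniz, Q.leibniz,
          add_mul, mul_add, TensorProduct.add_tmul, TensorProduct.tmul_add]
        have e1 : b * (b' * b'') = b * b' * b'' := by ring
        have e2 : b' * (b * b'') = b * b' * b'' := by ring
        have e3 : a * (a' * a'') = a * a' * a'' := by ring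
        have e4 : a' * (a * a'') = a * a' * a'' := by ring
        rw [e1, e2, e3, e4]
        abel

/-- The product biderivation on a tensor product. -/
def tensorBiderivation (P : PoissonBracket R) (Q : PoissonBracket S) :
    SkewBiderivation (R ⊗[ℂ] S) where
  bracket := tensorBilin P Q
  self x := by
    have h := tensorBilin_skew P Q x x
    have h2 : (2 : ℂ) • tensorBilin P Q x x = 0 := by
      rw [two_smul]; nth_rewrite 1 [h]; exact neg_add_cancel _
    exact (smul_eq_zero_iff_right two_ne_zero).mp h2
  leibniz := tensorBilin_leibniz P Q

theorem tensor_generators : Algebra.adjoin ℂ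
    (Set.range (fun a : R => a ⊗ₜ[ℂ] (1 : S)) ∪ Set.range (fun b : S => (1 : R) ⊗ₜ[ℂ] b)) = ⊤ := by
  rw [eq_top_iff]
  rintro x -
  induction x with
  | zero => exact zero_mem _
  | add x y hx hy => exact add_mem hx hy
  | tmul a b =>
    have : a ⊗ₜ[ℂ] b = (a ⊗ₜ[ℂ] (1 : S)) * ((1 : R) ⊗ₜ[ℂ] b) := by simp
    rw [this]
    exact mul_mem (Algebra.subset_adjoin (Or.inl ⟨a, rfl⟩)) (Algebra.subset_adjoin (Or.inr ⟨b, rfl⟩))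

/-- The Poisson bracket of a product of Poisson varieties:
`{a ⊗ b, a' ⊗ b'} = {a, a'} ⊗ b b' + a a' ⊗ {b, b'}`. -/
def tensor (P : PoissonBracket R) (Q : PoissonBracket S) : PoissonBracket (R ⊗[ℂ] S) where
  toSkewBiderivation := tensorBiderivation P Q
  jacobi := by
    have l0 : ∀ a : R, P.bracket 1 a = 0 := fun a => by rw [P.skew, P.bracket_one, neg_zero]
    have r0 : ∀ a : S, Q.bracket 1 a = 0 := fun a => by rw [Q.skew, Q.bracket_one, neg_zero]
    apply SkewBiderivation.jacobiator_eq_zero_of_adjoin _ _ tensor_generators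
    rintro _ (⟨a, rfl⟩ | ⟨a, rfl⟩) _ (⟨b, rfl⟩ | ⟨b, rfl⟩) _ (⟨c, rfl⟩ | ⟨c, rfl⟩) <;>
    simp only [SkewBiderivation.jacobiator, tensorBiderivation, tensorBilin_tmul, mul_one, one_mul,
      P.bracket_one, Q.bracket_one, l0, r0, TensorProduct.tmul_zero, TensorProduct.zero_tmul,
      add_zero, zero_add, map_zero, ← TensorProduct.add_tmul, ← TensorProduct.tmul_add, P.jacobi,
      Q.jacobi]

@[simp] theorem tensor_tmul (P : PoissonBracket R) (Q : PoissonBracket S) (a a' : R) (b b' : S) :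
    (P.tensor Q).bracket (a ⊗ₜ b) (a' ⊗ₜ b') =
      P.bracket a a' ⊗ₜ[ℂ] (b * b') + (a * a') ⊗ₜ[ℂ] Q.bracket b b' :=
  tensorBilin_tmul P Q a a' b b'

end PoissonBracket

/-! #### Localization -/

section Localization

variable {R : Type*} [CommRing R]

/-- A map satisfying the Leibniz rule along `φ` that vanishes on `R` vanishes on the localization
`S⁻¹ R`. -/
theorem leibnizMap_eq_zero {M : Submonoid R} {L : Type*} [CommRing L]
    (φ : Localization M →+* L) (δ : Localization M → L)
    (hmul : ∀ x y, δ (x * y) = φ x * δ y + φ y * δ x)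
    (h0 : ∀ r : R, δ (algebraMap R _ r) = 0) (x : Localization M) : δ x = 0 := by
  obtain ⟨⟨a, s⟩, h⟩ := IsLocalization.surj M x
  have h1 := congrArg δ h
  simp only [hmul, h0, mul_zero, zero_add] at h1
  have hu : IsUnit (φ (algebraMap R (Localization M) s)) :=
    (IsLocalization.map_units (Localization M) s).map φ
  exact hu.mul_right_eq_zero.mp h1

variable [Algebra ℂ R] (S : Submonoid R)

/-- The ring map `R → S⁻¹R[ε]`, `r ↦ r + D(r) ε`. -/
def derivTsze (D : Derivation ℂ R (Localization S)) :
    R →+* TrivSqZeroExt (Localization S) (Localization S) where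
  toFun r := TrivSqZeroExt.inl (algebraMap R _ r) + TrivSqZeroExt.inr (D r)
  map_one' := by ext <;> simp
  map_zero' := by ext <;> simp
  map_add' a b := by ext <;> simp
  map_mul' a b := by
    ext
    · simp
    · simp only [Derivation.leibniz, TrivSqZeroExt.snd_add, TrivSqZeroExt.snd_inl,
        TrivSqZeroExt.snd_inr, zero_add, TrivSqZeroExt.snd_mul, TrivSqZeroExt.fst_add,
        TrivSqZeroExt.fst_inl, TrivSqZeroExt.fst_inr, add_zero, smul_eq_mul,
        MulOpposite.smul_eq_mul_unop, MulOpposite.unop_op]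
      rw [Algebra.smul_def, Algebra.smul_def]; ring

theorem derivTsze_units (D : Derivation ℂ R (Localization S)) (s : S) :
    IsUnit (derivTsze S D s) := by
  rw [TrivSqZeroExt.isUnit_iff_isUnit_fst]
  simpa [derivTsze] using IsLocalization.map_units (Localization S) s

/-- The lift of `derivTsze` to the localization. -/
def derivLift (D : Derivation ℂ R (Localization S)) :
    Localization S →+* TrivSqZeroExt (Localization S) (Localization S) :=
  IsLocalization.lift (M := S) (derivTsze_units S D)

theorem derivLift_fst (D : Derivation ℂ R (Localization S)) (x : Localization S) :
    (derivLift S D x).fst = x := by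
  have : ((TrivSqZeroExt.fstHom (Localization S) (Localization S) (Localization S)).toRingHom.comp
      (derivLift S D)) = RingHom.id _ := by
    apply IsLocalization.ringHom_ext S
    ext r
    simp [derivLift, derivTsze]
  exact congrArg (fun f : Localization S →+* Localization S => f x) this

theorem derivLift_snd_algebraMap (D : Derivation ℂ R (Localization S)) (r : R) :
    (derivLift S D (algebraMap R _ r)).snd = D r := by
  simp [derivLift, derivTsze]

theorem derivLift_snd_mul (D : Derivation ℂ R (Localization S)) (x y : Localization S) :
    (derivLift S D (x * y)).snd = x * (derivLift S D y).snd + y * (derivLift S D x).snd := by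
  rw [map_mul, TrivSqZeroExt.snd_mul, derivLift_fst, derivLift_fst]
  simp [mul_comm]

/-- The unique extension of a derivation `R → S⁻¹R` to `S⁻¹R` (the quotient rule). -/
def derivExt (D : Derivation ℂ R (Localization S)) :
    Derivation ℂ (Localization S) (Localization S) :=
  Derivation.mk'
    { toFun := fun x => (derivLift S D x).snd
      map_add' := fun x y => by simp
      map_smul' := fun c x => by
        have h : (derivLift S D (algebraMap ℂ (Localization S) c)).snd = 0 := by
          rw [IsScalarTower.algebraMap_apply ℂ R (Localization S), derivLift_snd_algebraMap]
          simp
        rw [Algebra.smul_def, derivLift_snd_mul, h, Algebra.smul_def]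
        simp }
    fun x y => by simpa using derivLift_snd_mul S D x y

theorem derivExt_algebraMap (D : Derivation ℂ R (Localization S)) (r : R) :
    derivExt S D (algebraMap R _ r) = D r := derivLift_snd_algebraMap S D r

theorem deriv_loc_ext {D D' : Derivation ℂ (Localization S) (Localization S)}
    (h : ∀ r : R, D (algebraMap R _ r) = D' (algebraMap R _ r)) : D = D' := by
  ext x
  have := leibnizMap_eq_zero (RingHom.id (Localization S)) (fun x => (D - D') x)
    (fun x y => (D - D').leibniz x y) (fun r => by simp [h r]) x
  exact sub_eq_zero.mp this

namespace PoissonBracket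

variable (P : PoissonBracket R)

/-- The extension of `{r, -}` to `S⁻¹R`. -/
def locHam (r : R) : Derivation ℂ (Localization S) (Localization S) :=
  derivExt S (((Algebra.linearMap R (Localization S)).compDer (P.ham r)))

theorem locHam_algebraMap (r r' : R) :
    P.locHam S r (algebraMap R _ r') = algebraMap R _ (P.bracket r r') := by
  simp [locHam, derivExt_algebraMap]

/-- For `x ∈ S⁻¹R`, the derivation `r ↦ {x, r} = -{r, x}` of `R`. -/
def locDer (x : Localization S) : Derivation ℂ R (Localization S) :=
  Derivation.mk'
    { toFun := fun r => -P.locHam S r x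
      map_add' := fun a b => by
        have : P.locHam S (a + b) = P.locHam S a + P.locHam S b :=
          deriv_loc_ext S fun r => by simp [locHam_algebraMap]
        rw [this, Derivation.add_apply, neg_add]
      map_smul' := fun c a => by
        have : P.locHam S (c • a) = c • P.locHam S a :=
          deriv_loc_ext S fun r => by
            rw [Derivation.smul_apply, locHam_algebraMap, locHam_algebraMap, map_smul,
              LinearMap.smul_apply]
            exact map_smul (IsScalarTower.toAlgHom ℂ R (Localization S)) c (P.bracket a r)
        rw [this, Derivation.smul_apply, RingHom.id_apply, smul_neg] }
    fun a b => by
      have : P.locHam S (a * b) = algebraMap R (Localization S) a • P.locHam S b +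
          algebraMap R (Localization S) b • P.locHam S a :=
        deriv_loc_ext S fun r => by
          simp only [Derivation.add_apply, Derivation.smul_apply, locHam_algebraMap, smul_eq_mul,
            P.leibniz_left, map_add, map_mul]
          ring
      simp only [LinearMap.coe_mk, AddHom.coe_mk, this, Derivation.add_apply,
        Derivation.smul_apply, smul_eq_mul, Algebra.smul_def]
      ring

/-- The bracket of `S⁻¹R` as a bilinear map. -/
def locBilin : Localization S →ₗ[ℂ] Localization S →ₗ[ℂ] Localization S :=
  LinearMap.mk₂ ℂ (fun x y => derivExt S (P.locDer S x) y)
    (fun x x' y => by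
      have : derivExt S (P.locDer S (x + x')) =
          derivExt S (P.locDer S x) + derivExt S (P.locDer S x') :=
        deriv_loc_ext S fun r => by
          simp only [Derivation.add_apply, derivExt_algebraMap]
          simp [locDer]; ring
      rw [this, Derivation.add_apply])
    (fun c x y => by
      have : derivExt S (P.locDer S (c • x)) = c • derivExt S (P.locDer S x) :=
        deriv_loc_ext S fun r => by
          simp only [Derivation.smul_apply, derivExt_algebraMap]
          simp [locDer]
      rw [this, Derivation.smul_apply])
    (fun x y y' => map_add _ _ _)
    (fun c x y => Derivation.map_smul _ _ _)

theorem locBilin_leibniz (x y z : Localization S) :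
    P.locBilin S x (y * z) = P.locBilin S x y * z + y * P.locBilin S x z := by
  simp only [locBilin, LinearMap.mk₂_apply, Derivation.leibniz, smul_eq_mul]; ring

theorem locBilin_right (x : Localization S) (r : R) :
    P.locBilin S x (algebraMap R _ r) = -P.locHam S r x := by
  simp [locBilin, derivExt_algebraMap, locDer]

theorem locBilin_algebraMap (r r' : R) :
    P.locBilin S (algebraMap R _ r) (algebraMap R _ r') = algebraMap R _ (P.bracket r r') := by
  rw [locBilin_right, locHam_algebraMap, P.skew r' r, map_neg, neg_neg]

theorem locBilin_left (r : R) (x : Localization S) :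
    P.locBilin S (algebraMap R _ r) x = P.locHam S r x := by
  have : derivExt S (P.locDer S (algebraMap R _ r)) = P.locHam S r :=
    deriv_loc_ext S fun r' => by
      have := P.locBilin_algebraMap S r r'
      simp only [locBilin, LinearMap.mk₂_apply] at this
      rw [this, locHam_algebraMap]
  simp [locBilin, this]

theorem locBilin_leibniz_left (x y z : Localization S) :
    P.locBilin S (x * y) z = P.locBilin S x z * y + x * P.locBilin S y z := by
  have : derivExt S (P.locDer S (x * y)) =
      y • derivExt S (P.locDer S x) + x • derivExt S (P.locDer S y) :=
    deriv_loc_ext S fun r => by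
      simp only [Derivation.add_apply, Derivation.smul_apply, derivExt_algebraMap]
      simp [locDer]
  simp only [locBilin, LinearMap.mk₂_apply, this, Derivation.add_apply, Derivation.smul_apply,
    smul_eq_mul]
  ring

theorem locBilin_skew (x y : Localization S) : P.locBilin S x y = -P.locBilin S y x := by
  have := leibnizMap_eq_zero (RingHom.id (Localization S))
    (fun y => P.locBilin S x y + P.locBilin S y x)
    (fun y z => by
      simp only [locBilin_leibniz, locBilin_leibniz_left, RingHom.id_apply]; ring)
    (fun r => by rw [locBilin_right, locBilin_left]; ring) y
  exact eq_neg_of_add_eq_zero_left this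

/-- The extension of the bracket to `S⁻¹R`, as a skew biderivation. -/
def locBiderivation : SkewBiderivation (Localization S) where
  bracket := P.locBilin S
  self x := by
    have h := P.locBilin_skew S x x
    have h2 : (2 : ℂ) • P.locBilin S x x = 0 := by
      rw [two_smul]; nth_rewrite 1 [h]; exact neg_add_cancel _
    exact (smul_eq_zero_iff_right two_ne_zero).mp h2
  leibniz := P.locBilin_leibniz S

/-- The unique extension of a Poisson bracket to a localization. -/
def localization : PoissonBracket (Localization S) where
  toSkewBiderivation := P.locBiderivation S
  jacobi := by
    set Q := P.locBiderivation S with hQ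
    have key : ∀ y z, (∀ r : R, Q.jacobiator (algebraMap R _ r) y z = 0) →
        ∀ x, Q.jacobiator x y z = 0 := fun y z h x =>
      leibnizMap_eq_zero (RingHom.id (Localization S)) (fun x => Q.jacobiator x y z)
        (fun x x' => Q.jacobiator_mul x x' y z) h x
    have h0 : ∀ a b c : R, Q.jacobiator (algebraMap R _ a) (algebraMap R _ b)
        (algebraMap R _ c) = 0 := fun a b c => by
      have hb : ∀ r r' : R, Q.bracket (algebraMap R _ r) (algebraMap R _ r') =
        algebraMap R _ (P.bracket r r') := P.locBilin_algebraMap S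
      simp only [SkewBiderivation.jacobiator, hb, ← map_add, P.jacobi, map_zero]
    have h1 : ∀ (x : Localization S) (b c : R), Q.jacobiator x (algebraMap R _ b)
        (algebraMap R _ c) = 0 := fun x b c => key _ _ (fun a => h0 a b c) x
    have h2 : ∀ (x y : Localization S) (c : R), Q.jacobiator x y (algebraMap R _ c) = 0 :=
      fun x y c => by
        rw [Q.jacobiator_rot]
        exact key _ _ (fun b => by rw [← Q.jacobiator_rot]; exact h1 x b c) y
    intro x y z
    change Q.jacobiator x y z = 0
    rw [← Q.jacobiator_rot]
    exact key _ _ (fun c => by rw [Q.jacobiator_rot]; exact h2 x y c) z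

theorem localization_algebraMap (r r' : R) :
    (P.localization S).bracket (algebraMap R _ r) (algebraMap R _ r') =
      algebraMap R _ (P.bracket r r') := P.locBilin_algebraMap S r r'

/-- A ring map out of a localization that is compatible with brackets on `R` is so everywhere. -/
theorem localization_hom {L : Type*} [CommRing L] [Algebra ℂ L] (Q : PoissonBracket L)
    (φ : Localization S →+* L)
    (h : ∀ a b : R, φ (algebraMap R _ (P.bracket a b)) =
      Q.bracket (φ (algebraMap R _ a)) (φ (algebraMap R _ b))) (x y : Localization S) :
    φ ((P.localization S).bracket x y) = Q.bracket (φ x) (φ y) := by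
  have h1 : ∀ (a : R) (y : Localization S),
      φ ((P.localization S).bracket (algebraMap R _ a) y) =
        Q.bracket (φ (algebraMap R _ a)) (φ y) := fun a y => by
    refine sub_eq_zero.mp (leibnizMap_eq_zero φ (fun y =>
      φ ((P.localization S).bracket (algebraMap R _ a) y) -
        Q.bracket (φ (algebraMap R _ a)) (φ y)) (fun y z => ?_) (fun b => ?_) y)
    · simp only [(P.localization S).leibniz, Q.leibniz, map_add, map_mul]; ring
    · simp only [localization_algebraMap, h, sub_self]
  refine sub_eq_zero.mp (leibnizMap_eq_zero φ (fun x =>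
      φ ((P.localization S).bracket x y) - Q.bracket (φ x) (φ y)) (fun x z => ?_) (fun b => ?_) x)
  · simp only [(P.localization S).leibniz_left, Q.leibniz_left, map_add, map_mul]; ring
  · simp only [h1, sub_self]

end PoissonBracket

end Localization

/-! #### Adic completions -/

section Completion

variable {R T : Type*} [CommRing R] [CommRing T]

/-- A derivation maps `I ^ (n + 1)` to `I ^ n`. -/
theorem derivation_pow_mem [Algebra ℂ R] (D : Derivation ℂ R R) (I : Ideal R) (n : ℕ) {x : R}
    (hx : x ∈ I ^ (n + 1)) : D x ∈ I ^ n := by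
  induction n generalizing x with
  | zero => simp
  | succ n ih =>
    rw [pow_succ] at hx
    induction hx using Submodule.mul_induction_on' with
    | mem_mul_mem a ha b hb =>
      rw [Derivation.leibniz, smul_eq_mul, smul_eq_mul]
      refine add_mem (Ideal.mul_mem_right _ _ ha) ?_
      rw [pow_succ, mul_comm b]
      exact Ideal.mul_mem_mul (ih ha) hb
    | add a _ b _ ha hb => rw [map_add]; exact add_mem ha hb

/-- A chosen representative in `R` of the image of `x` in `R / I ^ n`. -/
def rep (I : Ideal R) (x : AdicCompletion I R) (n : ℕ) : R :=
  (Ideal.Quotient.mk_surjective (AdicCompletion.evalₐ I n x)).choose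

theorem mk_rep (I : Ideal R) (x : AdicCompletion I R) (n : ℕ) :
    Ideal.Quotient.mk (I ^ n) (rep I x n) = AdicCompletion.evalₐ I n x :=
  (Ideal.Quotient.mk_surjective (AdicCompletion.evalₐ I n x)).choose_spec

theorem mk_rep_of_le (I : Ideal R) (x : AdicCompletion I R) {m n : ℕ} (h : m ≤ n) :
    Ideal.Quotient.mk (I ^ m) (rep I x n) = AdicCompletion.evalₐ I m x := by
  have key : ∀ y : R, Ideal.Quotient.mk (I ^ n) y = AdicCompletion.evalₐ I n x →
      Ideal.Quotient.mk (I ^ m) y = AdicCompletion.evalₐ I m x := by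
    induction x using AdicCompletion.induction_on with
    | _ f =>
      intro y hy
      rw [AdicCompletion.evalₐ_mk] at hy ⊢
      rw [← AdicCompletion.Ideal.mk_eq_mk I h f]
      rw [Ideal.Quotient.eq] at hy ⊢
      exact Ideal.pow_le_pow_right h hy
  exact key _ (mk_rep I x n)

namespace PoissonBracket

variable [Algebra ℂ R] (P : PoissonBracket R) (I : Ideal R)

theorem bracket_congr (n : ℕ) {a a' b b' : R}
    (ha : Ideal.Quotient.mk (I ^ (n + 1)) a = Ideal.Quotient.mk (I ^ (n + 1)) a')
    (hb : Ideal.Quotient.mk (I ^ (n + 1)) b = Ideal.Quotient.mk (I ^ (n + 1)) b') :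
    Ideal.Quotient.mk (I ^ n) (P.bracket a b) = Ideal.Quotient.mk (I ^ n) (P.bracket a' b') := by
  rw [Ideal.Quotient.eq] at ha hb ⊢
  have h : P.bracket a b - P.bracket a' b' = P.ham a (b - b') - P.ham b' (a - a') := by
    simp only [SkewBiderivation.ham_apply, map_sub]
    rw [P.skew b' a, P.skew b' a']; ring
  rw [h]
  exact sub_mem (derivation_pow_mem _ I n hb) (derivation_pow_mem _ I n ha)

/-- The bracket on the completion, `{lim xₙ, lim yₙ} = lim {xₙ, yₙ}`. -/
def complFun (x y : AdicCompletion I R) : AdicCompletion I R :=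
  AdicCompletion.mk I R (AdicCompletion.AdicCauchySequence.mk I R
    (fun n => P.bracket (rep I x (n + 1)) (rep I y (n + 1))) fun n => by
      rw [SModEq.sub_mem, smul_eq_mul, Ideal.mul_top, ← Ideal.Quotient.eq]
      apply P.bracket_congr I n <;> rw [mk_rep, mk_rep_of_le I _ (Nat.le_succ _)])

theorem eval_complFun (x y : AdicCompletion I R) (n : ℕ) {a b : R}
    (ha : Ideal.Quotient.mk (I ^ (n + 1)) a = AdicCompletion.evalₐ I (n + 1) x)
    (hb : Ideal.Quotient.mk (I ^ (n + 1)) b = AdicCompletion.evalₐ I (n + 1) y) :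
    AdicCompletion.evalₐ I n (P.complFun I x y) = Ideal.Quotient.mk (I ^ n) (P.bracket a b) := by
  unfold complFun
  rw [AdicCompletion.evalₐ_mk]
  exact P.bracket_congr I n ((mk_rep I x _).trans ha.symm) ((mk_rep I y _).trans hb.symm)

theorem evalₐ_smul (c : ℂ) (x : AdicCompletion I R) (n : ℕ) :
    AdicCompletion.evalₐ I n (c • x) = c • AdicCompletion.evalₐ I n x :=
  map_smul ((AdicCompletion.evalₐ I n).restrictScalars ℂ) c x

theorem mk_smul' (c : ℂ) (x : R) (n : ℕ) :
    Ideal.Quotient.mk (I ^ n) (c • x) = c • Ideal.Quotient.mk (I ^ n) x := rfl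

/-- The unique continuous extension of a Poisson bracket to the `I`-adic completion. -/
def completion : PoissonBracket (AdicCompletion I R) where
  bracket := LinearMap.mk₂ ℂ (P.complFun I)
    (fun x x' y => AdicCompletion.ext_evalₐ fun n => by
      rw [map_add, P.eval_complFun I x y n (mk_rep I x _) (mk_rep I y _),
        P.eval_complFun I x' y n (mk_rep I x' _) (mk_rep I y _),
        P.eval_complFun I (x + x') y n (a := rep I x (n + 1) + rep I x' (n + 1))
          (by rw [map_add, map_add, mk_rep, mk_rep]) (mk_rep I y _)]
      simp)
    (fun c x y => AdicCompletion.ext_evalₐ fun n => by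
      rw [evalₐ_smul, P.eval_complFun I x y n (mk_rep I x _) (mk_rep I y _),
        P.eval_complFun I (c • x) y n (a := c • rep I x (n + 1))
          (by rw [mk_smul', evalₐ_smul, mk_rep]) (mk_rep I y _)]
      simp [mk_smul'])
    (fun x y y' => AdicCompletion.ext_evalₐ fun n => by
      rw [map_add, P.eval_complFun I x y n (mk_rep I x _) (mk_rep I y _),
        P.eval_complFun I x y' n (mk_rep I x _) (mk_rep I y' _),
        P.eval_complFun I x (y + y') n (b := rep I y (n + 1) + rep I y' (n + 1)) (mk_rep I x _)
          (by rw [map_add, map_add, mk_rep, mk_rep])]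
      simp)
    (fun c x y => AdicCompletion.ext_evalₐ fun n => by
      rw [evalₐ_smul, P.eval_complFun I x y n (mk_rep I x _) (mk_rep I y _),
        P.eval_complFun I x (c • y) n (b := c • rep I y (n + 1)) (mk_rep I x _)
          (by rw [mk_smul', evalₐ_smul, mk_rep])]
      simp [mk_smul'])
  self x := AdicCompletion.ext_evalₐ fun n => by
    rw [LinearMap.mk₂_apply, P.eval_complFun I x x n (mk_rep I x _) (mk_rep I x _), P.self]
    simp
  leibniz x y z := AdicCompletion.ext_evalₐ fun n => by
    simp only [LinearMap.mk₂_apply]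
    rw [map_add, map_mul, map_mul, P.eval_complFun I x y n (mk_rep I x _) (mk_rep I y _),
      P.eval_complFun I x z n (mk_rep I x _) (mk_rep I z _),
      P.eval_complFun I x (y * z) n (b := rep I y (n + 1) * rep I z (n + 1)) (mk_rep I x _)
        (by rw [map_mul, map_mul, mk_rep, mk_rep]), P.leibniz,
      ← mk_rep_of_le I y (Nat.le_succ n), ← mk_rep_of_le I z (Nat.le_succ n)]
    simp
  jacobi x y z := AdicCompletion.ext_evalₐ fun n => by
    simp only [LinearMap.mk₂_apply]
    have h : ∀ u v w : AdicCompletion I R,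
        AdicCompletion.evalₐ I n (P.complFun I u (P.complFun I v w)) =
          Ideal.Quotient.mk (I ^ n) (P.bracket (rep I u (n + 2))
            (P.bracket (rep I v (n + 2)) (rep I w (n + 2)))) := fun u v w =>
      P.eval_complFun I _ _ n (mk_rep_of_le I u (Nat.le_succ _))
        (P.eval_complFun I v w (n + 1) (mk_rep I v _) (mk_rep I w _)).symm
    rw [map_add, map_add, h, h, h, ← map_add, ← map_add, P.jacobi, map_zero, map_zero]

theorem eval_completion (x y : AdicCompletion I R) (n : ℕ) {a b : R}
    (ha : Ideal.Quotient.mk (I ^ (n + 1)) a = AdicCompletion.evalₐ I (n + 1) x)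
    (hb : Ideal.Quotient.mk (I ^ (n + 1)) b = AdicCompletion.evalₐ I (n + 1) y) :
    AdicCompletion.evalₐ I n ((P.completion I).bracket x y) =
      Ideal.Quotient.mk (I ^ n) (P.bracket a b) := P.eval_complFun I x y n ha hb

end PoissonBracket

/-- The kernel of `lim R / I ^ m → R / I ^ n`. These ideals form a neighbourhood basis of `0` in the
inverse limit topology of the completion. -/
def filtration (I : Ideal R) (n : ℕ) : Ideal (AdicCompletion I R) :=
  RingHom.ker (AdicCompletion.evalₐ I n)

/-- The ideal of definition of the completion: the kernel of `lim R / I ^ n → R / I`. -/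
def idealOfDefinition (I : Ideal R) : Ideal (AdicCompletion I R) := filtration I 1

/-- Continuity of an algebra map `φ : A → B` for the linear topologies in which the ideals `F m`,
respectively `G n`, form a neighbourhood basis of `0`. -/
def FilteredContinuous {A B : Type*} [CommRing A] [Algebra ℂ A] [CommRing B] [Algebra ℂ B]
    (F : ℕ → Ideal A) (G : ℕ → Ideal B) (φ : A →ₐ[ℂ] B) : Prop :=
  ∀ n, ∃ m, F m ≤ (G n).comap φ

theorem eval_pow_idealOfDefinition (I : Ideal R) (n : ℕ) {x : AdicCompletion I R}
    (hx : x ∈ idealOfDefinition I ^ n) : AdicCompletion.evalₐ I n x = 0 := by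
  have h1 : idealOfDefinition I ≤
      (I.map (Ideal.Quotient.mk (I ^ n))).comap (AdicCompletion.evalₐ I n) := by
    rcases Nat.eq_zero_or_pos n with rfl | hn
    · intro y _
      have : Subsingleton (R ⧸ I ^ 0) := by
        rw [pow_zero, Ideal.one_eq_top]; exact Ideal.Quotient.subsingleton_iff.mpr rfl
      rw [Ideal.mem_comap, Subsingleton.elim (AdicCompletion.evalₐ I 0 y) 0]
      exact zero_mem _
    · intro y hy
      rw [Ideal.mem_comap, ← mk_rep]
      apply Ideal.mem_map_of_mem
      have : Ideal.Quotient.mk (I ^ 1) (rep I y n) = 0 := by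
        rw [mk_rep_of_le I y hn]; exact hy
      rwa [Ideal.Quotient.eq_zero_iff_mem, pow_one] at this
  have h2 := (Ideal.pow_right_mono h1 n).trans (Ideal.le_comap_pow _ n) hx
  rw [Ideal.mem_comap, ← Ideal.map_pow, Ideal.map_quotient_self] at h2
  exact h2

variable [Algebra ℂ R] [Algebra ℂ T]

/-- The map `lim T / K ^ m → T / K ^ n → R / I ^ n` induced by `f : T → lim R / I ^ n`. -/
def complLiftAux (K : Ideal T) (I : Ideal R) (f : T →ₐ[ℂ] AdicCompletion I R)
    (h : K ≤ (idealOfDefinition I).comap f) (n : ℕ) : AdicCompletion K T →ₐ[ℂ] R ⧸ I ^ n :=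
  (Ideal.Quotient.liftₐ (K ^ n) (((AdicCompletion.evalₐ I n).restrictScalars ℂ).comp f) fun _ hx =>
    eval_pow_idealOfDefinition I n
      ((Ideal.pow_right_mono h n).trans (Ideal.le_comap_pow _ n) hx)).comp
  ((AdicCompletion.evalₐ K n).restrictScalars ℂ)

theorem complLiftAux_apply (K : Ideal T) (I : Ideal R) (f : T →ₐ[ℂ] AdicCompletion I R)
    (h : K ≤ (idealOfDefinition I).comap f) (n : ℕ) (x : AdicCompletion K T) {t : T}
    (ht : Ideal.Quotient.mk (K ^ n) t = AdicCompletion.evalₐ K n x) :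
    complLiftAux K I f h n x = AdicCompletion.evalₐ I n (f t) := by
  unfold complLiftAux
  simp only [AlgHom.comp_apply, AlgHom.restrictScalars_apply, ← ht]
  rfl

theorem complLiftAux_compat (K : Ideal T) (I : Ideal R) (f : T →ₐ[ℂ] AdicCompletion I R)
    (h : K ≤ (idealOfDefinition I).comap f) {m n : ℕ} (hle : m ≤ n) :
    (Ideal.Quotient.factorₐ ℂ (Ideal.pow_le_pow_right hle)).comp (complLiftAux K I f h n) =
      complLiftAux K I f h m := by
  ext x
  rw [AlgHom.comp_apply, complLiftAux_apply K I f h n x (mk_rep K x n),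
    complLiftAux_apply K I f h m x (mk_rep_of_le K x hle), ← mk_rep I _ n,
    ← mk_rep_of_le I _ hle]
  rfl

/-- The continuous extension to the `K`-adic completion of an algebra map `f : T → lim R / I ^ n`
with `f(K)` contained in the ideal of definition. -/
def complLift (K : Ideal T) (I : Ideal R) (f : T →ₐ[ℂ] AdicCompletion I R)
    (h : K ≤ (idealOfDefinition I).comap f) : AdicCompletion K T →ₐ[ℂ] AdicCompletion I R :=
  AdicCompletion.liftAlgHom I (complLiftAux K I f h) (complLiftAux_compat K I f h)

theorem complLift_eval (K : Ideal T) (I : Ideal R) (f : T →ₐ[ℂ] AdicCompletion I R)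
    (h : K ≤ (idealOfDefinition I).comap f) (x : AdicCompletion K T) (n : ℕ) {t : T}
    (ht : Ideal.Quotient.mk (K ^ n) t = AdicCompletion.evalₐ K n x) :
    AdicCompletion.evalₐ I n (complLift K I f h x) = AdicCompletion.evalₐ I n (f t) := by
  unfold complLift
  rw [AdicCompletion.evalₐ_liftAlgHom _ _ (complLiftAux_compat K I f h),
    complLiftAux_apply K I f h n x ht]

/-- The continuous map of completions induced by `f : T → R` with `f(K) ⊆ I`. -/
def complMap (K : Ideal T) (I : Ideal R) (f : T →ₐ[ℂ] R) (h : K ≤ I.comap f) :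
    AdicCompletion K T →ₐ[ℂ] AdicCompletion I R :=
  complLift K I (((Algebra.ofId R (AdicCompletion I R)).restrictScalars ℂ).comp f) fun x hx => by
    change AdicCompletion.evalₐ I 1 (algebraMap R (AdicCompletion I R) (f x)) = 0
    rw [AlgHom.commutes]
    change Ideal.Quotient.mk (I ^ 1) (f x) = 0
    rw [Ideal.Quotient.eq_zero_iff_mem, pow_one]
    exact h hx

theorem complMap_eval (K : Ideal T) (I : Ideal R) (f : T →ₐ[ℂ] R) (h : K ≤ I.comap f)
    (x : AdicCompletion K T) (n : ℕ) {t : T}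
    (ht : Ideal.Quotient.mk (K ^ n) t = AdicCompletion.evalₐ K n x) :
    AdicCompletion.evalₐ I n (complMap K I f h x) = Ideal.Quotient.mk (I ^ n) (f t) := by
  unfold complMap
  rw [complLift_eval K I _ _ x n ht]
  exact (AdicCompletion.evalₐ I n).commutes (f t)

theorem complMap_complMap {U : Type*} [CommRing U] [Algebra ℂ U] (K : Ideal T) (I : Ideal R)
    (J : Ideal U) (f : T →ₐ[ℂ] R) (h : K ≤ I.comap f) (g : R →ₐ[ℂ] U) (h' : I ≤ J.comap g)
    (h'' : K ≤ J.comap (g.comp f)) (x : AdicCompletion K T) :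
    complMap I J g h' (complMap K I f h x) =
      complMap K J (g.comp f) h'' x :=
  AdicCompletion.ext_evalₐ fun n => by
    rw [complMap_eval I J g h' _ n (complMap_eval K I f h x n (mk_rep K x n)).symm,
      complMap_eval K J _ h'' x n (mk_rep K x n)]
    rfl

theorem complMap_bracket (P : PoissonBracket T) (Q : PoissonBracket R) (K : Ideal T) (I : Ideal R)
    (f : T →ₐ[ℂ] R) (h : K ≤ I.comap f)
    (hf : ∀ a b, f (P.bracket a b) = Q.bracket (f a) (f b)) (x y : AdicCompletion K T) :
    complMap K I f h ((P.completion K).bracket x y) =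
      (Q.completion I).bracket (complMap K I f h x) (complMap K I f h y) :=
  AdicCompletion.ext_evalₐ fun n => by
    rw [complMap_eval K I f h _ n (P.eval_completion K x y n (mk_rep K x _) (mk_rep K y _)).symm,
      Q.eval_completion I _ _ n (complMap_eval K I f h x _ (mk_rep K x _)).symm
        (complMap_eval K I f h y _ (mk_rep K y _)).symm, hf]

end Completion

/-! ### Completed tensor products -/

section CompletedTensor

variable {A B A' B' : Type*} [CommRing A] [Algebra ℂ A] [CommRing B] [Algebra ℂ B]
  [CommRing A'] [Algebra ℂ A'] [CommRing B'] [Algebra ℂ B']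

/-- The ideal `I ⊗ B + A ⊗ J` of `A ⊗ B`. -/
def tensorIdeal (I : Ideal A) (J : Ideal B) : Ideal (A ⊗[ℂ] B) :=
  I.map (Algebra.TensorProduct.includeLeft : A →ₐ[ℂ] A ⊗[ℂ] B) ⊔
    J.map (Algebra.TensorProduct.includeRight : B →ₐ[ℂ] A ⊗[ℂ] B)

/-- The completed tensor product of two adic algebras with ideals of definition `I` and `J`, i.e.
the algebra of functions on the product of the formal schemes `Spf A` and `Spf B`. -/
def CompletedTensor (I : Ideal A) (J : Ideal B) : Type _ :=
  AdicCompletion (tensorIdeal I J) (A ⊗[ℂ] B)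

instance (I : Ideal A) (J : Ideal B) : CommRing (CompletedTensor I J) :=
  inferInstanceAs (CommRing (AdicCompletion (tensorIdeal I J) (A ⊗[ℂ] B)))

instance (I : Ideal A) (J : Ideal B) : Algebra ℂ (CompletedTensor I J) :=
  inferInstanceAs (Algebra ℂ (AdicCompletion (tensorIdeal I J) (A ⊗[ℂ] B)))

/-- The filtration of the completed tensor product `lim (A ⊗ B) / (I ⊗ B + A ⊗ J) ^ n` defining its
topology. -/
def CompletedTensor.filtration (I : Ideal A) (J : Ideal B) (n : ℕ) : Ideal (CompletedTensor I J) :=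
  FormalQuotient.filtration (tensorIdeal I J) n

/-- The product bracket on `A ⊗ B`, extended by continuity to the completed tensor product. -/
def CompletedTensor.bracket (P : PoissonBracket A) (Q : PoissonBracket B) (I : Ideal A)
    (J : Ideal B) : PoissonBracket (CompletedTensor I J) :=
  (P.tensor Q).completion (tensorIdeal I J)

/-- The map of completed tensor products induced by `f` and `g`. -/
def CompletedTensor.map (I : Ideal A) (J : Ideal B) (I' : Ideal A') (J' : Ideal B')
    (f : A →ₐ[ℂ] A') (g : B →ₐ[ℂ] B') (hf : I ≤ I'.comap f) (hg : J ≤ J'.comap g) :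
    CompletedTensor I J →ₐ[ℂ] CompletedTensor I' J' :=
  complMap (tensorIdeal I J) (tensorIdeal I' J') (Algebra.TensorProduct.map f g) <| by
    refine sup_le (Ideal.map_le_iff_le_comap.mpr fun a ha => ?_)
      (Ideal.map_le_iff_le_comap.mpr fun b hb => ?_)
    · refine Ideal.mem_sup_left (?_ : Algebra.TensorProduct.map f g (a ⊗ₜ 1) ∈ _)
      rw [Algebra.TensorProduct.map_tmul, map_one]
      exact Ideal.mem_map_of_mem _ (hf ha)
    · refine Ideal.mem_sup_right (?_ : Algebra.TensorProduct.map f g (1 ⊗ₜ b) ∈ _)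
      rw [Algebra.TensorProduct.map_tmul, map_one]
      exact Ideal.mem_map_of_mem _ (hg hb)

/-- The continuous map out of a completed tensor product induced by maps `f`, `g` of its two
factors to a third adic algebra. -/
def CompletedTensor.lift {R : Type*} [CommRing R] [Algebra ℂ R] (I : Ideal A) (J : Ideal B)
    (K : Ideal R) (f : A →ₐ[ℂ] AdicCompletion K R) (g : B →ₐ[ℂ] AdicCompletion K R)
    (hf : I ≤ (idealOfDefinition K).comap f) (hg : J ≤ (idealOfDefinition K).comap g) :
    CompletedTensor I J →ₐ[ℂ] AdicCompletion K R :=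
  complLift (tensorIdeal I J) K (Algebra.TensorProduct.productMap f g) <| by
    refine sup_le (Ideal.map_le_iff_le_comap.mpr fun a ha => ?_)
      (Ideal.map_le_iff_le_comap.mpr fun b hb => ?_)
    · have : Algebra.TensorProduct.productMap f g (a ⊗ₜ 1) = f a := by simp
      exact (congrArg (· ∈ idealOfDefinition K) this).mpr (hf ha)
    · have : Algebra.TensorProduct.productMap f g (1 ⊗ₜ b) = g b := by simp
      exact (congrArg (· ∈ idealOfDefinition K) this).mpr (hg hb)

end CompletedTensor

/-! ### Polynomial functions and the bracket of a symplectic vector space -/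

section Polynomial

variable {V V' : Type*} [AddCommGroup V] [Module ℂ V] [AddCommGroup V'] [Module ℂ V']

/-- The algebra of polynomial functions on `V`: the functions generated by the linear forms. -/
def polyFun (V : Type*) [AddCommGroup V] [Module ℂ V] : Subalgebra ℂ (V → ℂ) :=
  Algebra.adjoin ℂ (Set.range fun (α : Module.Dual ℂ V) (x : V) => α x)

theorem dual_mem_polyFun (α : Module.Dual ℂ V) : (fun x => α x) ∈ polyFun V :=
  Algebra.subset_adjoin ⟨α, rfl⟩

theorem polyFun_comp (L : V →ₗ[ℂ] V') {f : V' → ℂ} (hf : f ∈ polyFun V') :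
    f ∘ L ∈ polyFun V := by
  induction hf using Algebra.adjoin_induction with
  | mem x hx => obtain ⟨α, rfl⟩ := hx; exact dual_mem_polyFun (α.comp L)
  | algebraMap r => exact (polyFun V).algebraMap_mem r
  | add x y _ _ hx hy => exact add_mem hx hy
  | mul x y _ _ hx hy => exact mul_mem hx hy

theorem exists_hasLineDerivAt {f : V → ℂ} (hf : f ∈ polyFun V) :
    ∃ D : V → Module.Dual ℂ V, ∀ x w, HasLineDerivAt ℂ f (D x w) x w := by
  induction hf using Algebra.adjoin_induction with
  | mem x hx =>
    obtain ⟨α, rfl⟩ := hx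
    refine ⟨fun _ => α, fun x w => ?_⟩
    have : HasDerivAt (fun t : ℂ => α x + t * α w) (α w) 0 := by
      simpa using ((hasDerivAt_id (0 : ℂ)).mul_const (α w)).const_add (α x)
    simpa [HasLineDerivAt] using this
  | algebraMap r => exact ⟨fun _ => 0, fun x w => hasDerivAt_const _ _⟩
  | add f g _ _ hf hg =>
    obtain ⟨D, hD⟩ := hf
    obtain ⟨E, hE⟩ := hg
    exact ⟨fun x => D x + E x, fun x w => (hD x w).add (hE x w)⟩
  | mul f g _ _ hf hg =>
    obtain ⟨D, hD⟩ := hf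
    obtain ⟨E, hE⟩ := hg
    refine ⟨fun x => g x • D x + f x • E x, fun x w => ?_⟩
    have := (hD x w).mul (hE x w)
    simp only [zero_smul, add_zero] at this
    have e : (g x • D x + f x • E x) w = D x w * g x + f x * E x w := by
      simp only [LinearMap.add_apply, LinearMap.smul_apply, smul_eq_mul]; ring
    rw [e]; exact this

/-- The differential at `x` of a polynomial function, a linear form on `V`. -/
def differential (f : polyFun V) (x : V) : Module.Dual ℂ V where
  toFun w := lineDeriv ℂ (f : V → ℂ) x w
  map_add' v w := by
    obtain ⟨D, hD⟩ := exists_hasLineDerivAt f.2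
    simp only [(hD _ _).lineDeriv, map_add]
  map_smul' c w := by
    obtain ⟨D, hD⟩ := exists_hasLineDerivAt f.2
    simp only [(hD _ _).lineDeriv, map_smul, RingHom.id_apply]

theorem hasLineDerivAt_differential (f : polyFun V) (x w : V) :
    HasLineDerivAt ℂ (f : V → ℂ) (differential f x w) x w := by
  obtain ⟨D, hD⟩ := exists_hasLineDerivAt f.2
  have : differential f x w = D x w := (hD x w).lineDeriv
  rw [this]; exact hD x w

theorem differential_add (f g : polyFun V) (x : V) :
    differential (f + g) x = differential f x + differential g x := by
  ext w
  exact ((hasLineDerivAt_differential f x w).add (hasLineDerivAt_differential g x w)).deriv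

theorem differential_smul (c : ℂ) (f : polyFun V) (x : V) :
    differential (c • f) x = c • differential f x := by
  ext w
  exact ((hasLineDerivAt_differential f x w).const_smul c).deriv

theorem differential_mul (f g : polyFun V) (x : V) :
    differential (f * g) x = (g : V → ℂ) x • differential f x +
      (f : V → ℂ) x • differential g x := by
  ext w
  have := ((hasLineDerivAt_differential f x w).mul (hasLineDerivAt_differential g x w)).deriv
  simp only [zero_smul, add_zero] at this
  refine this.trans ?_
  simp; ring

theorem differential_algebraMap (c : ℂ) (x : V) :
    differential (algebraMap ℂ (polyFun V) c) x = 0 := by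
  ext w
  exact (hasDerivAt_const (0 : ℂ) c).deriv

theorem differential_dual (α : Module.Dual ℂ V) (x : V) :
    differential ⟨fun x => α x, dual_mem_polyFun α⟩ x = α := by
  ext w
  have : HasDerivAt (fun t : ℂ => α x + t * α w) (α w) 0 := by
    simpa using ((hasDerivAt_id (0 : ℂ)).mul_const (α w)).const_add (α x)
  refine HasDerivAt.deriv ?_
  simpa using this

theorem differential_comp (L : V →ₗ[ℂ] V') (f : polyFun V') (x w : V) :
    differential (⟨(f : V' → ℂ) ∘ L, polyFun_comp L f.2⟩ : polyFun V) x w =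
      differential f (L x) (L w) := by
  change lineDeriv ℂ ((f : V' → ℂ) ∘ L) x w = lineDeriv ℂ (f : V' → ℂ) (L x) (L w)
  simp [lineDeriv]

/-- A symplectic form on `V`: a nondegenerate alternating bilinear form. -/
structure IsSymplecticForm (ω : LinearMap.BilinForm ℂ V) : Prop where
  alt : ω.IsAlt
  nondegenerate : ω.Nondegenerate

variable {ω : LinearMap.BilinForm ℂ V}

section Bracket

variable [FiniteDimensional ℂ V]

/-- The Hamiltonian vector field `X_f`, determined by `ω (X_f x) w = d_x f w` for all `w`. -/
def hamiltonianField (hω : IsSymplecticForm ω) (f : polyFun V) (x : V) : V :=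
  (ω.toDual hω.nondegenerate).symm (differential f x)

theorem hamiltonianField_spec (hω : IsSymplecticForm ω) (f : polyFun V) (x w : V) :
    ω (hamiltonianField hω f x) w = differential f x w :=
  LinearMap.BilinForm.apply_toDual_symm_apply ..

theorem hamiltonianField_add (hω : IsSymplecticForm ω) (f g : polyFun V) (x : V) :
    hamiltonianField hω (f + g) x = hamiltonianField hω f x + hamiltonianField hω g x := by
  simp [hamiltonianField, differential_add]

theorem hamiltonianField_smul (hω : IsSymplecticForm ω) (c : ℂ) (f : polyFun V) (x : V) :
    hamiltonianField hω (c • f) x = c • hamiltonianField hω f x := by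
  simp [hamiltonianField, differential_smul]

theorem hamiltonianField_mul (hω : IsSymplecticForm ω) (f g : polyFun V) (x : V) :
    hamiltonianField hω (f * g) x = (g : V → ℂ) x • hamiltonianField hω f x +
      (f : V → ℂ) x • hamiltonianField hω g x := by
  simp [hamiltonianField, differential_mul]

theorem hamiltonianField_algebraMap (hω : IsSymplecticForm ω) (c : ℂ) (x : V) :
    hamiltonianField hω (algebraMap ℂ (polyFun V) c) x = 0 := by
  simp [hamiltonianField, differential_algebraMap]

theorem bracketFun_mem (hω : IsSymplecticForm ω) (f g : polyFun V) :
    (fun x => ω (hamiltonianField hω f x) (hamiltonianField hω g x)) ∈ polyFun V := by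
  obtain ⟨f, hf⟩ := f
  obtain ⟨g, hg⟩ := g
  induction hf using Algebra.adjoin_induction with
  | mem f hf =>
    obtain ⟨α, rfl⟩ := hf
    induction hg using Algebra.adjoin_induction with
    | mem g hg =>
      obtain ⟨β, rfl⟩ := hg
      convert (polyFun V).algebraMap_mem
        (ω ((ω.toDual hω.nondegenerate).symm α) ((ω.toDual hω.nondegenerate).symm β)) using 1
      funext x
      simp only [hamiltonianField, differential_dual]
      rfl
    | algebraMap r =>
      convert (polyFun V).zero_mem using 1
      funext x
      have := hamiltonianField_algebraMap hω r x
      erw [this]; simp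
    | add g g' hg hg' h h' =>
      refine (congrArg (· ∈ polyFun V) (funext fun x => ?_)).mpr (add_mem h h')
      have := hamiltonianField_add hω ⟨g, hg⟩ ⟨g', hg'⟩ x
      erw [this]; simp
    | mul g g' hg hg' h h' =>
      refine (congrArg (· ∈ polyFun V) (funext fun x => ?_)).mpr
        (add_mem (mul_mem hg' h) (mul_mem hg h'))
      have := hamiltonianField_mul hω ⟨g, hg⟩ ⟨g', hg'⟩ x
      erw [this]; simp
  | algebraMap r =>
    convert (polyFun V).zero_mem using 1
    funext x
    have := hamiltonianField_algebraMap hω r x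
    erw [this]; simp
  | add f f' hf hf' h h' =>
    refine (congrArg (· ∈ polyFun V) (funext fun x => ?_)).mpr (add_mem h h')
    have := hamiltonianField_add hω ⟨f, hf⟩ ⟨f', hf'⟩ x
    erw [this]; simp
  | mul f f' hf hf' h h' =>
    refine (congrArg (· ∈ polyFun V) (funext fun x => ?_)).mpr
      (add_mem (mul_mem hf' h) (mul_mem hf h'))
    have := hamiltonianField_mul hω ⟨f, hf⟩ ⟨f', hf'⟩ x
    erw [this]; simp

/-- `{f, g} = ω(X_f, X_g)` as a skew biderivation. -/
def symplecticBiderivation (hω : IsSymplecticForm ω) : SkewBiderivation (polyFun V) where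
  bracket := LinearMap.mk₂ ℂ
    (fun f g => ⟨fun x => ω (hamiltonianField hω f x) (hamiltonianField hω g x),
      bracketFun_mem hω f g⟩)
    (fun f f' g => Subtype.ext <| funext fun x => by simp [hamiltonianField_add])
    (fun c f g => Subtype.ext <| funext fun x => by simp [hamiltonianField_smul])
    (fun f g g' => Subtype.ext <| funext fun x => by simp [hamiltonianField_add])
    (fun c f g => Subtype.ext <| funext fun x => by simp [hamiltonianField_smul])
  self f := Subtype.ext <| funext fun x => by simp [hω.alt.self_eq_zero]
  leibniz f g g' := Subtype.ext <| funext fun x => by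
    simp [hamiltonianField_mul]; ring

/-- The Poisson bracket `{f, g}(x) = ω(X_f(x), X_g(x))` of a symplectic vector space. -/
def symplecticBracket (hω : IsSymplecticForm ω) : PoissonBracket (polyFun V) where
  toSkewBiderivation := symplecticBiderivation hω
  jacobi := by
    apply SkewBiderivation.jacobiator_eq_zero_of_adjoin _ _ Algebra.adjoin_adjoin_coe_preimage
    set Q := symplecticBiderivation hω
    have h : ∀ a b c : polyFun V, b ∈ ((↑) : polyFun V → V → ℂ) ⁻¹'
          Set.range (fun (α : Module.Dual ℂ V) (x : V) => α x) →
        c ∈ ((↑) : polyFun V → V → ℂ) ⁻¹' Set.range (fun (α : Module.Dual ℂ V) (x : V) => α x) →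
        Q.bracket a (Q.bracket b c) = 0 := by
      rintro a ⟨b, hb⟩ ⟨c, hc⟩ ⟨β, rfl⟩ ⟨γ, rfl⟩
      have : Q.bracket ⟨_, hb⟩ ⟨_, hc⟩ = algebraMap ℂ (polyFun V)
          (ω ((ω.toDual hω.nondegenerate).symm β) ((ω.toDual hω.nondegenerate).symm γ)) := by
        apply Subtype.ext
        funext x
        simp only [Q, symplecticBiderivation, LinearMap.mk₂_apply, hamiltonianField,
          differential_dual]
        rfl
      rw [this, Q.bracket_algebraMap]
    intro a ha b hb c hc
    simp only [SkewBiderivation.jacobiator, h _ _ _ hb hc, h _ _ _ hc ha, h _ _ _ ha hb, add_zero]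

theorem symplecticBracket_apply (hω : IsSymplecticForm ω) (f g : polyFun V) (x : V) :
    ((symplecticBracket hω).bracket f g : V → ℂ) x =
      ω (hamiltonianField hω f x) (hamiltonianField hω g x) := rfl

/-- A linear automorphism preserving `ω` preserves the bracket. -/
theorem symplecticBracket_comp (hω : IsSymplecticForm ω) (g : V ≃ₗ[ℂ] V)
    (hg : ∀ x y, ω (g x) (g y) = ω x y) (a b : polyFun V) (x : V) :
    ((symplecticBracket hω).bracket ⟨(a : V → ℂ) ∘ g, polyFun_comp g.toLinearMap a.2⟩
      ⟨(b : V → ℂ) ∘ g, polyFun_comp g.toLinearMap b.2⟩ : V → ℂ) x =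
      ((symplecticBracket hω).bracket a b : V → ℂ) (g x) := by
  have key : ∀ f : polyFun V, g (hamiltonianField hω
      ⟨(f : V → ℂ) ∘ g, polyFun_comp g.toLinearMap f.2⟩ x) = hamiltonianField hω f (g x) := by
    intro f
    rw [← sub_eq_zero]
    refine hω.nondegenerate.1 _ fun y => ?_
    obtain ⟨w, rfl⟩ := g.surjective y
    rw [map_sub, LinearMap.sub_apply, hg, hamiltonianField_spec, hamiltonianField_spec, sub_eq_zero]
    exact differential_comp g.toLinearMap f x w
  rw [symplecticBracket_apply, symplecticBracket_apply, ← key, ← key, hg]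

end Bracket

/-! ### Quotients by finite groups -/

/-- The algebra `ℂ[V]^G` of invariant polynomial functions, i.e. of functions on `V / G`. -/
def invariants (G : Subgroup (V ≃ₗ[ℂ] V)) : Subalgebra ℂ (V → ℂ) where
  carrier := {f | f ∈ polyFun V ∧ ∀ g ∈ G, ∀ x, f (g x) = f x}
  mul_mem' hf hf' := ⟨mul_mem hf.1 hf'.1, fun g hg x => by simp [hf.2 g hg x, hf'.2 g hg x]⟩
  add_mem' hf hf' := ⟨add_mem hf.1 hf'.1, fun g hg x => by simp [hf.2 g hg x, hf'.2 g hg x]⟩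
  algebraMap_mem' c := ⟨(polyFun V).algebraMap_mem c, fun _ _ _ => rfl⟩

/-- `G` acts by symplectic transformations. -/
def Preserves (ω : LinearMap.BilinForm ℂ V) (G : Subgroup (V ≃ₗ[ℂ] V)) : Prop :=
  ∀ g ∈ G, ∀ x y, ω (g x) (g y) = ω x y

/-- The Poisson bracket on the functions on `V / G`: the restriction of the bracket of `ℂ[V]`
to invariants. -/
def quotientBracket [FiniteDimensional ℂ V] (hω : IsSymplecticForm ω) {G : Subgroup (V ≃ₗ[ℂ] V)} (hG : Preserves ω G) :
    PoissonBracket (invariants G) :=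
  (symplecticBracket hω).induced (Subalgebra.inclusion fun _ hf => hf.1)
    (Subalgebra.inclusion_injective _) fun a b => by
      refine ⟨⟨((symplecticBracket hω).bracket ⟨a.1, a.2.1⟩ ⟨b.1, b.2.1⟩ : polyFun V).1,
        ((symplecticBracket hω).bracket ⟨a.1, a.2.1⟩ ⟨b.1, b.2.1⟩).2, fun g hg x => ?_⟩, rfl⟩
      have h := symplecticBracket_comp hω g (hG g hg) ⟨a.1, a.2.1⟩ ⟨b.1, b.2.1⟩ x
      have ha : (a : V → ℂ) ∘ g = a := funext (a.2.2 g hg)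
      have hb : (b : V → ℂ) ∘ g = b := funext (b.2.2 g hg)
      simp only [ha, hb] at h
      exact h.symm

/-- The group of automorphisms of a subspace `U` obtained by restricting those elements of `G`
that preserve `U`. -/
def inducedGroup (G : Subgroup (V ≃ₗ[ℂ] V)) (U : Submodule ℂ V) : Subgroup (U ≃ₗ[ℂ] U) where
  carrier := {h | ∃ g ∈ G, ∀ u : U, (h u : V) = g u}
  mul_mem' := by
    rintro h h' ⟨g, hg, e⟩ ⟨g', hg', e'⟩
    exact ⟨g * g', mul_mem hg hg', fun u => by
      rw [LinearEquiv.mul_apply, e, e', LinearEquiv.mul_apply]⟩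
  one_mem' := ⟨1, one_mem _, fun _ => rfl⟩
  inv_mem' := by
    rintro h ⟨g, hg, e⟩
    refine ⟨g⁻¹, inv_mem hg, fun u => ?_⟩
    change ((h.symm u : U) : V) = g.symm u
    rw [LinearEquiv.eq_symm_apply, ← e, h.apply_symm_apply]

theorem inducedGroup_preserves {G : Subgroup (V ≃ₗ[ℂ] V)} (hG : Preserves ω G)
    (U : Submodule ℂ V) : Preserves (ω.restrict U) (inducedGroup G U) := by
  rintro h ⟨g, hg, e⟩ x y
  simp only [LinearMap.BilinForm.restrict_apply, LinearMap.domRestrict_apply, e, hG g hg]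

/-- The fixed subspace `V^G`. -/
def fixedSpace (G : Subgroup (V ≃ₗ[ℂ] V)) : Submodule ℂ V where
  carrier := {x | ∀ g ∈ G, g x = x}
  add_mem' hx hy g hg := by rw [map_add, hx g hg, hy g hg]
  zero_mem' g _ := map_zero g
  smul_mem' c x hx g hg := by rw [map_smul, hx g hg]

/-- The symplectic complement `(V^G)^⊥`. -/
def slice (ω : LinearMap.BilinForm ℂ V) (G : Subgroup (V ≃ₗ[ℂ] V)) : Submodule ℂ V :=
  ω.orthogonal (fixedSpace G)

theorem fixedSpace_symplectic (hω : IsSymplecticForm ω) {G : Subgroup (V ≃ₗ[ℂ] V)} [Finite G]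
    (hG : Preserves ω G) : IsSymplecticForm (ω.restrict (fixedSpace G)) := by
  have := Fintype.ofFinite G
  have alt : (ω.restrict (fixedSpace G)).IsAlt := fun x => hω.alt x
  refine ⟨alt, ?_⟩
  apply LinearMap.BilinForm.nondegenerate_restrict_of_disjoint_orthogonal ω hω.alt.isRefl
  rw [Submodule.disjoint_def]
  intro u hu hu'
  refine hω.nondegenerate.1 u fun y => ?_
  have hs : (∑ g : G, (g : V ≃ₗ[ℂ] V) y) ∈ fixedSpace G := by
    intro h hh
    rw [map_sum]
    exact Fintype.sum_equiv (Equiv.mulLeft (⟨h, hh⟩ : G)) _ _ fun g => rfl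
  have h1 : ω u (∑ g : G, (g : V ≃ₗ[ℂ] V) y) = 0 :=
    hω.alt.isRefl _ _ (hu' _ hs)
  have h2 : ∀ g : G, ω u ((g : V ≃ₗ[ℂ] V) y) = ω u y := fun g => by
    conv_lhs => rw [← hu g g.2]
    exact hG g g.2 u y
  rw [map_sum, Finset.sum_congr rfl fun g _ => h2 g, Finset.sum_const, nsmul_eq_mul] at h1
  exact (mul_eq_zero.mp h1).resolve_left (by simp)

theorem slice_symplectic [FiniteDimensional ℂ V] (hω : IsSymplecticForm ω) {G : Subgroup (V ≃ₗ[ℂ] V)} [Finite G]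
    (hG : Preserves ω G) : IsSymplecticForm (ω.restrict (slice ω G)) := by
  have alt : (ω.restrict (slice ω G)).IsAlt := fun x => hω.alt x
  refine ⟨alt, ?_⟩
  apply LinearMap.BilinForm.nondegenerate_restrict_of_disjoint_orthogonal ω hω.alt.isRefl
  rw [slice, LinearMap.BilinForm.orthogonal_orthogonal hω.nondegenerate hω.alt.isRefl]
  exact ((LinearMap.BilinForm.isCompl_orthogonal_of_restrict_nondegenerate hω.alt.isRefl
    (fixedSpace_symplectic hω hG).nondegenerate).disjoint).symm

end Polynomial

/-! ### Completion of a localization -/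

section LocCompletion

variable {A B C : Type*} [CommRing A] [CommRing B] [CommRing C]

/-- The ideal of `S⁻¹A` generated by `I`. -/
def locIdeal (S : Submonoid A) (I : Ideal A) : Ideal (Localization S) :=
  I.map (algebraMap A (Localization S))

/-- The completion of `S⁻¹A` along the ideal generated by `I`. -/
def LocCompletion (S : Submonoid A) (I : Ideal A) : Type _ :=
  AdicCompletion (locIdeal S I) (Localization S)

instance (S : Submonoid A) (I : Ideal A) : CommRing (LocCompletion S I) :=
  inferInstanceAs (CommRing (AdicCompletion (locIdeal S I) (Localization S)))

variable [Algebra ℂ A] [Algebra ℂ B] [Algebra ℂ C]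

instance (S : Submonoid A) (I : Ideal A) : Algebra ℂ (LocCompletion S I) :=
  inferInstanceAs (Algebra ℂ (AdicCompletion (locIdeal S I) (Localization S)))

/-- The filtration defining the topology of the completion. -/
def locFiltration (S : Submonoid A) (I : Ideal A) (n : ℕ) : Ideal (LocCompletion S I) :=
  filtration (locIdeal S I) n

/-- The bracket on the completion of `S⁻¹A` extending a bracket of `A`. -/
def locBracket (P : PoissonBracket A) (S : Submonoid A) (I : Ideal A) :
    PoissonBracket (LocCompletion S I) :=
  (P.localization S).completion (locIdeal S I)

/-- The map of localizations induced by `f : A → B`. -/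
def locMap (S : Submonoid A) (T : Submonoid B) (f : A →ₐ[ℂ] B) (hS : S ≤ T.comap f) :
    Localization S →ₐ[ℂ] Localization T where
  __ := IsLocalization.map (M := S) (T := T) (Localization T) f.toRingHom hS
  commutes' c := by
    rw [IsScalarTower.algebraMap_apply ℂ A (Localization S),
      IsScalarTower.algebraMap_apply ℂ B (Localization T)]
    exact (IsLocalization.map_eq _ _).trans (congrArg _ (f.commutes c))

theorem locMap_algebraMap (S : Submonoid A) (T : Submonoid B) (f : A →ₐ[ℂ] B)
    (hS : S ≤ T.comap f) (a : A) :
    locMap S T f hS (algebraMap A _ a) = algebraMap B _ (f a) :=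
  IsLocalization.map_eq (M := S) (T := T) (Q := Localization T) hS a

theorem locMap_ideal (S : Submonoid A) (T : Submonoid B) (I : Ideal A) (J : Ideal B)
    (f : A →ₐ[ℂ] B) (hS : S ≤ T.comap f) (hI : I ≤ J.comap f) :
    locIdeal S I ≤ (locIdeal T J).comap (locMap S T f hS) := by
  refine Ideal.map_le_iff_le_comap.mpr fun a ha => ?_
  change locMap S T f hS (algebraMap A _ a) ∈ locIdeal T J
  rw [locMap_algebraMap]
  exact Ideal.mem_map_of_mem _ (hI ha)

/-- The continuous map of completions induced by `f : A → B`. -/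
def locComplMap (S : Submonoid A) (T : Submonoid B) (I : Ideal A) (J : Ideal B)
    (f : A →ₐ[ℂ] B) (hS : S ≤ T.comap f) (hI : I ≤ J.comap f) :
    LocCompletion S I →ₐ[ℂ] LocCompletion T J :=
  complMap (locIdeal S I) (locIdeal T J) (locMap S T f hS) (locMap_ideal S T I J f hS hI)

theorem locComplMap_ideal (S : Submonoid A) (T : Submonoid B) (I : Ideal A) (J : Ideal B)
    (f : A →ₐ[ℂ] B) (hS : S ≤ T.comap f) (hI : I ≤ J.comap f) :
    locFiltration S I 1 ≤ (locFiltration T J 1).comap (locComplMap S T I J f hS hI) := by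
  intro x hx
  change AdicCompletion.evalₐ (locIdeal T J) 1
    (complMap (locIdeal S I) (locIdeal T J) (locMap S T f hS) _ x) = 0
  rw [complMap_eval _ _ _ _ x 1 (t := 0) (by rw [map_zero]; exact hx.symm), map_zero, map_zero]

theorem locComplMap_comp (S : Submonoid A) (T : Submonoid B) (U : Submonoid C) (I : Ideal A)
    (J : Ideal B) (K : Ideal C) (f : A →ₐ[ℂ] B) (hS : S ≤ T.comap f) (hI : I ≤ J.comap f)
    (g : B →ₐ[ℂ] C) (hT : T ≤ U.comap g) (hJ : J ≤ K.comap g) (h : A →ₐ[ℂ] C)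
    (hh : h = g.comp f) (hU : S ≤ U.comap h) (hK : I ≤ K.comap h) (x : LocCompletion S I) :
    locComplMap T U J K g hT hJ (locComplMap S T I J f hS hI x) = locComplMap S U I K h hU hK x := by
  subst hh
  have e : (locMap T U g hT).comp (locMap S T f hS) = locMap S U (g.comp f) hU := by
    apply AlgHom.coe_ringHom_injective
    apply IsLocalization.ringHom_ext S
    ext a
    change locMap T U g hT (locMap S T f hS (algebraMap A _ a)) =
      locMap S U (g.comp f) hU (algebraMap A _ a)
    simp only [locMap_algebraMap]
    rfl
  have h := locMap_ideal S U I K (g.comp f) hU hK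
  rw [← e] at h
  refine (complMap_complMap _ _ _ _ _ _ _ h x).trans ?_
  unfold locComplMap
  simp only [e]
  rfl

theorem locComplMap_bracket (S : Submonoid A) (T : Submonoid B) (I : Ideal A) (J : Ideal B)
    (f : A →ₐ[ℂ] B) (hS : S ≤ T.comap f) (hI : I ≤ J.comap f)
    (P : PoissonBracket A) (Q : PoissonBracket B)
    (h : ∀ a b, f (P.bracket a b) = Q.bracket (f a) (f b)) (x y : LocCompletion S I) :
    locComplMap S T I J f hS hI ((locBracket P S I).bracket x y) =
      (locBracket Q T J).bracket (locComplMap S T I J f hS hI x)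
        (locComplMap S T I J f hS hI y) := by
  refine complMap_bracket _ _ _ _ _ _ (fun a b => ?_) x y
  refine P.localization_hom _ (Q.localization _) (locMap S T f hS).toRingHom (fun a b => ?_) a b
  change locMap S T f hS (algebraMap A _ _) = (Q.localization _).bracket
    (locMap S T f hS (algebraMap A _ _)) (locMap S T f hS (algebraMap A _ _))
  simp only [locMap_algebraMap, h, PoissonBracket.localization_algebraMap]

end LocCompletion

/-! ### Formal neighbourhoods -/

section FormalNeighbourhood

variable {α β γ : Type*}

/-- The functions in `R` that vanish nowhere on `Y`. -/
def nonvanishing (R : Subalgebra ℂ (α → ℂ)) (Y : Set α) : Submonoid R where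
  carrier := {f | ∀ y ∈ Y, (f : α → ℂ) y ≠ 0}
  mul_mem' hf hg y hy := mul_ne_zero (hf y hy) (hg y hy)
  one_mem' _ _ := one_ne_zero

/-- The functions in `R` that vanish on `Y`. -/
def vanishing (R : Subalgebra ℂ (α → ℂ)) (Y : Set α) : Ideal R where
  carrier := {f | ∀ y ∈ Y, (f : α → ℂ) y = 0}
  add_mem' hf hg y hy := by simp [hf y hy, hg y hy]
  zero_mem' _ _ := rfl
  smul_mem' c f hf y hy := by simp [hf y hy]

/-- Let `X` be the affine variety with algebra of functions `R`, and let `Y` be (the preimage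
in `α` of) a subvariety of `X` which is closed in a principal open affine subset `U` of `X`.
This is the algebra of functions on the formal neighbourhood of `Y` in `X`, that is, the completion
of `𝒪(U)` along the ideal of `Y`. Every function without zeros on `Y` is invertible on each
infinitesimal neighbourhood of the closed subvariety `Y` of `U`, so that, in order not to choose
`U`, one may invert all these functions before completing. -/
abbrev FormalFunctions (R : Subalgebra ℂ (α → ℂ)) (Y : Set α) : Type _ :=
  LocCompletion (nonvanishing R Y) (vanishing R Y)

/-- The filtration of `lim 𝒪(U) / I_Y ^ m` by the kernels of the maps to `𝒪(U) / I_Y ^ n`; it defines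
the topology of the algebra of functions on the formal neighbourhood. -/
abbrev formalFiltration (R : Subalgebra ℂ (α → ℂ)) (Y : Set α) (n : ℕ) :
    Ideal (FormalFunctions R Y) :=
  locFiltration (nonvanishing R Y) (vanishing R Y) n

/-- The ideal of `Y` in the algebra of functions on its formal neighbourhood. -/
abbrev formalIdeal (R : Subalgebra ℂ (α → ℂ)) (Y : Set α) : Ideal (FormalFunctions R Y) :=
  formalFiltration R Y 1

/-- Pull-back of functions along `L : α → β`. -/
def pullback {R : Subalgebra ℂ (α → ℂ)} {R' : Subalgebra ℂ (β → ℂ)} (L : α → β)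
    (hR : ∀ f ∈ R', f ∘ L ∈ R) : R' →ₐ[ℂ] R where
  toFun f := ⟨(f : β → ℂ) ∘ L, hR f f.2⟩
  map_one' := rfl
  map_mul' _ _ := rfl
  map_zero' := rfl
  map_add' _ _ := rfl
  commutes' _ := rfl

/-- Pull-back of functions on formal neighbourhoods. -/
def formalPullback {R : Subalgebra ℂ (α → ℂ)} {R' : Subalgebra ℂ (β → ℂ)} {Y : Set α} {Y' : Set β}
    (L : α → β) (hR : ∀ f ∈ R', f ∘ L ∈ R) (hY : Set.MapsTo L Y Y') :
    FormalFunctions R' Y' →ₐ[ℂ] FormalFunctions R Y :=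
  locComplMap _ _ _ _ (pullback L hR) (fun _ hf y hy => hf (L y) (hY hy))
    (fun _ hf y hy => hf (L y) (hY hy))

theorem formalPullback_ideal {R : Subalgebra ℂ (α → ℂ)} {R' : Subalgebra ℂ (β → ℂ)} {Y : Set α}
    {Y' : Set β} (L : α → β) (hR : ∀ f ∈ R', f ∘ L ∈ R) (hY : Set.MapsTo L Y Y') :
    formalIdeal R' Y' ≤ (formalIdeal R Y).comap (formalPullback L hR hY) :=
  locComplMap_ideal _ _ _ _ _ _ _

theorem formalPullback_formalPullback {R : Subalgebra ℂ (α → ℂ)} {R' : Subalgebra ℂ (β → ℂ)}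
    {R'' : Subalgebra ℂ (γ → ℂ)} {Y : Set α} {Y' : Set β} {Y'' : Set γ}
    (L : α → β) (hR : ∀ f ∈ R', f ∘ L ∈ R) (hY : Set.MapsTo L Y Y')
    (M : β → γ) (hR' : ∀ f ∈ R'', f ∘ M ∈ R') (hY' : Set.MapsTo M Y' Y'')
    (N : α → γ) (hN : N = M ∘ L) (hR'' : ∀ f ∈ R'', f ∘ N ∈ R) (hY'' : Set.MapsTo N Y Y'')
    (x : FormalFunctions R'' Y'') :
    formalPullback L hR hY (formalPullback M hR' hY' x) = formalPullback N hR'' hY'' x :=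
  locComplMap_comp _ _ _ _ _ _ _ _ _ _ _ _ _ (by subst hN; rfl) _ _ x

/-- The bracket on the formal neighbourhood of `Y`: the unique continuous extension of the bracket
of `R`. -/
def formalBracket {R : Subalgebra ℂ (α → ℂ)} (P : PoissonBracket R) (Y : Set α) :
    PoissonBracket (FormalFunctions R Y) :=
  locBracket P (nonvanishing R Y) (vanishing R Y)

theorem formalPullback_bracket {R : Subalgebra ℂ (α → ℂ)} {R' : Subalgebra ℂ (β → ℂ)} {Y : Set α}
    {Y' : Set β} (L : α → β) (hR : ∀ f ∈ R', f ∘ L ∈ R) (hY : Set.MapsTo L Y Y')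
    (P : PoissonBracket R') (Q : PoissonBracket R)
    (h : ∀ a b, pullback L hR (P.bracket a b) = Q.bracket (pullback L hR a) (pullback L hR b))
    (x y : FormalFunctions R' Y') :
    formalPullback L hR hY ((formalBracket P Y').bracket x y) =
      (formalBracket Q Y).bracket (formalPullback L hR hY x) (formalPullback L hR hY y) :=
  locComplMap_bracket _ _ _ _ _ _ _ P Q h x y

end FormalNeighbourhood

section Vector

variable {V V' : Type*} [AddCommGroup V] [Module ℂ V] [AddCommGroup V'] [Module ℂ V']

theorem polyFun_smul (c : ℂˣ) (f : V → ℂ) (hf : f ∈ polyFun V) : f ∘ (c • ·) ∈ polyFun V :=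
  polyFun_comp (LinearMap.lsmul ℂ V (c : ℂ)) hf

theorem invariants_smul (G : Subgroup (V ≃ₗ[ℂ] V)) (c : ℂˣ) (f : V → ℂ) (hf : f ∈ invariants G) :
    f ∘ (c • ·) ∈ invariants G :=
  ⟨polyFun_smul c f hf.1, fun g hg x => by
    change f ((c : ℂ) • g x) = f ((c : ℂ) • x)
    rw [← map_smul, hf.2 g hg]⟩

/-! #### The quotient of the formal neighbourhood of the origin -/

theorem mapsTo_zero (L : V →ₗ[ℂ] V') : Set.MapsTo L {0} {0} := by
  rintro _ rfl; exact map_zero L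

/-- The functions on the formal neighbourhood of the origin in `V`. -/
abbrev OriginFunctions (V : Type*) [AddCommGroup V] [Module ℂ V] : Type _ :=
  FormalFunctions (polyFun V) ({0} : Set V)

/-- The action of a linear map on functions on the formal neighbourhoods of the origins. -/
def originPullback (L : V →ₗ[ℂ] V') : OriginFunctions V' →ₐ[ℂ] OriginFunctions V :=
  formalPullback L (fun _ hf => polyFun_comp L hf) (mapsTo_zero L)

theorem originPullback_comp {V'' : Type*} [AddCommGroup V''] [Module ℂ V''] (L : V →ₗ[ℂ] V')
    (M : V' →ₗ[ℂ] V'') (x : OriginFunctions V'') :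
    originPullback L (originPullback M x) = originPullback (M.comp L) x :=
  formalPullback_formalPullback _ _ _ _ _ _ _ rfl _ _ x

/-- The algebra of functions on `V^ / G`, where `V^` is the formal neighbourhood of the origin:
the `G`-invariant functions on `V^`. -/
def originInvariants (G : Subgroup (V ≃ₗ[ℂ] V)) : Subalgebra ℂ (OriginFunctions V) where
  carrier := {x | ∀ g ∈ G, originPullback g.toLinearMap x = x}
  mul_mem' hx hy g hg := by rw [map_mul, hx g hg, hy g hg]
  add_mem' hx hy g hg := by rw [map_add, hx g hg, hy g hg]
  algebraMap_mem' c g _ := AlgHom.commutes _ c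

/-- The maximal ideal of `originInvariants G`: the functions vanishing at the origin. -/
def originIdeal (G : Subgroup (V ≃ₗ[ℂ] V)) : Ideal (originInvariants G) :=
  (formalIdeal (polyFun V) {0}).comap (originInvariants G).val

theorem originPullback_bracket [FiniteDimensional ℂ V] {ω : LinearMap.BilinForm ℂ V}
    (hω : IsSymplecticForm ω) (g : V ≃ₗ[ℂ] V) (hg : ∀ x y, ω (g x) (g y) = ω x y)
    (x y : OriginFunctions V) :
    originPullback g.toLinearMap ((formalBracket (symplecticBracket hω) {0}).bracket x y) =
      (formalBracket (symplecticBracket hω) {0}).bracket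
        (originPullback g.toLinearMap x) (originPullback g.toLinearMap y) :=
  formalPullback_bracket _ _ _ (symplecticBracket hω) (symplecticBracket hω)
    (fun a b => Subtype.ext <| funext fun x => (symplecticBracket_comp hω g hg a b x).symm) x y

/-- The restriction of the bracket of the formal neighbourhood of the origin to invariants. -/
def originBracket [FiniteDimensional ℂ V] {ω : LinearMap.BilinForm ℂ V} (hω : IsSymplecticForm ω)
    {G : Subgroup (V ≃ₗ[ℂ] V)} (hG : Preserves ω G) : PoissonBracket (originInvariants G) :=
  (formalBracket (symplecticBracket hω) {0}).induced (originInvariants G).val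
    Subtype.val_injective fun a b =>
      ⟨⟨(formalBracket (symplecticBracket hω) {0}).bracket a.1 b.1, fun g hg => by
        rw [originPullback_bracket hω g (hG g hg), a.2 g hg, b.2 g hg]⟩, rfl⟩

/-- The action of `c ∈ ℂˣ` on functions on `V^ / G`, by dilation of `V`. -/
def originDilation (G : Subgroup (V ≃ₗ[ℂ] V)) (c : ℂˣ) :
    originInvariants G →ₐ[ℂ] originInvariants G :=
  ((originPullback (LinearMap.lsmul ℂ V (c : ℂ))).comp (originInvariants G).val).codRestrict
    (originInvariants G) fun x g hg => by
      refine (originPullback_comp _ _ x.1).trans ?_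
      have e : (LinearMap.lsmul ℂ V (c : ℂ)).comp g.toLinearMap =
          g.toLinearMap.comp (LinearMap.lsmul ℂ V (c : ℂ)) := by
        ext y; simp
      rw [e]
      refine (originPullback_comp _ _ x.1).symm.trans ?_
      exact congrArg _ (x.2 g hg)

theorem originDilation_ideal (G : Subgroup (V ≃ₗ[ℂ] V)) (c : ℂˣ) :
    originIdeal G ≤ (originIdeal G).comap (originDilation G c) :=
  fun _ hx => formalPullback_ideal _ _ (mapsTo_zero _) hx

end Vector

/-! ### The objects of the decomposition -/

section Decomposition

variable {V : Type*} [AddCommGroup V] [Module ℂ V]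

theorem Preserves.mono {ω : LinearMap.BilinForm ℂ V} {G H : Subgroup (V ≃ₗ[ℂ] V)}
    (hG : Preserves ω G) (h : H ≤ G) : Preserves ω H := fun g hg => hG g (h hg)

theorem finite_of_le {G H : Subgroup (V ≃ₗ[ℂ] V)} [Finite G] (h : H ≤ G) : Finite H :=
  Finite.of_injective _ (Subgroup.inclusion_injective h)

/-- The orbit `ℂˣ · v`. -/
def puncturedLine (v : V) : Set V := {x | ∃ c : ℂˣ, x = c • v}

theorem puncturedLine_smul (v : V) (c : ℂˣ) :
    Set.MapsTo (c • ·) (puncturedLine v) (puncturedLine v) := by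
  rintro _ ⟨d, rfl⟩; exact ⟨c * d, (mul_smul c d v).symm⟩

/-- The orbit `ℂˣ · v` as a subset of a subspace `U` (containing `v`). -/
def puncturedLineIn (U : Submodule ℂ V) (v : V) : Set U := {x | (x : V) ∈ puncturedLine v}

theorem puncturedLineIn_smul (U : Submodule ℂ V) (v : V) (c : ℂˣ) :
    Set.MapsTo (c • ·) (puncturedLineIn U v) (puncturedLineIn U v) :=
  fun x hx => puncturedLine_smul v c (x := (x : V)) hx

/-- Functions on the formal neighbourhood of `ℂˣ · v̄` in `X = V / Γ`. -/
abbrev QuotientNbhd (Γ : Subgroup (V ≃ₗ[ℂ] V)) (v : V) : Type _ :=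
  FormalFunctions (invariants Γ) (puncturedLine v)

/-- The Poisson bracket of the formal neighbourhood of `ℂˣ · v̄` in `X`. -/
def quotientNbhdBracket [FiniteDimensional ℂ V] {ω : LinearMap.BilinForm ℂ V}
    (hω : IsSymplecticForm ω) {Γ : Subgroup (V ≃ₗ[ℂ] V)} (hΓ : Preserves ω Γ) (v : V) :
    PoissonBracket (QuotientNbhd Γ v) :=
  formalBracket (quotientBracket hω hΓ) (puncturedLine v)

/-- The action of `c ∈ ℂˣ` on the formal neighbourhood of `ℂˣ · v̄` in `X`. -/
def quotientDilation (Γ : Subgroup (V ≃ₗ[ℂ] V)) (v : V) (c : ℂˣ) :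
    QuotientNbhd Γ v →ₐ[ℂ] QuotientNbhd Γ v :=
  formalPullback (c • ·) (invariants_smul Γ c) (puncturedLine_smul v c)

/-- The group `N(Γ₀)⁰ = N(Γ₀) / Γ₀` acting on `V^Γ₀`, where `N(Γ₀)` is the normalizer of `Γ₀`
in `Γ`. -/
def leafGroup (Γ Γ₀ : Subgroup (V ≃ₗ[ℂ] V)) :
    Subgroup (fixedSpace Γ₀ ≃ₗ[ℂ] fixedSpace Γ₀) :=
  inducedGroup (Γ ⊓ Subgroup.normalizer (Γ₀ : Set (V ≃ₗ[ℂ] V))) (fixedSpace Γ₀)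

theorem leafGroup_preserves {ω : LinearMap.BilinForm ℂ V} {Γ : Subgroup (V ≃ₗ[ℂ] V)}
    (hΓ : Preserves ω Γ) (Γ₀ : Subgroup (V ≃ₗ[ℂ] V)) :
    Preserves (ω.restrict (fixedSpace Γ₀)) (leafGroup Γ Γ₀) :=
  inducedGroup_preserves (fun g hg => hΓ g (Subgroup.mem_inf.mp hg).1) _

/-- Functions on the formal neighbourhood of `ℂˣ · v̄` in the leaf `X_Γ₀ = (V^Γ₀)° / N(Γ₀)⁰`, where
`(V^Γ₀)°` is the set of vectors with stabilizer exactly `Γ₀`. As the leaf is an open subvariety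
of the affine variety `V^Γ₀ / N(Γ₀)⁰`, this is the formal neighbourhood in the latter. -/
abbrev LeafNbhd (Γ Γ₀ : Subgroup (V ≃ₗ[ℂ] V)) (v : V) : Type _ :=
  FormalFunctions (invariants (leafGroup Γ Γ₀)) (puncturedLineIn (fixedSpace Γ₀) v)

/-- The ideal of `ℂˣ · v̄` in the algebra of functions on its formal neighbourhood in the leaf. -/
def leafIdeal (Γ Γ₀ : Subgroup (V ≃ₗ[ℂ] V)) (v : V) : Ideal (LeafNbhd Γ Γ₀ v) :=
  formalIdeal (invariants (leafGroup Γ Γ₀)) (puncturedLineIn (fixedSpace Γ₀) v)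

/-- The Poisson bracket of the formal neighbourhood of `ℂˣ · v̄` in the leaf, induced by the
restriction of `ω` to `V^Γ₀`. -/
def leafNbhdBracket [FiniteDimensional ℂ V] {ω : LinearMap.BilinForm ℂ V}
    (hω : IsSymplecticForm ω) {Γ Γ₀ : Subgroup (V ≃ₗ[ℂ] V)} [Finite Γ] (hΓ : Preserves ω Γ)
    (h : Γ₀ ≤ Γ) (v : V) : PoissonBracket (LeafNbhd Γ Γ₀ v) :=
  have : Finite Γ₀ := finite_of_le h
  formalBracket (quotientBracket (fixedSpace_symplectic hω (hΓ.mono h)) (leafGroup_preserves hΓ Γ₀))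
    (puncturedLineIn (fixedSpace Γ₀) v)

/-- The action of `c ∈ ℂˣ` on the formal neighbourhood of `ℂˣ · v̄` in the leaf. -/
def leafDilation (Γ Γ₀ : Subgroup (V ≃ₗ[ℂ] V)) (v : V) (c : ℂˣ) :
    LeafNbhd Γ Γ₀ v →ₐ[ℂ] LeafNbhd Γ Γ₀ v :=
  formalPullback (c • ·) (invariants_smul _ c) (puncturedLineIn_smul _ v c)

/-- The group `Γ₀` acting on `(V^Γ₀)^⊥`. -/
def sliceGroup (ω : LinearMap.BilinForm ℂ V) (Γ₀ : Subgroup (V ≃ₗ[ℂ] V)) :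
    Subgroup (slice ω Γ₀ ≃ₗ[ℂ] slice ω Γ₀) :=
  inducedGroup Γ₀ (slice ω Γ₀)

/-- Functions on the quotient by `Γ₀` of the formal neighbourhood of the origin
in `(V^Γ₀)^⊥`. -/
abbrev SliceFunctions (ω : LinearMap.BilinForm ℂ V) (Γ₀ : Subgroup (V ≃ₗ[ℂ] V)) : Type _ :=
  originInvariants (sliceGroup ω Γ₀)

/-- The Poisson bracket of the slice, induced by the restriction of `ω` to `(V^Γ₀)^⊥`. -/
def sliceBracket [FiniteDimensional ℂ V] {ω : LinearMap.BilinForm ℂ V}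
    (hω : IsSymplecticForm ω) {Γ Γ₀ : Subgroup (V ≃ₗ[ℂ] V)} [Finite Γ] (hΓ : Preserves ω Γ)
    (h : Γ₀ ≤ Γ) : PoissonBracket (SliceFunctions ω Γ₀) :=
  have : Finite Γ₀ := finite_of_le h
  originBracket (slice_symplectic hω (hΓ.mono h)) (inducedGroup_preserves (hΓ.mono h) _)

/-- Functions on the completed product of the formal neighbourhood of `ℂˣ · v̄` in the leaf
and the quotient by `Γ₀` of the formal neighbourhood of the origin in `(V^Γ₀)^⊥`. -/
abbrev ProductNbhd (ω : LinearMap.BilinForm ℂ V) (Γ Γ₀ : Subgroup (V ≃ₗ[ℂ] V)) (v : V) : Type _ :=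
  CompletedTensor (leafIdeal Γ Γ₀ v) (originIdeal (sliceGroup ω Γ₀))

/-- The product Poisson bracket, extended by continuity to the completed product. -/
def productBracket [FiniteDimensional ℂ V] {ω : LinearMap.BilinForm ℂ V}
    (hω : IsSymplecticForm ω) {Γ Γ₀ : Subgroup (V ≃ₗ[ℂ] V)} [Finite Γ] (hΓ : Preserves ω Γ)
    (h : Γ₀ ≤ Γ) (v : V) : PoissonBracket (ProductNbhd ω Γ Γ₀ v) :=
  CompletedTensor.bracket (leafNbhdBracket hω hΓ h v) (sliceBracket hω hΓ h) _ _

/-- The diagonal action of `c ∈ ℂˣ` on the completed product. -/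
def productDilation (ω : LinearMap.BilinForm ℂ V) (Γ Γ₀ : Subgroup (V ≃ₗ[ℂ] V)) (v : V) (c : ℂˣ) :
    ProductNbhd ω Γ Γ₀ v →ₐ[ℂ] ProductNbhd ω Γ Γ₀ v :=
  CompletedTensor.map _ _ _ _ (leafDilation Γ Γ₀ v c) (originDilation _ c)
    (formalPullback_ideal _ _ _) (originDilation_ideal _ c)

/-! #### The common cover

The vector space `V^Γ₀ × (V^Γ₀)^⊥` maps to `V / Γ` by addition followed by the quotient map,
and to the product of `V^Γ₀ / N(Γ₀)⁰` and `(V^Γ₀)^⊥ / Γ₀` by the product of the quotient maps. -/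

/-- Functions on the formal neighbourhood of `ℂˣ · v × {0}` in `V^Γ₀ × (V^Γ₀)^⊥`. -/
abbrev CoverNbhd (ω : LinearMap.BilinForm ℂ V) (Γ₀ : Subgroup (V ≃ₗ[ℂ] V)) (v : V) : Type _ :=
  FormalFunctions (polyFun (fixedSpace Γ₀ × slice ω Γ₀))
    (puncturedLineIn (fixedSpace Γ₀) v ×ˢ ({0} : Set (slice ω Γ₀)))

/-- Pull-back of functions along `V^Γ₀ × (V^Γ₀)^⊥ → V / Γ`, `(u, w) ↦ Γ · (u + w)`. -/
def quotientToCover (ω : LinearMap.BilinForm ℂ V) (Γ Γ₀ : Subgroup (V ≃ₗ[ℂ] V)) (v : V) :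
    QuotientNbhd Γ v →ₐ[ℂ] CoverNbhd ω Γ₀ v :=
  formalPullback ((fixedSpace Γ₀).subtype.coprod (slice ω Γ₀).subtype)
    (fun _ hf => polyFun_comp _ hf.1) (by
      rintro ⟨u, w⟩ ⟨hu, hw⟩
      obtain rfl : w = 0 := hw
      simpa using (show (u : V) ∈ puncturedLine v from hu))

/-- Pull-back of functions along the projection `V^Γ₀ × (V^Γ₀)^⊥ → V^Γ₀ → V^Γ₀ / N(Γ₀)⁰`. -/
def leafToCover (ω : LinearMap.BilinForm ℂ V) (Γ Γ₀ : Subgroup (V ≃ₗ[ℂ] V)) (v : V) :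
    LeafNbhd Γ Γ₀ v →ₐ[ℂ] CoverNbhd ω Γ₀ v :=
  formalPullback (LinearMap.fst ℂ (fixedSpace Γ₀) (slice ω Γ₀))
    (fun _ hf => polyFun_comp _ hf.1) (fun _ hp => hp.1)

/-- Pull-back of functions along the projection `V^Γ₀ × (V^Γ₀)^⊥ → (V^Γ₀)^⊥`. -/
def originToCover (ω : LinearMap.BilinForm ℂ V) (Γ₀ : Subgroup (V ≃ₗ[ℂ] V)) (v : V) :
    OriginFunctions (slice ω Γ₀) →ₐ[ℂ] CoverNbhd ω Γ₀ v :=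
  formalPullback (LinearMap.snd ℂ (fixedSpace Γ₀) (slice ω Γ₀))
    (fun _ hf => polyFun_comp _ hf) (fun _ hp => hp.2)

/-- Pull-back of functions along the quotient map from `V^Γ₀ × (V^Γ₀)^⊥` to the product of
`V^Γ₀ / N(Γ₀)⁰` and `(V^Γ₀)^⊥ / Γ₀`. -/
def productToCover (ω : LinearMap.BilinForm ℂ V) (Γ Γ₀ : Subgroup (V ≃ₗ[ℂ] V)) (v : V) :
    ProductNbhd ω Γ Γ₀ v →ₐ[ℂ] CoverNbhd ω Γ₀ v :=
  CompletedTensor.lift _ _ _ (leafToCover ω Γ Γ₀ v)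
    ((originToCover ω Γ₀ v).comp (originInvariants (sliceGroup ω Γ₀)).val)
    (formalPullback_ideal _ _ _) (fun x hx => formalPullback_ideal (R := polyFun _)
      (R' := polyFun (slice ω Γ₀)) (LinearMap.snd ℂ (fixedSpace Γ₀) (slice ω Γ₀))
      (fun _ hf => polyFun_comp _ hf) (fun _ hp => hp.2) (x := x.1) hx)

end Decomposition

end FormalQuotient

end

open FormalQuotient

/-! Let C be the algebra of functions on the formal neighbourhood of ℂˣ·v × {0} in V^Γ₀ × (V^Γ₀)^⊥
(`CoverNbhd`). Both sides of the decomposition map to C. The point is that both maps are injective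
and have the same image, namely the functions invariant under Γ₀ acting on the second factor. The
isomorphism is then forced. Dilations and brackets exist on C as well and both maps respect them, so
every property of the isomorphism can be tested inside C. Both maps are moreover strict: an element
whose image is small in the filtration of C is itself small. This gives continuity in both
directions.

For V/Γ, an element of Γ that moves v does not send it to a multiple of v; this is the freeness
hypothesis. Hence some polynomial P has no zeros on ℂˣ·v and vanishes on all its other translates
(`exists_separating`). If a polynomial is multiplied by a high power of P and then averaged over Γ,
only the terms of the stabilizer Γ₀ matter near ℂˣ·v. So a fraction that approximates a Γ₀-invariant
function turns into a fraction of Γ-invariants (`exists_invariant_fraction`). Strictness rests on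
the comparison of two topologies on a ring of invariants, by powers of a contracted ideal and by
contractions of powers; they agree by integrality and the Reynolds operator (`exists_pow_comap_le`).

For the product, N(Γ₀)⁰ acts with trivial stabilizer at v. The same result for this group identifies
the neighbourhood in the leaf with the one in V^Γ₀ (`inclPullback_leaf_bijective`). It remains to
see that the completed tensor product of functions near ℂˣ·v in U = V^Γ₀ with Γ₀-invariant functions
near 0 in W = (V^Γ₀)^⊥ gives all invariants of C. The image is dense because denominators can be
moved to U (`exists_fst_fraction`) and averaging a(u)b(w) over Γ₀ only averages b. Strictness holds
because, over a field, the kernel of a tensor product of maps is generated by the two kernels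
(`ker_tensorProduct_map`); this is applied to truncations of both factors.

The brackets agree because V^Γ₀ and its complement are ω-orthogonal: the inclusions of the factors
are adjoint to the projections, and a linear map with an adjoint section is Poisson
(`polyPullback_bracket`). -/

noncomputable section

open scoped TensorProduct

namespace FormalQuotient

/-! ### Averaging over a finite group -/

section Averaging

variable {G B A : Type*} [Fintype G] [CommRing B] [Algebra ℂ B] [CommRing A] [Algebra ℂ A]

/-- The Reynolds operator of a finite group acting on `B` from the right. -/
def average (ρ : G → B →ₐ[ℂ] B) : B →ₗ[ℂ] B :=
  (Fintype.card G : ℂ)⁻¹ • ∑ g, (ρ g).toLinearMap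

theorem average_apply (ρ : G → B →ₐ[ℂ] B) (b : B) :
    average ρ b = (Fintype.card G : ℂ)⁻¹ • ∑ g, ρ g b := by
  simp [average]

/-- Linearity of the Reynolds operator over the invariants is what carries statements about `B` down
to the ring of invariants. -/
theorem average_mul_of_fixed (ρ : G → B →ₐ[ℂ] B) {a : B} (ha : ∀ g, ρ g a = a) (b : B) :
    average ρ (b * a) = average ρ b * a := by
  simp only [average_apply, map_mul, ha, ← Finset.sum_mul, smul_mul_assoc]

theorem average_of_fixed [Nonempty G] (ρ : G → B →ₐ[ℂ] B) {a : B} (ha : ∀ g, ρ g a = a) :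
    average ρ a = a := by
  have : (Fintype.card G : ℂ) ≠ 0 := by simp
  rw [average_apply, Finset.sum_congr rfl fun g _ => ha g, Finset.sum_const, Finset.card_univ,
    ← Nat.cast_smul_eq_nsmul ℂ, smul_smul, inv_mul_cancel₀ this, one_smul]

/-- The error of an average is the mean of the errors, and an ideal is closed under such means. -/
theorem sub_average_mem [Nonempty G] (ρ : G → B →ₐ[ℂ] B) (φ : B →ₐ[ℂ] A) {F : Ideal A} {z : A}
    {p : B} (h : ∀ g, z - φ (ρ g p) ∈ F) : z - φ (average ρ p) ∈ F := by
  have hcard : (Fintype.card G : ℂ) ≠ 0 := by simp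
  have h2 : z - φ (average ρ p) =
      algebraMap ℂ _ (Fintype.card G : ℂ)⁻¹ * ∑ g : G, (z - φ (ρ g p)) := by
    rw [← Algebra.smul_def, Finset.sum_sub_distrib, smul_sub, Finset.sum_const, Finset.card_univ,
      ← Nat.cast_smul_eq_nsmul ℂ, inv_smul_smul₀ hcard, average_apply, map_smul, map_sum]
  rw [h2]
  exact Ideal.mul_mem_left _ _ (Ideal.sum_mem _ fun g _ => h g)

variable [Group G]

/-- Pull-back reverses composition, so `ρ` is a right action and the sum is reindexed by right
multiplication. -/
theorem action_average (ρ : G → B →ₐ[ℂ] B) (hρ : ∀ g h b, ρ (g * h) b = ρ h (ρ g b)) (h : G)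
    (b : B) : ρ h (average ρ b) = average ρ b := by
  rw [average_apply, map_smul, map_sum]
  congr 1
  exact Fintype.sum_equiv (Equiv.mulRight h) _ _ fun g => (hρ g h b).symm

/-- The extension of an ideal of the ring of invariants contracts to itself. -/
theorem mem_of_map_invariants (ρ : G → B →ₐ[ℂ] B) (hρ : ∀ g h b, ρ (g * h) b = ρ h (ρ g b))
    (ι : A →ₐ[ℂ] B) (hι : Function.Injective ι) (hfix : ∀ a g, ρ g (ι a) = ι a)
    (hrange : ∀ b, (∀ g, ρ g b = b) → ∃ a, ι a = b) (K : Ideal A) {a : A}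
    (ha : ι a ∈ K.map ι) : a ∈ K := by
  -- The claim is needed only for `b = 1`. The free factor `b` absorbs the coefficients in `B` that
  -- occur in the induction over the span.
  have key : ∀ y ∈ K.map ι, ∀ b, ∃ x ∈ K, ι x = average ρ (b * y) := by
    intro y hy
    induction hy using Submodule.span_induction with
    | mem y hy =>
      obtain ⟨x, hx, rfl⟩ := hy
      intro b
      obtain ⟨c, hc⟩ := hrange (average ρ b) fun g => action_average ρ hρ g b
      refine ⟨c * x, K.mul_mem_left c hx, ?_⟩
      rw [map_mul, hc]
      exact (average_mul_of_fixed ρ (hfix x) b).symm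
    | zero => exact fun b => ⟨0, zero_mem _, by simp⟩
    | add y z _ _ hy hz =>
      intro b
      obtain ⟨x, hx, h⟩ := hy b
      obtain ⟨x', hx', h'⟩ := hz b
      exact ⟨x + x', add_mem hx hx', by rw [map_add, h, h', mul_add, map_add]⟩
    | smul c y _ hy =>
      intro b
      obtain ⟨x, hx, h⟩ := hy (b * c)
      exact ⟨x, hx, by rw [h, smul_eq_mul, mul_assoc]⟩
  obtain ⟨x, hx, h⟩ := key _ ha 1
  rw [one_mul, average_of_fixed ρ (hfix a)] at h
  exact hι h ▸ hx

/-- Each element of a stable ideal `J` is integral over the invariants in `J`. -/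
theorem pow_card_mem_map_invariants (ρ : G → B →ₐ[ℂ] B) (hρ : ∀ g h b, ρ (g * h) b = ρ h (ρ g b))
    (hone : ∀ b, ρ 1 b = b) (ι : A →ₐ[ℂ] B)
    (hrange : ∀ b, (∀ g, ρ g b = b) → ∃ a, ι a = b) (J : Ideal B)
    (hJ : ∀ g, ∀ b ∈ J, ρ g b ∈ J) {j : B} (hj : j ∈ J) :
    j ^ Fintype.card G ∈ (J.comap ι).map ι := by
  -- The orbit polynomial ∏ (X - ρ g j) is monic, has invariant coefficients and has `j` as a root.
  -- As `J` is stable, it reduces to a power of `X` modulo `J`, so all coefficients but the leading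
  -- one lie in the contraction of `J`.
  open Polynomial in
  set p : B[X] := ∏ g : G, (X - C (ρ g j)) with hp
  have hmonic : p.Monic := monic_prod_X_sub_C _ _
  have hdeg : p.natDegree ≤ Fintype.card G := by
    refine (natDegree_prod_le _ _).trans ?_
    refine (Finset.sum_le_sum fun g _ => natDegree_X_sub_C_le (ρ g j)).trans ?_
    simp
  have hroot : p.eval j = 0 := by
    rw [hp, eval_prod]
    exact Finset.prod_eq_zero (Finset.mem_univ 1) (by simp [hone])
  have hquot : p.map (Ideal.Quotient.mk J) = X ^ Fintype.card G := by
    rw [hp, Polynomial.map_prod]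
    simp [Ideal.Quotient.eq_zero_iff_mem.mpr (hJ _ j hj)]
  have hcoeff : ∀ k, k < Fintype.card G → p.coeff k ∈ (J.comap ι).map ι := by
    intro k hk
    obtain ⟨a, ha⟩ := hrange (p.coeff k) fun h => by
      have : p.map (ρ h : B →+* B) = p := by
        rw [hp, Polynomial.map_prod]
        refine Fintype.prod_equiv (Equiv.mulRight h) _ _ fun g => ?_
        simp [hρ]
      conv_rhs => rw [← this]
      rw [coeff_map]; rfl
    have hmem : p.coeff k ∈ J := by
      rw [← Ideal.Quotient.eq_zero_iff_mem, ← coeff_map, hquot, coeff_X_pow, if_neg hk.ne]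
    rw [← ha] at hmem ⊢
    exact Ideal.mem_map_of_mem ι hmem
  -- Over the zero ring `p` does not have degree |G|, so this case is treated separately.
  have htop : p.coeff (Fintype.card G) = 1 := by
    rcases subsingleton_or_nontrivial B with h | h
    · exact Subsingleton.elim _ _
    · have : p.natDegree = Fintype.card G := by
        rw [hp, natDegree_prod_of_monic _ _ fun g _ => monic_X_sub_C _]
        simp
      rw [← this]; exact hmonic
  rw [eval_eq_sum_range' (Nat.lt_succ_of_le hdeg), Finset.sum_range_succ, htop, one_mul] at hroot
  rw [eq_neg_of_add_eq_zero_right hroot]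
  exact neg_mem (Ideal.sum_mem _ fun k hk =>
    Ideal.mul_mem_right _ _ (hcoeff k (Finset.mem_range.mp hk)))

/-- For a stable finitely generated ideal `J`, the filtrations of the ring of invariants by powers
of the contraction of `J` and by contractions of powers of `J` are equivalent. -/
theorem exists_pow_comap_le (ρ : G → B →ₐ[ℂ] B) (hρ : ∀ g h b, ρ (g * h) b = ρ h (ρ g b))
    (hone : ∀ b, ρ 1 b = b) (ι : A →ₐ[ℂ] B) (hι : Function.Injective ι)
    (hfix : ∀ a g, ρ g (ι a) = ι a) (hrange : ∀ b, (∀ g, ρ g b = b) → ∃ a, ι a = b) (J : Ideal B)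
    (hfg : J.FG) (hJ : ∀ g, ∀ b ∈ J, ρ g b ∈ J) (n : ℕ) :
    ∃ m, ∀ a, ι a ∈ J ^ m → a ∈ J.comap ι ^ n := by
  -- By integrality `J` lies in the radical of the extension of its contraction. Finite generation
  -- makes the exponent uniform, and the Reynolds operator brings the extended ideal back to the
  -- invariants.
  obtain ⟨k, hk⟩ := Ideal.exists_pow_le_of_le_radical_of_fg (J := (J.comap ι).map ι)
    (fun j hj => ⟨_, pow_card_mem_map_invariants ρ hρ hone ι hrange J hJ hj⟩) hfg
  refine ⟨k * n, fun a ha => mem_of_map_invariants ρ hρ ι hι hfix hrange _ ?_⟩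
  rw [Ideal.map_pow]
  rw [pow_mul] at ha
  exact Ideal.pow_right_mono hk n ha

end Averaging

/-! ### Maps between completions -/

section Completion

variable {R T : Type*} [CommRing R] [CommRing T]

theorem mem_filtration {I : Ideal R} {n : ℕ} {x : AdicCompletion I R} :
    x ∈ filtration I n ↔ AdicCompletion.evalₐ I n x = 0 := Iff.rfl

theorem evalₐ_eq_of_le {I : Ideal R} {m n : ℕ} (h : m ≤ n) {x y : AdicCompletion I R}
    (hxy : AdicCompletion.evalₐ I n x = AdicCompletion.evalₐ I n y) :
    AdicCompletion.evalₐ I m x = AdicCompletion.evalₐ I m y := by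
  rw [← mk_rep, ← mk_rep, Ideal.Quotient.eq] at hxy
  rw [← mk_rep_of_le I x h, ← mk_rep_of_le I y h, Ideal.Quotient.eq]
  exact Ideal.pow_le_pow_right h hxy

theorem filtration_antitone (I : Ideal R) {m n : ℕ} (h : m ≤ n) :
    filtration I n ≤ filtration I m := fun x hx => by
  rw [mem_filtration] at hx ⊢
  rw [evalₐ_eq_of_le h (y := 0) (by rw [hx, map_zero]), map_zero]

/-- Finite generation is essential: only then is the kernel of the projection to R / I ^ n generated
by I ^ n. Beyond this, the proof reconciles the two forms `I ^ n • ⊤` and `I ^ n` of the ideal. -/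
theorem filtration_eq_map {I : Ideal R} (hI : I.FG) (n : ℕ) :
    filtration I n = (I ^ n).map (algebraMap R (AdicCompletion I R)) := by
  ext x
  have h1 : x ∈ (AdicCompletion.eval I R n).ker ↔ x ∈ filtration I n := by
    have h : (I ^ n • ⊤ : Ideal R) = I ^ n := by ext x; simp
    rw [mem_filtration, LinearMap.mem_ker, ← AdicCompletion.factor_eval_eq_evalₐ I x h.le]
    rw [← map_zero (Ideal.Quotient.factor h.le)]
    exact ((Ideal.quotientEquivAlgOfEq R h).injective.eq_iff (a := AdicCompletion.eval I R n x)
      (b := 0)).symm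
  rw [← h1, ← AdicCompletion.pow_smul_top_eq_ker_eval hI]
  rw [Ideal.smul_top_eq_map, Submodule.restrictScalars_mem]

theorem filtration_eq_pow {I : Ideal R} (hI : I.FG) (n : ℕ) :
    filtration I n = idealOfDefinition I ^ n := by
  rw [idealOfDefinition, filtration_eq_map hI, filtration_eq_map hI, pow_one, Ideal.map_pow]

theorem idealOfDefinition_fg {I : Ideal R} (hI : I.FG) : (idealOfDefinition I).FG := by
  rw [idealOfDefinition, filtration_eq_map hI, pow_one]
  exact hI.map _

variable [Algebra ℂ R] [Algebra ℂ T] {K : Ideal T} {I : Ideal R} {f : T →ₐ[ℂ] AdicCompletion I R}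

/-- Strictness means that a small image forces a small argument. It passes from `f` to its extension
because at each level an element of the completion has a representative in `T`. -/
theorem complLift_strict (h : K ≤ (idealOfDefinition I).comap f)
    (hf : ∀ n, ∃ m, ∀ t, f t ∈ filtration I m → t ∈ K ^ n) (n : ℕ) :
    ∃ m, ∀ x, complLift K I f h x ∈ filtration I m → x ∈ filtration K n := by
  obtain ⟨m, hm⟩ := hf n
  -- Level `m` feeds the hypothesis on `f`; level `n` is where the representative of `x` is read
  -- off.
  refine ⟨max m n, fun x hx => ?_⟩
  rw [mem_filtration, complLift_eval K I f h x _ (mk_rep K x _)] at hx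
  have h1 := filtration_antitone I (le_max_left m n) (mem_filtration.mpr hx)
  rw [mem_filtration, ← mk_rep_of_le K x (le_max_right m n), Ideal.Quotient.eq_zero_iff_mem]
  exact hm _ h1

theorem complLift_injective (h : K ≤ (idealOfDefinition I).comap f)
    (hf : ∀ n, ∃ m, ∀ t, f t ∈ filtration I m → t ∈ K ^ n) :
    Function.Injective (complLift K I f h) := by
  rw [injective_iff_map_eq_zero]
  intro x hx
  refine AdicCompletion.ext_evalₐ fun n => ?_
  obtain ⟨m, hm⟩ := complLift_strict h hf n
  rw [map_zero]
  exact hm x (by rw [hx]; exact zero_mem _)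

/-- An element of the closure of the image of `f` lies in the image of the extension: strictness
turns convergence of the images into the Cauchy property of the approximations in the `K`-adic
topology. -/
theorem exists_complLift_eq (h : K ≤ (idealOfDefinition I).comap f)
    (hf : ∀ n, ∃ m, ∀ t, f t ∈ filtration I m → t ∈ K ^ n) {x : AdicCompletion I R}
    (hx : ∀ n, ∃ t, f t - x ∈ filtration I n) : ∃ y, complLift K I f h y = x := by
  choose m hm using hf
  choose t ht using hx
  -- A monotone bound for `m n + n`: being above `m n` makes consecutive terms agree modulo `K ^ n`,
  -- being above `n` makes the images converge to `x`.
  let M : ℕ → ℕ := fun n => ∑ i ∈ Finset.range (n + 1), (m i + i)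
  have hM : Monotone M := fun a b hab =>
    Finset.sum_le_sum_of_subset (Finset.range_mono (by omega))
  have hMm : ∀ n, m n + n ≤ M n := fun n =>
    Finset.single_le_sum (f := fun i => m i + i) (fun _ _ => Nat.zero_le _)
      (Finset.mem_range.mpr (Nat.lt_succ_self n))
  have hcauchy : ∀ n, t (M n) - t (M (n + 1)) ∈ K ^ n := fun n => by
    apply hm
    have h1 : f (t (M n)) - x ∈ filtration I (m n) :=
      filtration_antitone I (by have := hMm n; omega) (ht (M n))
    have h2 : f (t (M (n + 1))) - x ∈ filtration I (m n) :=
      filtration_antitone I (by have := hMm n; have := hM (Nat.le_add_right n 1); omega)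
        (ht (M (n + 1)))
    rw [map_sub]
    simpa using sub_mem h1 h2
  refine ⟨AdicCompletion.mk K T (AdicCompletion.AdicCauchySequence.mk K T (fun n => t (M n))
    fun n => ?_), AdicCompletion.ext_evalₐ fun n => ?_⟩
  · rw [SModEq.sub_mem, smul_eq_mul, Ideal.mul_top]
    exact hcauchy n
  · rw [complLift_eval K I f h _ n (t := t (M n)) (by rw [AdicCompletion.evalₐ_mk]; rfl),
      ← sub_eq_zero, ← map_sub]
    exact filtration_antitone I (by have := hMm n; omega) (ht (M n))

omit [Algebra ℂ R] in
theorem algebraMap_mem_filtration {I : Ideal R} {n : ℕ} {r : R} :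
    algebraMap R (AdicCompletion I R) r ∈ filtration I n ↔ r ∈ I ^ n := by
  rw [mem_filtration, AlgHom.commutes, Ideal.Quotient.algebraMap_eq, Ideal.Quotient.eq_zero_iff_mem]

theorem exists_complMap_eq {g : T →ₐ[ℂ] R} (h : K ≤ I.comap g)
    (hg : ∀ n, ∃ m, ∀ t, g t ∈ I ^ m → t ∈ K ^ n) {x : AdicCompletion I R}
    (hx : ∀ n, ∃ t, Ideal.Quotient.mk (I ^ n) (g t) = AdicCompletion.evalₐ I n x) :
    ∃ y, complMap K I g h y = x := by
  refine exists_complLift_eq _ (fun n => ?_) fun n => ?_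
  · obtain ⟨m, hm⟩ := hg n
    exact ⟨m, fun t ht => hm t (algebraMap_mem_filtration.mp ht)⟩
  · obtain ⟨t, ht⟩ := hx n
    refine ⟨t, ?_⟩
    rw [mem_filtration, map_sub, ← ht, sub_eq_zero]
    exact (AdicCompletion.evalₐ I n).commutes (g t)

end Completion

/-! ### Completed localizations -/

section LocCompletion

variable {A B E : Type*} [CommRing A] [CommRing B] [CommRing E] [Algebra ℂ A] [Algebra ℂ B]
  [Algebra ℂ E] {S : Submonoid A} {T : Submonoid B} {I : Ideal A} {J : Ideal B}

omit [Algebra ℂ E] in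
theorem mem_of_isUnit_mul_mem {F : Ideal E} {u x : E} (hu : IsUnit u) (h : u * x ∈ F) : x ∈ F :=
  (Ideal.unit_mul_mem_iff_mem F hu).mp h

/-- The canonical map `S⁻¹A → lim S⁻¹A / I ^ n`. -/
def locCoe (S : Submonoid A) (I : Ideal A) : Localization S →ₐ[ℂ] LocCompletion S I :=
  (Algebra.ofId (Localization S) (AdicCompletion (locIdeal S I) (Localization S))).restrictScalars ℂ

/-- The projection `lim S⁻¹A / I ^ m → S⁻¹A / I ^ n`. -/
def locEval (S : Submonoid A) (I : Ideal A) (n : ℕ) :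
    LocCompletion S I →ₐ[ℂ] Localization S ⧸ locIdeal S I ^ n :=
  (AdicCompletion.evalₐ (locIdeal S I) n).restrictScalars ℂ

theorem locEval_locCoe (t : Localization S) (n : ℕ) :
    locEval S I n (locCoe S I t) = Ideal.Quotient.mk _ t :=
  (AdicCompletion.evalₐ (locIdeal S I) n).commutes t

theorem mem_locFiltration {n : ℕ} {x : LocCompletion S I} :
    x ∈ locFiltration S I n ↔ locEval S I n x = 0 := Iff.rfl

theorem exists_mk_eq_locEval (x : LocCompletion S I) (n : ℕ) :
    ∃ t, Ideal.Quotient.mk (locIdeal S I ^ n) t = locEval S I n x :=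
  ⟨_, mk_rep (locIdeal S I) x n⟩

/-- The canonical map `A → lim S⁻¹A / I ^ n`. -/
def locOf (S : Submonoid A) (I : Ideal A) : A →ₐ[ℂ] LocCompletion S I :=
  (locCoe S I).comp (IsScalarTower.toAlgHom ℂ A (Localization S))

theorem eval_locOf (a : A) (n : ℕ) : locEval S I n (locOf S I a) =
    Ideal.Quotient.mk (locIdeal S I ^ n) (algebraMap A (Localization S) a) :=
  locEval_locCoe _ n

omit [Algebra ℂ A] in
theorem locFiltration_antitone {m n : ℕ} (h : m ≤ n) :
    locFiltration S I n ≤ locFiltration S I m := filtration_antitone _ h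

omit [Algebra ℂ A] in
theorem locFiltration_one_fg (hI : I.FG) : (locFiltration S I 1).FG :=
  idealOfDefinition_fg (I := locIdeal S I) (hI.map _)

omit [Algebra ℂ A] in
theorem locFiltration_eq_pow (hI : I.FG) (n : ℕ) :
    locFiltration S I n = locFiltration S I 1 ^ n :=
  filtration_eq_pow (I := locIdeal S I) (hI.map _) n

theorem eq_of_forall_sub_mem_locFiltration {x y : LocCompletion S I}
    (h : ∀ n, x - y ∈ locFiltration S I n) : x = y :=
  AdicCompletion.ext_evalₐ fun n => by
    have := mem_locFiltration.mp (h n)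
    rwa [map_sub, sub_eq_zero] at this

theorem locOf_mem_locFiltration {a : A} {n : ℕ} :
    locOf S I a ∈ locFiltration S I n ↔ ∃ s ∈ S, s * a ∈ I ^ n := by
  rw [mem_locFiltration, eval_locOf, Ideal.Quotient.eq_zero_iff_mem, locIdeal, ← Ideal.map_pow,
    IsLocalization.algebraMap_mem_map_algebraMap_iff S]

theorem locOf_mem_of_mem {a : A} {n : ℕ} (ha : a ∈ I ^ n) : locOf S I a ∈ locFiltration S I n :=
  locOf_mem_locFiltration.mpr ⟨1, one_mem _, by rwa [one_mul]⟩

theorem isUnit_locOf {s : A} (hs : s ∈ S) : IsUnit (locOf S I s) :=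
  (IsLocalization.map_units (Localization S) ⟨s, hs⟩).map (locCoe S I)

/-- Modulo each step of the filtration, elements of the completion are fractions. -/
theorem exists_locOf_mul_sub_mem (x : LocCompletion S I) (n : ℕ) :
    ∃ s ∈ S, ∃ a, locOf S I s * x - locOf S I a ∈ locFiltration S I n := by
  obtain ⟨t, ht⟩ := exists_mk_eq_locEval x n
  obtain ⟨⟨a, s⟩, h⟩ := IsLocalization.surj S t
  refine ⟨s, s.2, a, ?_⟩
  rw [mem_locFiltration, map_sub, map_mul, ← ht, eval_locOf, eval_locOf, ← map_mul, ← h, mul_comm,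
    sub_self]

variable {f : A →ₐ[ℂ] B} {hS : S ≤ T.comap f} {hI : I ≤ J.comap f}

theorem locEval_locComplMap {x : LocCompletion S I} {n : ℕ} {t : Localization S}
    (ht : Ideal.Quotient.mk _ t = locEval S I n x) :
    locEval T J n (locComplMap S T I J f hS hI x) = Ideal.Quotient.mk _ (locMap S T f hS t) :=
  complMap_eval _ _ _ (locMap_ideal S T I J f hS hI) _ n ht

theorem locComplMap_locOf (a : A) :
    locComplMap S T I J f hS hI (locOf S I a) = locOf T J (f a) :=
  eq_of_forall_sub_mem_locFiltration fun n => by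
    rw [mem_locFiltration, map_sub, locEval_locComplMap (eval_locOf a n).symm, eval_locOf,
      locMap_algebraMap, sub_self]

theorem locComplMap_mem {x : LocCompletion S I} {n : ℕ} (hx : x ∈ locFiltration S I n) :
    locComplMap S T I J f hS hI x ∈ locFiltration T J n := by
  rw [mem_locFiltration] at hx ⊢
  rw [locEval_locComplMap (t := 0) (by rw [hx, map_zero]), map_zero, map_zero]

/-- With `s * x` close to some `a` in `A`, smallness of the image of `x` gives smallness of `f a`.
The hypothesis then makes `a` small up to a denominator, and `s` is a unit. The two levels are kept
separate so that `m = n` can be used where no loss occurs. -/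
theorem locComplMap_strict_step {m n : ℕ} (hmn : n ≤ m)
    (hf : ∀ a, ∀ t ∈ T, t * f a ∈ J ^ m → ∃ s ∈ S, s * a ∈ I ^ n) {x : LocCompletion S I}
    (hx : locComplMap S T I J f hS hI x ∈ locFiltration T J m) : x ∈ locFiltration S I n := by
  obtain ⟨s, hs, a, h⟩ := exists_locOf_mul_sub_mem x m
  have h1 := locComplMap_mem (T := T) (J := J) (f := f) (hS := hS) (hI := hI) h
  rw [map_sub, map_mul, locComplMap_locOf, locComplMap_locOf] at h1
  have h2 := (Submodule.sub_mem_iff_right _ (Ideal.mul_mem_left _ _ hx)).mp h1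
  obtain ⟨t, ht, h3⟩ := locOf_mem_locFiltration.mp h2
  have h4 : locOf S I a ∈ locFiltration S I n := locOf_mem_locFiltration.mpr (hf a t ht h3)
  have h5 := (Submodule.sub_mem_iff_left _ h4).mp (locFiltration_antitone hmn h)
  exact mem_of_isUnit_mul_mem (isUnit_locOf hs) h5

theorem locComplMap_strict
    (hf : ∀ n, ∃ m, ∀ a, ∀ t ∈ T, t * f a ∈ J ^ m → ∃ s ∈ S, s * a ∈ I ^ n) (n : ℕ) :
    ∃ m, ∀ x, locComplMap S T I J f hS hI x ∈ locFiltration T J m → x ∈ locFiltration S I n := by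
  obtain ⟨m, hm⟩ := hf n
  exact ⟨max m n, fun x hx => locComplMap_strict_step (le_max_right m n)
    (fun a t ht h => hm a t ht (Ideal.pow_le_pow_right (le_max_left m n) h)) hx⟩

/-- For a strict map the image is closed, so it suffices that `x` is, at each level, a fraction with
numerator and denominator from `A`. -/
theorem exists_locComplMap_eq
    (hf : ∀ n, ∃ m, ∀ a, ∀ t ∈ T, t * f a ∈ J ^ m → ∃ s ∈ S, s * a ∈ I ^ n)
    {x : LocCompletion T J}
    (hx : ∀ n, ∃ s ∈ S, ∃ a, locOf T J (f s) * x - locOf T J (f a) ∈ locFiltration T J n) :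
    ∃ y, locComplMap S T I J f hS hI y = x := by
  refine exists_complMap_eq (locMap_ideal S T I J f hS hI) (fun n => ?_) (fun n => ?_)
  · obtain ⟨m, hm⟩ := locComplMap_strict (hS := hS) (hI := hI) hf n
    refine ⟨m, fun t ht => ?_⟩
    have h := hm (locCoe S I t) (by
      rw [mem_locFiltration, locEval_locComplMap (locEval_locCoe t m).symm]
      exact Ideal.Quotient.eq_zero_iff_mem.mpr ht)
    rwa [mem_locFiltration, locEval_locCoe, Ideal.Quotient.eq_zero_iff_mem] at h
  · obtain ⟨s, hs, a, h⟩ := hx n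
    -- The approximation is a / s. It is compared with `x` after multiplication by `f s`, which is a
    -- unit in the quotient.
    refine ⟨IsLocalization.mk' (Localization S) a ⟨s, hs⟩, ?_⟩
    rw [mem_locFiltration, map_sub, map_mul, eval_locOf, eval_locOf, sub_eq_zero] at h
    refine ((IsLocalization.map_units (Localization T) ⟨f s, hS hs⟩).map
      (Ideal.Quotient.mk (locIdeal T J ^ n))).mul_left_cancel ?_
    refine Eq.trans ?_ h.symm
    rw [← map_mul]
    change Ideal.Quotient.mk _ (algebraMap B (Localization T) (f s) * _) = _
    rw [← locMap_algebraMap S T f hS, ← locMap_algebraMap S T f hS, ← map_mul]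
    rw [IsLocalization.mk'_spec'_mk]

/-- Maps out of a completed localization that are discontinuous nowhere are determined by their
restriction to `A`. -/
theorem locCompletion_hom_ext {φ ψ : LocCompletion S I →ₐ[ℂ] E} (m : ℕ)
    (hφ : ∀ x ∈ locFiltration S I m, φ x = 0) (hψ : ∀ x ∈ locFiltration S I m, ψ x = 0)
    (h : ∀ a, φ (locOf S I a) = ψ (locOf S I a)) : φ = ψ := by
  ext x
  obtain ⟨s, hs, a, hx⟩ := exists_locOf_mul_sub_mem x m
  have h1 := hφ _ hx
  have h2 := hψ _ hx
  rw [map_sub, map_mul, sub_eq_zero] at h1 h2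
  rw [← h, ← h, ← h1] at h2
  exact ((isUnit_locOf hs).map φ).mul_left_cancel h2.symm

/-- A map out of `A` that inverts `S` and kills a power of `I` extends to the completion. -/
theorem exists_locCompletion_hom (σ : A →ₐ[ℂ] E) (m : ℕ) (hσ : ∀ s ∈ S, IsUnit (σ s))
    (hm : ∀ a ∈ I ^ m, σ a = 0) : ∃ Ψ : LocCompletion S I →ₐ[ℂ] E,
      (∀ a, Ψ (locOf S I a) = σ a) ∧ ∀ x ∈ locFiltration S I m, Ψ x = 0 := by
  let τ : Localization S →ₐ[ℂ] E := IsLocalization.liftAlgHom (M := S) (f := σ) fun s => hσ s s.2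
  have hτ : ∀ a, τ (algebraMap A _ a) = σ a := fun a => IsLocalization.lift_eq _ a
  have hτm : ∀ x ∈ locIdeal S I ^ m, τ x = 0 := by
    have : locIdeal S I ^ m ≤ RingHom.ker τ := by
      rw [locIdeal, ← Ideal.map_pow, Ideal.map_le_iff_le_comap]
      intro a ha
      rw [Ideal.mem_comap, RingHom.mem_ker, hτ, hm a ha]
    exact fun x hx => this hx
  let Ψ : LocCompletion S I →ₐ[ℂ] E := (Ideal.Quotient.liftₐ (locIdeal S I ^ m) τ hτm).comp
    (locEval S I m)
  refine ⟨Ψ, fun a => ?_, fun x hx => ?_⟩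
  · change Ideal.Quotient.liftₐ (locIdeal S I ^ m) τ hτm
      (locEval S I m (locOf S I a)) = _
    rw [eval_locOf, ← hτ]
    rfl
  · change Ideal.Quotient.liftₐ (locIdeal S I ^ m) τ hτm
      (locEval S I m x) = _
    rw [mem_locFiltration.mp hx, map_zero]

end LocCompletion

/-! ### Polynomial functions -/

section Polynomial

variable {V V' V'' : Type*} [AddCommGroup V] [Module ℂ V] [AddCommGroup V'] [Module ℂ V']
  [AddCommGroup V''] [Module ℂ V'']

/-- The algebra is generated by the finite-dimensional image of the dual space, so Hilbert's basis
theorem applies. It supplies the finite generation of vanishing ideals on which the comparison of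
filtrations with powers depends. -/
instance polyFun_isNoetherianRing [FiniteDimensional ℂ V] : IsNoetherianRing (polyFun V) := by
  let L : Module.Dual ℂ V →ₗ[ℂ] V → ℂ := LinearMap.ltoFun ℂ V ℂ ℂ
  have h : polyFun V = Algebra.adjoin ℂ (LinearMap.range L : Set (V → ℂ)) := rfl
  obtain ⟨s, hs⟩ : (LinearMap.range L).FG := by
    rw [LinearMap.range_eq_map]; exact Module.Finite.fg_top.map L
  rw [← hs, Algebra.adjoin_span] at h
  have : Algebra.FiniteType ℂ (polyFun V) := (polyFun V).fg_iff_finiteType.mp ⟨s, h.symm⟩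
  exact Algebra.FiniteType.isNoetherianRing ℂ _

/-- Pull-back of polynomial functions along a linear map. -/
def polyPullback (L : V →ₗ[ℂ] V') : polyFun V' →ₐ[ℂ] polyFun V :=
  pullback L fun _ hf => polyFun_comp L hf

@[simp]
theorem polyPullback_apply (L : V →ₗ[ℂ] V') (f : polyFun V') (x : V) :
    (polyPullback L f : V → ℂ) x = (f : V' → ℂ) (L x) := rfl

/-- Products of polynomial functions on two vector spaces. -/
def polyProd (V V' : Type*) [AddCommGroup V] [Module ℂ V] [AddCommGroup V'] [Module ℂ V'] :
    polyFun V ⊗[ℂ] polyFun V' →ₐ[ℂ] polyFun (V × V') :=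
  Algebra.TensorProduct.productMap (polyPullback (LinearMap.fst ℂ V V'))
    (polyPullback (LinearMap.snd ℂ V V'))

theorem polyProd_tmul (f : polyFun V) (f' : polyFun V') (x : V × V') :
    (polyProd V V' (f ⊗ₜ f') : V × V' → ℂ) x = (f : V → ℂ) x.1 * (f' : V' → ℂ) x.2 := by
  rw [polyProd, Algebra.TensorProduct.productMap_apply_tmul]
  rfl

/-- Expand a tensor as ∑ cᵢ ⊗ bᵢ in a basis of the right factor. If its product function is zero,
then freezing x gives the relation ∑ cᵢ(x) bᵢ = 0, so every cᵢ vanishes at every x. -/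
theorem polyProd_injective : Function.Injective (polyProd V V') := by
  classical
  rw [injective_iff_map_eq_zero]
  intro t ht
  let b := Module.Basis.ofVectorSpace ℂ (polyFun V')
  obtain ⟨c, rfl⟩ := (TensorProduct.equivFinsuppOfBasisRight (M := polyFun V) b).symm.surjective t
  rw [TensorProduct.equivFinsuppOfBasisRight_symm_apply] at ht
  suffices h : c = 0 by rw [h]; exact LinearEquiv.map_zero _
  ext k x
  have h1 : ∑ i ∈ c.support, (c i : V → ℂ) x • b i = 0 := by
    ext y
    have h2 := congrArg (fun f : polyFun (V × V') => (f : V × V' → ℂ) (x, y)) ht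
    simp only [Finsupp.sum, map_sum] at h2
    simpa [polyProd_tmul] using h2
  by_cases hk : k ∈ c.support
  · exact linearIndependent_iff'.mp b.linearIndependent _ _ h1 k hk
  · rw [Finsupp.notMem_support_iff.mp hk]; rfl

theorem polyProd_surjective : Function.Surjective (polyProd V V') := by
  rintro ⟨f, hf⟩
  induction hf using Algebra.adjoin_induction with
  | mem f hf =>
    obtain ⟨α, rfl⟩ := hf
    -- A linear form on the product splits as α(x, y) = α(x, 0) + α(0, y).
    refine ⟨⟨_, dual_mem_polyFun (α.comp (LinearMap.inl ℂ V V'))⟩ ⊗ₜ 1 +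
      1 ⊗ₜ ⟨_, dual_mem_polyFun (α.comp (LinearMap.inr ℂ V V'))⟩, ?_⟩
    ext ⟨x, y⟩
    rw [map_add]
    change (polyProd V V' _ : V × V' → ℂ) _ + (polyProd V V' _ : V × V' → ℂ) _ = _
    rw [polyProd_tmul, polyProd_tmul]
    simp [← map_add]
  | algebraMap r => exact ⟨algebraMap ℂ _ r, AlgHom.commutes _ r⟩
  | add f g _ _ hf hg =>
    obtain ⟨s, hs⟩ := hf
    obtain ⟨t, ht⟩ := hg
    exact ⟨s + t, by rw [map_add, hs, ht]; rfl⟩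
  | mul f g _ _ hf hg =>
    obtain ⟨s, hs⟩ := hf
    obtain ⟨t, ht⟩ := hg
    exact ⟨s * t, by rw [map_mul, hs, ht]; rfl⟩

/-- Polynomial functions on a product. -/
def polyProdEquiv (V V' : Type*) [AddCommGroup V] [Module ℂ V] [AddCommGroup V'] [Module ℂ V'] :
    polyFun V ⊗[ℂ] polyFun V' ≃ₐ[ℂ] polyFun (V × V') :=
  AlgEquiv.ofBijective (polyProd V V') ⟨polyProd_injective, polyProd_surjective⟩

theorem polyProdEquiv_symm_fst (f : polyFun V) :
    (polyProdEquiv V V').symm (polyPullback (LinearMap.fst ℂ V V') f) = f ⊗ₜ 1 := by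
  rw [AlgEquiv.symm_apply_eq]
  exact ((Algebra.TensorProduct.productMap_apply_tmul _ _ _ _).trans (by simp)).symm

theorem polyProdEquiv_symm_snd (f : polyFun V') :
    (polyProdEquiv V V').symm (polyPullback (LinearMap.snd ℂ V V') f) = 1 ⊗ₜ f := by
  rw [AlgEquiv.symm_apply_eq]
  exact ((Algebra.TensorProduct.productMap_apply_tmul _ _ _ _).trans (by simp)).symm

end Polynomial

/-! ### Formal neighbourhoods -/

section FormalNeighbourhood

variable {α β : Type*} {R : Subalgebra ℂ (α → ℂ)} {R' : Subalgebra ℂ (β → ℂ)} {Y : Set α}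
  {Y' : Set β}

/-- The germ along `Y` of a function. -/
abbrev germ (R : Subalgebra ℂ (α → ℂ)) (Y : Set α) : R →ₐ[ℂ] FormalFunctions R Y :=
  locOf (nonvanishing R Y) (vanishing R Y)

theorem formalPullback_germ (L : α → β) (hR : ∀ f ∈ R', f ∘ L ∈ R) (hY : Set.MapsTo L Y Y')
    (f : R') : formalPullback L hR hY (germ R' Y' f) = germ R Y (pullback L hR f) :=
  locComplMap_locOf f

theorem formalPullback_mem (L : α → β) (hR : ∀ f ∈ R', f ∘ L ∈ R) (hY : Set.MapsTo L Y Y')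
    {n : ℕ} {x : FormalFunctions R' Y'} (hx : x ∈ formalFiltration R' Y' n) :
    formalPullback L hR hY x ∈ formalFiltration R Y n :=
  locComplMap_mem hx

/-- At each level `x` and its pull-back are fractions with the same numerator and denominator, so
they differ by an element of every step of the filtration. -/
theorem formalPullback_eq_self (hR : ∀ f ∈ R, f ∘ id ∈ R) (hY : Set.MapsTo id Y Y)
    (x : FormalFunctions R Y) : formalPullback id hR hY x = x := by
  refine eq_of_forall_sub_mem_locFiltration fun n => ?_
  obtain ⟨s, hs, a, h⟩ := exists_locOf_mul_sub_mem x n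
  refine mem_of_isUnit_mul_mem (isUnit_locOf hs) ?_
  have h1 := formalPullback_mem id hR hY h
  rw [map_sub, map_mul, formalPullback_germ, formalPullback_germ] at h1
  have h2 := sub_mem h1 h
  change locOf _ _ s * _ - locOf _ _ a - (locOf _ _ s * x - locOf _ _ a) ∈ _ at h2
  rw [sub_sub_sub_cancel_right, ← mul_sub] at h2
  exact h2

theorem formalPullback_strict {L : α → β} {hR : ∀ f ∈ R', f ∘ L ∈ R} {hY : Set.MapsTo L Y Y'}
    (h : ∀ n, ∃ m, ∀ a, ∀ t ∈ nonvanishing R Y, t * pullback L hR a ∈ vanishing R Y ^ m →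
      ∃ s ∈ nonvanishing R' Y', s * a ∈ vanishing R' Y' ^ n) (n : ℕ) :
    ∃ m, ∀ x, formalPullback L hR hY x ∈ formalFiltration R Y m → x ∈ formalFiltration R' Y' n :=
  locComplMap_strict (f := pullback L hR) h n

/-- The variant of `formalPullback_strict` in which no level is lost. At level one it compares
ideals of definition. -/
theorem mem_of_formalPullback_mem {L : α → β} {hR : ∀ f ∈ R', f ∘ L ∈ R}
    {hY : Set.MapsTo L Y Y'} {n : ℕ}
    (h : ∀ a, ∀ t ∈ nonvanishing R Y, t * pullback L hR a ∈ vanishing R Y ^ n →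
      ∃ s ∈ nonvanishing R' Y', s * a ∈ vanishing R' Y' ^ n) {x : FormalFunctions R' Y'}
    (hx : formalPullback L hR hY x ∈ formalFiltration R Y n) : x ∈ formalFiltration R' Y' n :=
  locComplMap_strict_step (f := pullback L hR) le_rfl h hx

theorem exists_formalPullback_eq {L : α → β} {hR : ∀ f ∈ R', f ∘ L ∈ R} {hY : Set.MapsTo L Y Y'}
    (h : ∀ n, ∃ m, ∀ a, ∀ t ∈ nonvanishing R Y, t * pullback L hR a ∈ vanishing R Y ^ m →
      ∃ s ∈ nonvanishing R' Y', s * a ∈ vanishing R' Y' ^ n) {x : FormalFunctions R Y}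
    (hx : ∀ n, ∃ s ∈ nonvanishing R' Y', ∃ a, germ R Y (pullback L hR s) * x -
      germ R Y (pullback L hR a) ∈ formalFiltration R Y n) :
    ∃ y, formalPullback L hR hY y = x :=
  exists_locComplMap_eq (f := pullback L hR) h hx

/-- A symmetry that fixes `x` carries a fraction approximating `x` to another such fraction. This
permits the averaging of numerators and denominators over symmetries of `x`. -/
theorem formalPullback_fraction {L : α → α} {hR : ∀ f ∈ R, f ∘ L ∈ R} {hY : Set.MapsTo L Y Y}
    {x : FormalFunctions R Y} (hx : formalPullback L hR hY x = x) {q p : R} {n : ℕ}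
    (h : germ R Y q * x - germ R Y p ∈ formalFiltration R Y n) :
    germ R Y (pullback L hR q) * x - germ R Y (pullback L hR p) ∈ formalFiltration R Y n := by
  have h1 := formalPullback_mem L hR hY h
  rwa [map_sub, map_mul, hx, formalPullback_germ, formalPullback_germ] at h1

end FormalNeighbourhood

/-! ### The quotient map along a punctured line -/

section QuotientMap

variable {V : Type*} [AddCommGroup V] [Module ℂ V] (G : Subgroup (V ≃ₗ[ℂ] V)) (v : V)

/-- `ℂˣ` acts freely on the image of `v` in `V / G`. -/
def FreeOrbit : Prop := ∀ c : ℂˣ, (∃ g ∈ G, g v = c • v) → c = 1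

variable {G v}

theorem mapsTo_puncturedLine {V' : Type*} [AddCommGroup V'] [Module ℂ V'] (L : V →ₗ[ℂ] V') {v : V}
    {v' : V'} (h : L v = v') : Set.MapsTo L (puncturedLine v) (puncturedLine v') := by
  rintro _ ⟨c, rfl⟩
  refine ⟨c, ?_⟩
  rw [← h]
  exact map_smul L (c : ℂ) v

/-- A polynomial without zeros on `ℂˣ · v` that vanishes on its other translates. -/
theorem exists_separating [Finite G] (hfree : FreeOrbit G v) :
    ∃ P : polyFun V, (∀ y ∈ puncturedLine v, (P : V → ℂ) y ≠ 0) ∧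
      ∀ g ∈ G, g v ≠ v → ∀ y ∈ puncturedLine v, (P : V → ℂ) (g y) = 0 := by
  have key : ∀ g : G, ∃ p : polyFun V, (∀ y ∈ puncturedLine v, (p : V → ℂ) y ≠ 0) ∧
      ((g : V ≃ₗ[ℂ] V) v ≠ v → ∀ y ∈ puncturedLine v, (p : V → ℂ) ((g : V ≃ₗ[ℂ] V) y) = 0) := by
    intro g
    by_cases hg : (g : V ≃ₗ[ℂ] V) v = v
    · exact ⟨1, fun _ _ => one_ne_zero, fun h => absurd hg h⟩
    -- If v = a · gv, then gv is a multiple of v, and freeness forces gv = v. Hence a linear form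
    -- can vanish at gv without vanishing at v; the product of these forms over the group is the
    -- polynomial sought.
    have hv : v ∉ Submodule.span ℂ {(g : V ≃ₗ[ℂ] V) v} := by
      intro h
      obtain ⟨a, ha⟩ := Submodule.mem_span_singleton.mp h
      have ha0 : a ≠ 0 := by
        rintro rfl
        rw [zero_smul] at ha
        exact hg (by rw [← ha, map_zero])
      have h1 := hfree (Units.mk0 a ha0)⁻¹ ⟨g, g.2, by
        rw [eq_inv_smul_iff]; exact ha⟩
      rw [inv_eq_one, Units.ext_iff, Units.val_mk0, Units.val_one] at h1
      rw [h1, one_smul] at ha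
      exact hg ha
    obtain ⟨α, hα, hker⟩ := Submodule.exists_le_ker_of_notMem hv
    refine ⟨⟨_, dual_mem_polyFun α⟩, ?_, fun _ => ?_⟩
    · rintro _ ⟨c, rfl⟩
      change α ((c : ℂ) • v) ≠ 0
      rw [map_smul]
      exact smul_ne_zero c.ne_zero hα
    · rintro _ ⟨c, rfl⟩
      change α (g.1 ((c : ℂ) • v)) = 0
      have h0 : α (g.1 v) = 0 := hker (Submodule.mem_span_singleton_self _)
      rw [map_smul, map_smul, h0, smul_zero]
  have := Fintype.ofFinite G
  choose p hp hp' using key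
  have hprod : ∀ y, ((∏ g, p g : polyFun V) : V → ℂ) y = ∏ g, (p g : V → ℂ) y := fun y => by
    simp
  refine ⟨∏ g, p g, fun y hy => ?_, fun g hg hgv y hy => ?_⟩
  · rw [hprod]
    exact Finset.prod_ne_zero_iff.mpr fun g _ => hp g y hy
  · rw [hprod]
    exact Finset.prod_eq_zero (Finset.mem_univ ⟨g, hg⟩) (hp' ⟨g, hg⟩ hgv y hy)

/-- The inclusion of invariants into polynomial functions. -/
abbrev invariantsIncl (G : Subgroup (V ≃ₗ[ℂ] V)) : invariants G →ₐ[ℂ] polyFun V :=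
  pullback id fun _ hf => hf.1

/-- Right translation of polynomial functions. -/
def polyTranslate (g : G) : polyFun V →ₐ[ℂ] polyFun V := polyPullback g.1.toLinearMap

@[simp]
theorem polyTranslate_apply (g : G) (f : polyFun V) (x : V) :
    (polyTranslate g f : V → ℂ) x = (f : V → ℂ) (g.1 x) := rfl

theorem polyTranslate_mul (g h : G) (f : polyFun V) :
    polyTranslate (g * h) f = polyTranslate h (polyTranslate g f) := rfl

theorem polyTranslate_one (f : polyFun V) : polyTranslate (1 : G) f = f := rfl

theorem polyTranslate_incl (a : invariants G) (g : G) :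
    polyTranslate g (invariantsIncl G a) = invariantsIncl G a :=
  Subtype.ext <| funext fun x => a.2.2 g g.2 x

theorem invariantsIncl_injective : Function.Injective (invariantsIncl G) := fun _ _ h =>
  Subtype.ext (congrArg (fun f : polyFun V => (f : V → ℂ)) h)

theorem exists_invariantsIncl_eq (b : polyFun V) (hb : ∀ g : G, polyTranslate g b = b) :
    ∃ a, invariantsIncl G a = b :=
  ⟨⟨b, b.2, fun g hg x => congrArg (fun f : polyFun V => (f : V → ℂ) x) (hb ⟨g, hg⟩)⟩, rfl⟩

open Classical in
/-- The part of the average over `G` that comes from the stabilizer of `v`. -/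
def partialAverage [Fintype G] (v : V) : polyFun V →ₗ[ℂ] polyFun V :=
  (Fintype.card G : ℂ)⁻¹ • ∑ g : G with g.1 v = v, (polyTranslate g).toLinearMap

theorem apply_of_mem_puncturedLine {g : V ≃ₗ[ℂ] V} (hg : g v = v) {y : V}
    (hy : y ∈ puncturedLine v) : g y = y := by
  obtain ⟨c, rfl⟩ := hy
  change g ((c : ℂ) • v) = (c : ℂ) • v
  rw [map_smul, hg]

/-- Elements that fix v fix its whole line, so on the line the partial average is `b` times the
nonzero number |Stab v| / |G|. -/
theorem partialAverage_ne_zero [Fintype G] {b : polyFun V} {y : V} (hy : y ∈ puncturedLine v)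
    (hb : (b : V → ℂ) y ≠ 0) : (partialAverage (G := G) v b : V → ℂ) y ≠ 0 := by
  classical
  have h : (partialAverage (G := G) v b : V → ℂ) y = (Fintype.card G : ℂ)⁻¹ *
      ∑ g : G with g.1 v = v, (b : V → ℂ) (g.1 y) := by
    simp [partialAverage]
  rw [h, Finset.sum_congr rfl fun g hg => by
    rw [apply_of_mem_puncturedLine (Finset.mem_filter.mp hg).2 hy], Finset.sum_const, nsmul_eq_mul]
  refine mul_ne_zero (by simp) (mul_ne_zero (Nat.cast_ne_zero.mpr ?_) hb)
  exact (Finset.card_pos.mpr ⟨1, by simp⟩).ne'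

/-- Near the punctured line only the stabilizer contributes to the average of a multiple of a
high power of a separating polynomial. -/
theorem average_sub_partialAverage_mem [Fintype G] {P : polyFun V}
    (hP : ∀ g ∈ G, g v ≠ v → ∀ y ∈ puncturedLine v, (P : V → ℂ) (g y) = 0) (n : ℕ) (b : polyFun V) :
    average (G := G) polyTranslate (P ^ n * b) - partialAverage (G := G) v (P ^ n * b) ∈
      vanishing (polyFun V) (puncturedLine v) ^ n := by
  classical
  -- Both sums are divided by |G|, so the difference consists exactly of the terms with gv ≠ v. In
  -- each of them the translate of `P` vanishes on the line, and its n-th power occurs as a factor.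
  have h : average (G := G) polyTranslate (P ^ n * b) - partialAverage (G := G) v (P ^ n * b) =
      (Fintype.card G : ℂ)⁻¹ • ∑ g : G with ¬ g.1 v = v, polyTranslate g (P ^ n * b) := by
    rw [average_apply, ← Finset.sum_filter_add_sum_filter_not Finset.univ (fun g : G => g.1 v = v)]
    simp [partialAverage]
  rw [h, Algebra.smul_def]
  refine Ideal.mul_mem_left _ _ (Ideal.sum_mem _ fun g hg => ?_)
  rw [map_mul, map_pow]
  have hgP : polyTranslate g P ∈ vanishing (polyFun V) (puncturedLine v) :=
    fun y hy => hP g g.2 (Finset.mem_filter.mp hg).2 y hy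
  exact Ideal.mul_mem_right _ _ (Ideal.pow_mem_pow hgP n)

/-- On the line the average coincides with the partial average as soon as the exponent is positive,
and the latter is a nonzero multiple of `P ^ n * b`. -/
theorem average_mem_nonvanishing [Fintype G] {P : polyFun V}
    (hP : ∀ y ∈ puncturedLine v, (P : V → ℂ) y ≠ 0)
    (hP' : ∀ g ∈ G, g v ≠ v → ∀ y ∈ puncturedLine v, (P : V → ℂ) (g y) = 0) {n : ℕ} (hn : n ≠ 0)
    {b : polyFun V} (hb : b ∈ nonvanishing (polyFun V) (puncturedLine v)) :
    average (G := G) polyTranslate (P ^ n * b) ∈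
      nonvanishing (polyFun V) (puncturedLine v) := by
  intro y hy
  have h := Ideal.pow_le_self hn (average_sub_partialAverage_mem hP' n b) y hy
  have h1 : (average (G := G) polyTranslate (P ^ n * b) : V → ℂ) y =
      (partialAverage (G := G) v (P ^ n * b) : V → ℂ) y := by
    simpa [sub_eq_zero] using h
  rw [h1]
  refine partialAverage_ne_zero hy ?_
  simpa using ⟨fun h => absurd h (hP y hy), hb y hy⟩

/-- The ideal of the preimage in `V` of the image of `ℂˣ · v` in `V / G`. -/
def orbitIdeal (G : Subgroup (V ≃ₗ[ℂ] V)) (v : V) : Ideal (polyFun V) :=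
  vanishing (polyFun V) {x | ∃ g ∈ G, g x ∈ puncturedLine v}

theorem orbitIdeal_stable (g : G) {b : polyFun V} (hb : b ∈ orbitIdeal G v) :
    polyTranslate g b ∈ orbitIdeal G v := by
  rintro x ⟨h, hh, hx⟩
  refine hb (g.1 x) ⟨h * g.1⁻¹, mul_mem hh (inv_mem g.2), ?_⟩
  change h (g.1.symm (g.1 x)) ∈ _
  rwa [LinearEquiv.symm_apply_apply]

theorem orbitIdeal_pow_stable (g : G) (n : ℕ) {b : polyFun V} (hb : b ∈ orbitIdeal G v ^ n) :
    polyTranslate g b ∈ orbitIdeal G v ^ n := by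
  have h : orbitIdeal G v ≤ (orbitIdeal G v).comap (polyTranslate g) :=
    fun _ h => orbitIdeal_stable g h
  exact (Ideal.pow_right_mono h n).trans (Ideal.le_comap_pow _ n) hb

/-- An invariant that vanishes on the line vanishes on all its translates. This links the ideal of
the line in the quotient to a `G`-stable ideal of polynomials, to which the comparison of topologies
applies. -/
theorem comap_orbitIdeal : (orbitIdeal G v).comap (invariantsIncl G) =
    vanishing (invariants G) (puncturedLine v) := by
  ext a
  constructor
  · exact fun h y hy => h y ⟨1, one_mem _, hy⟩
  · rintro h x ⟨g, hg, hx⟩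
    exact (a.2.2 g hg x).symm.trans (h _ hx)

/-- A point of the preimage of the orbit lies on the line itself or on another translate. Functions
in the ideal of the line vanish in the first case, and `P` vanishes in the second. So `P` times the
ideal of the line lies in the orbit ideal, and powers follow. -/
theorem separating_pow_mul_mem {P : polyFun V}
    (hP : ∀ g ∈ G, g v ≠ v → ∀ y ∈ puncturedLine v, (P : V → ℂ) (g y) = 0) {n : ℕ}
    {b : polyFun V} (hb : b ∈ vanishing (polyFun V) (puncturedLine v) ^ n) :
    P ^ n * b ∈ orbitIdeal G v ^ n := by
  have h : Ideal.span {P} * vanishing (polyFun V) (puncturedLine v) ≤ orbitIdeal G v := by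
    rw [Ideal.span_singleton_mul_le_iff]
    rintro j hj x ⟨g, hg, hx⟩
    have hgx : g⁻¹ (g x) = x := g.symm_apply_apply x
    change (P : V → ℂ) x * (j : V → ℂ) x = 0
    rw [← hgx]
    by_cases hv : g⁻¹ v = v
    · rw [apply_of_mem_puncturedLine hv hx, hj _ hx, mul_zero]
    · rw [hP _ (inv_mem hg) hv _ hx, zero_mul]
  refine Ideal.pow_right_mono h n ?_
  rw [mul_pow]
  exact Ideal.mul_mem_mul (Ideal.pow_mem_pow (Ideal.mem_span_singleton_self P) n) hb

/-- The pull-back of functions along the quotient map `V → V / G`, near `ℂˣ · v`. -/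
abbrev quotientPullback (G : Subgroup (V ≃ₗ[ℂ] V)) (v : V) :
    FormalFunctions (invariants G) (puncturedLine v) →ₐ[ℂ]
      FormalFunctions (polyFun V) (puncturedLine v) :=
  formalPullback id (fun _ hf => hf.1) (Set.mapsTo_id _)

/-- Strictness of the quotient map, stated up to denominators. Multiplication by a power of `P`
moves `t * a` into a power of the orbit ideal. Averaging replaces the denominator by an invariant
one and leaves the invariant `a` alone, and `exists_pow_comap_le` returns to powers of the ideal of
the line in the invariants. -/
theorem exists_invariant_mul_mem [FiniteDimensional ℂ V] [Finite G] (hfree : FreeOrbit G v)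
    (n : ℕ) : ∃ m, ∀ a : invariants G, ∀ t ∈ nonvanishing (polyFun V) (puncturedLine v),
      t * invariantsIncl G a ∈ vanishing (polyFun V) (puncturedLine v) ^ m →
      ∃ s ∈ nonvanishing (invariants G) (puncturedLine v),
        s * a ∈ vanishing (invariants G) (puncturedLine v) ^ n := by
  have := Fintype.ofFinite G
  obtain ⟨P, hP, hP'⟩ := exists_separating hfree
  obtain ⟨m, hm⟩ := exists_pow_comap_le (G := G) polyTranslate polyTranslate_mul polyTranslate_one
    (invariantsIncl G) invariantsIncl_injective polyTranslate_incl exists_invariantsIncl_eq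
    (orbitIdeal G v) (IsNoetherian.noetherian _) (fun g _ h => orbitIdeal_stable g h) n
  rw [comap_orbitIdeal] at hm
  -- The exponent has to be positive for the averaged denominator to be without zeros on the line;
  -- `m` itself may be zero.
  refine ⟨m + 1, fun a t ht h => ?_⟩
  obtain ⟨s, hs⟩ := exists_invariantsIncl_eq _
    fun g => action_average (G := G) polyTranslate polyTranslate_mul g (P ^ (m + 1) * t)
  refine ⟨s, fun y hy => ?_, hm _ ?_⟩
  · have := average_mem_nonvanishing (G := G) hP hP' m.succ_ne_zero ht y hy
    rwa [← hs] at this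
  · rw [map_mul, hs, ← average_mul_of_fixed _ (polyTranslate_incl a), average_apply,
      Algebra.smul_def]
    refine Ideal.mul_mem_left _ _ (Ideal.sum_mem _ fun g _ => orbitIdeal_pow_stable g m ?_)
    rw [mul_assoc]
    exact Ideal.pow_le_pow_right m.le_succ (separating_pow_mul_mem hP' h)

theorem quotientPullback_strict [FiniteDimensional ℂ V] [Finite G] (hfree : FreeOrbit G v)
    (n : ℕ) : ∃ m, ∀ x, quotientPullback G v x ∈ formalFiltration (polyFun V) (puncturedLine v) m →
      x ∈ formalFiltration (invariants G) (puncturedLine v) n :=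
  formalPullback_strict (exists_invariant_mul_mem hfree) n

/-- At level one, membership is vanishing on the line, and there a denominator without zeros can be
cancelled pointwise. -/
theorem mem_formalIdeal_of_quotientPullback_mem
    {x : FormalFunctions (invariants G) (puncturedLine v)}
    (hx : quotientPullback G v x ∈ formalIdeal (polyFun V) (puncturedLine v)) :
    x ∈ formalIdeal (invariants G) (puncturedLine v) := by
  refine mem_of_formalPullback_mem (fun a t ht h => ⟨1, one_mem _, ?_⟩) hx
  rw [pow_one] at h
  rw [pow_one, one_mul]
  intro y hy
  have h1 : (t : V → ℂ) y * (a : V → ℂ) y = 0 := h y hy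
  exact (mul_eq_zero.mp h1).resolve_left (ht y hy)

-- Only the stabilizer of v is assumed to fix `x`, so only its translates of the fraction still
-- approximate `x`. This is why the partial average appears and not the full one.
open Classical in
theorem partialAverage_fraction [Fintype G] {x : FormalFunctions (polyFun V) (puncturedLine v)}
    (hx : ∀ g ∈ G, ∀ hg : g v = v, formalPullback g (fun _ hf => polyFun_comp g.toLinearMap hf)
      (mapsTo_puncturedLine g.toLinearMap hg) x = x) {q p : polyFun V} {n : ℕ}
    (h : germ _ _ q * x - germ _ _ p ∈ formalFiltration (polyFun V) (puncturedLine v) n) :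
    germ _ _ (partialAverage (G := G) v q) * x - germ _ _ (partialAverage (G := G) v p) ∈
      formalFiltration (polyFun V) (puncturedLine v) n := by
  set φ := germ (polyFun V) (puncturedLine v)
  have h3 : φ (partialAverage (G := G) v q) * x - φ (partialAverage (G := G) v p) =
      algebraMap ℂ _ (Fintype.card G : ℂ)⁻¹ *
      ∑ g : G with g.1 v = v, (φ (polyTranslate g q) * x - φ (polyTranslate g p)) := by
    simp only [partialAverage, LinearMap.smul_apply, LinearMap.sum_apply, AlgHom.toLinearMap_apply,
      map_smul, map_sum, smul_mul_assoc, Finset.sum_mul, Finset.sum_sub_distrib, mul_sub,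
      ← Algebra.smul_def]
  rw [h3]
  exact Ideal.mul_mem_left _ _ (Ideal.sum_mem _ fun g hg =>
    formalPullback_fraction (hx g g.2 (Finset.mem_filter.mp hg).2) h)

/-- A function on the formal neighbourhood of `ℂˣ · v` that is invariant under the stabilizer
of `v` is a fraction of invariants modulo each step of the filtration. -/
theorem exists_invariant_fraction [Finite G] (hfree : FreeOrbit G v)
    {x : FormalFunctions (polyFun V) (puncturedLine v)}
    (hx : ∀ g ∈ G, ∀ hg : g v = v, formalPullback g (fun _ hf => polyFun_comp g.toLinearMap hf)
      (mapsTo_puncturedLine g.toLinearMap hg) x = x) (n : ℕ) :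
    ∃ s ∈ nonvanishing (invariants G) (puncturedLine v), ∃ a : invariants G,
      germ (polyFun V) (puncturedLine v) (invariantsIncl G s) * x -
        germ (polyFun V) (puncturedLine v) (invariantsIncl G a) ∈
      formalFiltration (polyFun V) (puncturedLine v) n := by
  have := Fintype.ofFinite G
  obtain ⟨P, hP, hP'⟩ := exists_separating hfree
  -- One level more than required, so that the exponent of `P` is positive even for `n = 0`.
  obtain ⟨q, hq, p, h⟩ := exists_locOf_mul_sub_mem x (n + 1)
  set φ := germ (polyFun V) (puncturedLine v)
  have lift : ∀ b : polyFun V, ∃ a, invariantsIncl G a =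
      average (G := G) polyTranslate (P ^ (n + 1) * b) := fun b =>
    exists_invariantsIncl_eq _ fun g => action_average (G := G) polyTranslate polyTranslate_mul g _
  obtain ⟨s, hs⟩ := lift q
  obtain ⟨a, ha⟩ := lift p
  refine ⟨s, fun y hy => ?_, a, locFiltration_antitone n.le_succ ?_⟩
  · have := average_mem_nonvanishing (G := G) hP hP' n.succ_ne_zero hq y hy
    rwa [← hs] at this
  rw [hs, ha]
  -- The stabilizer average gives a fraction for `x`, the full average gives invariants, and after
  -- multiplication by the power of `P` the two agree to the required order.
  have near : ∀ b : polyFun V, φ (average (G := G) polyTranslate (P ^ (n + 1) * b)) -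
      φ (partialAverage (G := G) v (P ^ (n + 1) * b)) ∈
        formalFiltration (polyFun V) (puncturedLine v) (n + 1) := fun b => by
    rw [← map_sub]
    exact locOf_mem_of_mem (average_sub_partialAverage_mem hP' (n + 1) b)
  have h1 : φ (P ^ (n + 1) * q) * x - φ (P ^ (n + 1) * p) ∈
      formalFiltration (polyFun V) (puncturedLine v) (n + 1) := by
    rw [map_mul, map_mul, mul_assoc, ← mul_sub]
    exact Ideal.mul_mem_left _ _ h
  have h4 := sub_mem (add_mem (Ideal.mul_mem_right x _ (near q)) (partialAverage_fraction hx h1))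
    (near p)
  convert h4 using 1
  ring

/-- A function on the formal neighbourhood of `ℂˣ · v` that is invariant under the stabilizer
of `v` descends to the formal neighbourhood in the quotient. -/
theorem exists_quotientPullback_eq [FiniteDimensional ℂ V] [Finite G] (hfree : FreeOrbit G v)
    {x : FormalFunctions (polyFun V) (puncturedLine v)}
    (hx : ∀ g ∈ G, ∀ hg : g v = v, formalPullback g (fun _ hf => polyFun_comp g.toLinearMap hf)
      (mapsTo_puncturedLine g.toLinearMap hg) x = x) :
    ∃ y, quotientPullback G v y = x :=
  exists_formalPullback_eq (exists_invariant_mul_mem hfree) (exists_invariant_fraction hfree hx)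

end QuotientMap

/-! ### Ideals and kernels in tensor products over ℂ -/

section Tensor

variable {A B A' B' : Type*} [CommRing A] [Algebra ℂ A] [CommRing B] [Algebra ℂ B]
  [CommRing A'] [Algebra ℂ A'] [CommRing B'] [Algebra ℂ B']

/-- Over a field, the kernel of a tensor product of algebra maps is generated by their kernels. -/
theorem ker_tensorProduct_map (f : A →ₐ[ℂ] A') (g : B →ₐ[ℂ] B') {x : A ⊗[ℂ] B}
    (hx : Algebra.TensorProduct.map f g x = 0) :
    x ∈ tensorIdeal (RingHom.ker f) (RingHom.ker g) := by
  -- Each map is factored through its range. The tensor product of the two inclusions is injective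
  -- by flatness, and for the surjective parts the kernel is known.
  have h1 : Algebra.TensorProduct.map f g =
      (Algebra.TensorProduct.map f.range.val g.range.val).comp
        (Algebra.TensorProduct.map f.rangeRestrict g.rangeRestrict) := by
    ext <;> simp
  have h2 : Function.Injective (Algebra.TensorProduct.map f.range.val g.range.val) :=
    TensorProduct.map_injective_of_flat_flat f.range.val.toLinearMap g.range.val.toLinearMap
      Subtype.val_injective Subtype.val_injective
  rw [h1, AlgHom.comp_apply] at hx
  have h3 : x ∈ RingHom.ker (Algebra.TensorProduct.map f.rangeRestrict g.rangeRestrict) :=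
    h2 (hx.trans (map_zero _).symm)
  rw [Algebra.TensorProduct.map_ker _ _ f.rangeRestrict_surjective
    g.rangeRestrict_surjective] at h3
  have h4 : RingHom.ker f.rangeRestrict = RingHom.ker f := by
    ext y; simp [RingHom.mem_ker, Subtype.ext_iff]
  have h5 : RingHom.ker g.rangeRestrict = RingHom.ker g := by
    ext y; simp [RingHom.mem_ker, Subtype.ext_iff]
  rwa [h4, h5] at h3

theorem tensorIdeal_mono {I I' : Ideal A} {J J' : Ideal B} (hI : I ≤ I') (hJ : J ≤ J') :
    tensorIdeal I J ≤ tensorIdeal I' J' :=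
  sup_le_sup (Ideal.map_mono hI) (Ideal.map_mono hJ)

theorem tensorIdeal_pow_le (I : Ideal A) (J : Ideal B) (n : ℕ) :
    tensorIdeal (I ^ n) (J ^ n) ≤ tensorIdeal I J ^ n := by
  unfold tensorIdeal
  rw [Ideal.map_pow, Ideal.map_pow]
  exact sup_le (Ideal.pow_right_mono le_sup_left n) (Ideal.pow_right_mono le_sup_right n)

/-- In a product of n + n factors from a sum of two ideals, one of the ideals occurs at least n
times. -/
theorem tensorIdeal_pow_eq_bot {I : Ideal A} {J : Ideal B} {n : ℕ} (hI : I ^ n = ⊥)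
    (hJ : J ^ n = ⊥) : tensorIdeal I J ^ (n + n) = ⊥ := by
  rw [eq_bot_iff]
  refine Ideal.sup_pow_add_le_pow_sup_pow.trans ?_
  rw [← Ideal.map_pow, ← Ideal.map_pow, hI, hJ, Ideal.map_bot, Ideal.map_bot, sup_bot_eq]

theorem tmul_one_mem_tensorIdeal {I : Ideal A} {J : Ideal B} {a : A} (ha : a ∈ I) :
    a ⊗ₜ[ℂ] (1 : B) ∈ tensorIdeal I J :=
  Ideal.mem_sup_left (Ideal.mem_map_of_mem
    (Algebra.TensorProduct.includeLeft : A →ₐ[ℂ] A ⊗[ℂ] B) ha)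

theorem one_tmul_mem_tensorIdeal {I : Ideal A} {J : Ideal B} {b : B} (hb : b ∈ J) :
    (1 : A) ⊗ₜ[ℂ] b ∈ tensorIdeal I J :=
  Ideal.mem_sup_right (Ideal.mem_map_of_mem
    (Algebra.TensorProduct.includeRight : B →ₐ[ℂ] A ⊗[ℂ] B) hb)

theorem map_mkₐ_pow_eq_bot {I F : Ideal A} {n : ℕ} (h : I ^ n ≤ F) :
    I.map (Ideal.Quotient.mkₐ ℂ F) ^ n = ⊥ := by
  rw [← Ideal.map_pow, eq_bot_iff]
  exact (Ideal.map_mono h).trans (Ideal.map_quotient_self F).le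

end Tensor

/-! ### Formal neighbourhoods in a product -/

section Product

variable {U W : Type*} [AddCommGroup U] [Module ℂ U] [AddCommGroup W] [Module ℂ W] (Y : Set U)

/-- Pull-back along the first projection from a neighbourhood of `Y × {0}`. -/
abbrev fstPullback (W : Type*) [AddCommGroup W] [Module ℂ W] (Y : Set U) :
    FormalFunctions (polyFun U) Y →ₐ[ℂ]
    FormalFunctions (polyFun (U × W)) (Y ×ˢ ({0} : Set W)) :=
  formalPullback (LinearMap.fst ℂ U W) (fun _ hf => polyFun_comp _ hf) (fun _ hp => hp.1)

/-- Pull-back along the second projection from a neighbourhood of `Y × {0}`. -/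
abbrev sndPullback (W : Type*) [AddCommGroup W] [Module ℂ W] (Y : Set U) :
    OriginFunctions W →ₐ[ℂ] FormalFunctions (polyFun (U × W)) (Y ×ˢ ({0} : Set W)) :=
  formalPullback (LinearMap.snd ℂ U W) (fun _ hf => polyFun_comp _ hf) (fun _ hp => hp.2)

variable {Y}

theorem fstPullback_germ (f : polyFun U) : fstPullback W Y (germ (polyFun U) Y f) =
    germ (polyFun (U × W)) (Y ×ˢ ({0} : Set W)) (polyPullback (LinearMap.fst ℂ U W) f) :=
  formalPullback_germ _ _ _ f

theorem sndPullback_germ (f : polyFun W) : sndPullback W Y (germ (polyFun W) {0} f) =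
    germ (polyFun (U × W)) (Y ×ˢ ({0} : Set W)) (polyPullback (LinearMap.snd ℂ U W) f) :=
  formalPullback_germ _ _ _ f

/-- Restriction of a polynomial on `U × W` to `U`. -/
abbrev restrictLeft (f : polyFun (U × W)) : polyFun U := polyPullback (LinearMap.inl ℂ U W) f

/-- The difference f(u, w) - f(u, 0) is a sum of terms a(u) (b(w) - b(0)). Thus, modulo functions of
w that vanish at 0, a polynomial may be replaced by its restriction to `U`. -/
theorem polyProd_sub_restrictLeft_mem {E : Type*} [CommRing E] [Algebra ℂ E] (𝔫 : Ideal E)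
    (σ : polyFun (U × W) →ₐ[ℂ] E)
    (h : ∀ b : polyFun W, (b : W → ℂ) 0 = 0 → σ (polyPullback (LinearMap.snd ℂ U W) b) ∈ 𝔫)
    (f : polyFun (U × W)) :
    σ f - σ (polyPullback (LinearMap.fst ℂ U W) (restrictLeft f)) ∈ 𝔫 := by
  obtain ⟨s, rfl⟩ := polyProd_surjective f
  induction s with
  | zero => simp
  | add s t hs ht =>
    simp only [map_add] at hs ht ⊢
    convert add_mem hs ht using 1
    ring
  | tmul a b =>
    have h1 : polyProd U W (a ⊗ₜ b) -
        polyPullback (LinearMap.fst ℂ U W) (restrictLeft (polyProd U W (a ⊗ₜ b))) =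
        polyPullback (LinearMap.fst ℂ U W) a *
          polyPullback (LinearMap.snd ℂ U W) (b - algebraMap ℂ _ ((b : W → ℂ) 0)) := by
      ext x
      change (polyProd U W (a ⊗ₜ b) : U × W → ℂ) x - (polyProd U W (a ⊗ₜ b) : U × W → ℂ) (x.1, 0) =
        (a : U → ℂ) x.1 * ((b : W → ℂ) x.2 - (b : W → ℂ) 0)
      rw [polyProd_tmul, polyProd_tmul]
      ring
    rw [← map_sub, h1, map_mul]
    exact Ideal.mul_mem_left _ _ (h _ (sub_self _))

/-- A map out of polynomials on `U × W` extends to the formal neighbourhood of `Y × {0}` if it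
inverts functions on `U` without zeros on `Y` and sends functions on `U` vanishing on `Y`, and
functions on `W` vanishing at `0`, to a nilpotent ideal. -/
theorem exists_prod_hom {E : Type*} [CommRing E] [Algebra ℂ E] (σ : polyFun (U × W) →ₐ[ℂ] E)
    (𝔫 : Ideal E) {N : ℕ} (hnil : 𝔫 ^ N = ⊥)
    (hunit : ∀ s ∈ nonvanishing (polyFun U) Y, IsUnit (σ (polyPullback (LinearMap.fst ℂ U W) s)))
    (hfst : ∀ f ∈ vanishing (polyFun U) Y, σ (polyPullback (LinearMap.fst ℂ U W) f) ∈ 𝔫)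
    (hsnd : ∀ b : polyFun W, (b : W → ℂ) 0 = 0 →
      σ (polyPullback (LinearMap.snd ℂ U W) b) ∈ 𝔫) :
    ∃ Ψ : FormalFunctions (polyFun (U × W)) (Y ×ˢ ({0} : Set W)) →ₐ[ℂ] E,
      (∀ f, Ψ (germ _ _ f) = σ f) ∧
        ∀ x ∈ formalFiltration (polyFun (U × W)) (Y ×ˢ ({0} : Set W)) N, Ψ x = 0 := by
  have hrest := polyProd_sub_restrictLeft_mem 𝔫 σ hsnd
  refine exists_locCompletion_hom σ N (fun s hs => ?_) (fun f hf => ?_)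
  -- The image of a denominator differs by a nilpotent from the image of its restriction to `U`,
  -- which is a unit by assumption.
  · have h2 : IsNilpotent (σ s - σ (polyPullback (LinearMap.fst ℂ U W) (restrictLeft s))) :=
      ⟨N, by
        have := Ideal.pow_mem_pow (hrest s) N
        rwa [hnil, Ideal.mem_bot] at this⟩
    have h4 := h2.isUnit_add_left_of_commute
      (hunit (restrictLeft s) fun y hy => hs (y, 0) ⟨hy, rfl⟩) (Commute.all _ _)
    rwa [add_sub_cancel] at h4
  · have h1 : vanishing (polyFun (U × W)) (Y ×ˢ ({0} : Set W)) ≤ 𝔫.comap σ := fun f hf =>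
      (Submodule.sub_mem_iff_left _ (hfst _ fun y hy => hf (y, 0) ⟨hy, rfl⟩)).mp (hrest f)
    have h2 := ((Ideal.pow_right_mono h1 _).trans (Ideal.le_comap_pow _ _)) hf
    rwa [Ideal.mem_comap, hnil, Ideal.mem_bot] at h2

/-- Both sides kill a step of the filtration, so they are determined by their values on germs. -/
theorem hom_formalPullback_eq {α β E : Type*} [CommRing E] [Algebra ℂ E]
    {R : Subalgebra ℂ (α → ℂ)} {R' : Subalgebra ℂ (β → ℂ)} {Y : Set α} {Y' : Set β} {L : α → β}
    {hR : ∀ f ∈ R', f ∘ L ∈ R} {hY : Set.MapsTo L Y Y'} {Ψ : FormalFunctions R Y →ₐ[ℂ] E}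
    {φ : FormalFunctions R' Y' →ₐ[ℂ] E} {n : ℕ} (hΨ : ∀ x ∈ formalFiltration R Y n, Ψ x = 0)
    (hφ : ∀ x ∈ formalFiltration R' Y' n, φ x = 0)
    (h : ∀ f, Ψ (germ R Y (pullback L hR f)) = φ (germ R' Y' f)) (x : FormalFunctions R' Y') :
    Ψ (formalPullback L hR hY x) = φ x := by
  have := locCompletion_hom_ext (φ := Ψ.comp (formalPullback L hR hY)) (ψ := φ) n
    (fun x hx => hΨ _ (formalPullback_mem L hR hY hx)) hφ fun f => by
      rw [AlgHom.comp_apply, formalPullback_germ, h]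
  exact congrArg (fun φ => φ x) this

/-- The truncation of the algebra of a formal neighbourhood. -/
abbrev Truncation {α : Type*} (R : Subalgebra ℂ (α → ℂ)) (Y : Set α) (q : ℕ) : Type _ :=
  FormalFunctions R Y ⧸ formalFiltration R Y q

/-- The projection to the truncation. -/
abbrev truncate {α : Type*} (R : Subalgebra ℂ (α → ℂ)) (Y : Set α) (q : ℕ) :
    FormalFunctions R Y →ₐ[ℂ] Truncation R Y q := Ideal.Quotient.mkₐ ℂ (formalFiltration R Y q)

theorem truncate_eq_zero {α : Type*} {R : Subalgebra ℂ (α → ℂ)} {Y : Set α} {q : ℕ}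
    {x : FormalFunctions R Y} : truncate R Y q x = 0 ↔ x ∈ formalFiltration R Y q :=
  Ideal.Quotient.eq_zero_iff_mem

theorem map_truncate_pow [FiniteDimensional ℂ U] (q : ℕ) :
    (formalIdeal (polyFun U) Y).map (truncate (polyFun U) Y q) ^ q = ⊥ := by
  have h : formalIdeal (polyFun U) Y ^ q ≤ formalFiltration (polyFun U) Y q :=
    (locFiltration_eq_pow (IsNoetherian.noetherian (vanishing (polyFun U) Y)) q).ge
  exact map_mkₐ_pow_eq_bot h

theorem truncate_germ_mem {α : Type*} {R : Subalgebra ℂ (α → ℂ)} {Y : Set α} (q : ℕ) {f : R}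
    (hf : f ∈ vanishing R Y) :
    truncate R Y q (germ R Y f) ∈ (formalIdeal R Y).map (truncate R Y q) :=
  Ideal.mem_map_of_mem (truncate R Y q) (locOf_mem_of_mem (by rwa [pow_one]))

/-- The truncation `𝒪(U × W) → 𝒪(U)/F_q ⊗ 𝒪(W)/F_q` of the formal neighbourhood of `Y × {0}`. -/
theorem exists_truncation [FiniteDimensional ℂ U] [FiniteDimensional ℂ W] (q : ℕ) :
    ∃ Ψ : FormalFunctions (polyFun (U × W)) (Y ×ˢ ({0} : Set W)) →ₐ[ℂ]
      Truncation (polyFun U) Y q ⊗[ℂ] Truncation (polyFun W) {0} q,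
      (∀ x ∈ formalFiltration _ _ (q + q), Ψ x = 0) ∧
      (∀ l, Ψ (fstPullback W Y l) = truncate (polyFun U) Y q l ⊗ₜ 1) ∧
      (∀ m, Ψ (sndPullback W Y m) = 1 ⊗ₜ truncate (polyFun W) {0} q m) := by
  -- On polynomials the map is the truncation in each tensor factor. It extends to the formal
  -- neighbourhood because both truncated ideals have vanishing q-th power, whence the level `q +
  -- q`.
  let σ := (Algebra.TensorProduct.map ((truncate (polyFun U) Y q).comp (germ (polyFun U) Y))
    ((truncate (polyFun W) {0} q).comp (germ (polyFun W) {0}))).comp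
      (polyProdEquiv U W).symm.toAlgHom
  have hfst : ∀ f, σ (polyPullback (LinearMap.fst ℂ U W) f) =
      truncate (polyFun U) Y q (germ (polyFun U) Y f) ⊗ₜ 1 := fun f => by
    change Algebra.TensorProduct.map _ _ ((polyProdEquiv U W).symm _) = _
    rw [polyProdEquiv_symm_fst, Algebra.TensorProduct.map_tmul, map_one]
    rfl
  have hsnd : ∀ f, σ (polyPullback (LinearMap.snd ℂ U W) f) =
      1 ⊗ₜ truncate (polyFun W) {0} q (germ (polyFun W) {0} f) := fun f => by
    change Algebra.TensorProduct.map _ _ ((polyProdEquiv U W).symm _) = _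
    rw [polyProdEquiv_symm_snd, Algebra.TensorProduct.map_tmul, map_one]
    rfl
  obtain ⟨Ψ, hΨ, hΨ0⟩ := exists_prod_hom (Y := Y) σ (tensorIdeal _ _)
    (tensorIdeal_pow_eq_bot (map_truncate_pow (Y := Y) q) (map_truncate_pow (Y := {0}) q))
    (fun s hs => by
      rw [hfst]
      exact ((isUnit_locOf hs).map (truncate (polyFun U) Y q)).map
        (Algebra.TensorProduct.includeLeft (S := ℂ) : _ →ₐ[ℂ] _ ⊗[ℂ] _))
    (fun f hf => by rw [hfst]; exact tmul_one_mem_tensorIdeal (truncate_germ_mem q hf))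
    (fun b hb => by
      rw [hsnd]
      exact one_tmul_mem_tensorIdeal (truncate_germ_mem q (by rintro _ rfl; exact hb)))
  refine ⟨Ψ, hΨ0, fun l => ?_, fun m => ?_⟩
  · refine hom_formalPullback_eq
      (φ := (Algebra.TensorProduct.includeLeft (S := ℂ)).comp
        (truncate (polyFun U) Y q)) hΨ0
      (fun x hx => by
        rw [AlgHom.comp_apply, truncate_eq_zero.mpr
          (locFiltration_antitone (Nat.le_add_left q q) hx), map_zero])
      (fun f => ?_) l
    exact (hΨ (polyPullback (LinearMap.fst ℂ U W) f)).trans (hfst f)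
  · refine hom_formalPullback_eq
      (φ := Algebra.TensorProduct.includeRight.comp (truncate (polyFun W) {0} q)) hΨ0
      (fun x hx => by
        rw [AlgHom.comp_apply, truncate_eq_zero.mpr
          (locFiltration_antitone (Nat.le_add_left q q) hx), map_zero])
      (fun f => ?_) m
    exact (hΨ (polyPullback (LinearMap.snd ℂ U W) f)).trans (hsnd f)

end Product

/-- Surjectivity turns the hypothesis into `J ≤ I.map f`, so powers of `J` lie in images of powers
of `I`. In this way powers of ideals are compared on the leaf by means of polynomials on V^Γ₀,
without finite generation of the ideal in the invariants. -/
theorem mem_pow_of_bijective {A B : Type*} [CommRing A] [CommRing B] (f : A →+* B)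
    (hf : Function.Bijective f) {I : Ideal A} {J : Ideal B} (h : ∀ x, f x ∈ J → x ∈ I) {n : ℕ}
    {x : A} (hx : f x ∈ J ^ n) : x ∈ I ^ n := by
  have h1 : J ≤ I.map f := fun y hy => by
    obtain ⟨z, rfl⟩ := hf.2 y
    exact Ideal.mem_map_of_mem f (h z hy)
  have h2 := Ideal.pow_right_mono h1 n hx
  rw [← Ideal.map_pow, Ideal.mem_map_iff_of_surjective f hf.2] at h2
  obtain ⟨y, hy, e⟩ := h2
  exact hf.1 e ▸ hy

/-! ### The product of a formal neighbourhood with a quotient of a formal neighbourhood of the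
origin -/

section Product

variable {U W : Type*} [AddCommGroup U] [Module ℂ U] [AddCommGroup W] [Module ℂ W]
  {R : Subalgebra ℂ (U → ℂ)} (hR : ∀ f ∈ R, f ∘ id ∈ polyFun U) (Y : Set U)
  (H : Subgroup (W ≃ₗ[ℂ] W))

/-- The pull-back of functions along the map from the formal neighbourhood of `Y × {0}` in `U × W`
to the product of the formal neighbourhood of `Y` in `Spec R` and `W^ / H`. -/
def prodPullback : FormalFunctions R Y ⊗[ℂ] originInvariants H →ₐ[ℂ]
    FormalFunctions (polyFun (U × W)) (Y ×ˢ ({0} : Set W)) :=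
  Algebra.TensorProduct.productMap
    (formalPullback (LinearMap.fst ℂ U W)
      (fun _ hf => polyFun_comp (LinearMap.fst ℂ U W) (hR _ hf)) (fun _ hp => hp.1))
    ((sndPullback W Y).comp (originInvariants H).val)

/-- The inclusion of functions in `R` into polynomial functions, near `Y`. -/
abbrev inclPullback : FormalFunctions R Y →ₐ[ℂ] FormalFunctions (polyFun U) Y :=
  formalPullback id hR (Set.mapsTo_id Y)

variable {hR Y H}

theorem prodPullback_tmul (l : FormalFunctions R Y) (m : originInvariants H) :
    prodPullback hR Y H (l ⊗ₜ m) =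
      fstPullback W Y (inclPullback hR Y l) * sndPullback W Y m.1 := by
  rw [prodPullback, Algebra.TensorProduct.productMap_apply_tmul]
  congr 1
  exact (formalPullback_formalPullback (LinearMap.fst ℂ U W)
    (fun _ hf => polyFun_comp (LinearMap.fst ℂ U W) hf) (fun _ hp => hp.1) id hR (Set.mapsTo_id Y)
    (LinearMap.fst ℂ U W) rfl (fun _ hf => polyFun_comp (LinearMap.fst ℂ U W) (hR _ hf))
    (fun _ hp => hp.1) l).symm

/-- The comparison of topologies `exists_pow_comap_le`, now for a finite group acting on a ring of
formal functions. The ideal of the origin there is finitely generated because the polynomial ring is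
Noetherian. -/
theorem exists_originIdeal_pow [FiniteDimensional ℂ W] [Finite H] (n : ℕ) :
    ∃ q, ∀ m : originInvariants H, m.1 ∈ formalIdeal (polyFun W) ({0} : Set W) ^ q →
      m ∈ originIdeal H ^ n := by
  have := Fintype.ofFinite H
  let ρ : H → OriginFunctions W →ₐ[ℂ] OriginFunctions W :=
    fun h => originPullback h.1.toLinearMap
  have hmul : ∀ g h b, ρ (g * h) b = ρ h (ρ g b) := fun g h b =>
    (originPullback_comp h.1.toLinearMap g.1.toLinearMap b).symm
  have hone : ∀ b, ρ 1 b = b := fun b => formalPullback_eq_self _ _ b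
  have hfix : ∀ (m : originInvariants H) g, ρ g m.1 = m.1 := fun m g => m.2 g g.2
  have hrange : ∀ b, (∀ g, ρ g b = b) → ∃ m, (originInvariants H).val m = b :=
    fun b hb => ⟨⟨b, fun h hh => hb ⟨h, hh⟩⟩, rfl⟩
  have hstable : ∀ g, ∀ b ∈ formalIdeal (polyFun W) ({0} : Set W),
      ρ g b ∈ formalIdeal (polyFun W) ({0} : Set W) := fun g b hb =>
    formalPullback_mem g.1.toLinearMap (fun _ hf => polyFun_comp _ hf) (mapsTo_zero _) hb
  exact exists_pow_comap_le ρ hmul hone (originInvariants H).val Subtype.val_injective hfix hrange _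
    (locFiltration_one_fg (IsNoetherian.noetherian (vanishing (polyFun W) ({0} : Set W))))
    hstable n

/-- After truncation of both factors the map becomes a tensor product of two algebra maps, so its
kernel is generated by elements of the factors. These are small in their own factor: on the left
through the bijection with functions on `U`, on the right through `exists_originIdeal_pow`. -/
theorem exists_prodPullback_strict [FiniteDimensional ℂ U] [FiniteDimensional ℂ W] [Finite H]
    (hbij : Function.Bijective (inclPullback hR Y))
    (hideal : ∀ x, inclPullback hR Y x ∈ formalIdeal (polyFun U) Y → x ∈ formalIdeal R Y) (n : ℕ) :
    ∃ m, ∀ t, prodPullback hR Y H t ∈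
      formalFiltration (polyFun (U × W)) (Y ×ˢ ({0} : Set W)) m →
        t ∈ tensorIdeal (formalIdeal R Y) (originIdeal H) ^ n := by
  obtain ⟨q₀, hq₀⟩ := exists_originIdeal_pow (H := H) n
  -- Level `n` serves the left factor, where no level is lost; level `q₀` serves the invariants on
  -- the right.
  obtain ⟨Ψ, hΨ, hfst, hsnd⟩ := exists_truncation (Y := Y) (U := U) (W := W) (max q₀ n)
  refine ⟨max q₀ n + max q₀ n, fun t ht => ?_⟩
  have h1 : Ψ.comp (prodPullback hR Y H) = Algebra.TensorProduct.map
      ((truncate (polyFun U) Y (max q₀ n)).comp (inclPullback hR Y))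
      ((truncate (polyFun W) {0} (max q₀ n)).comp (originInvariants H).val) := by
    refine Algebra.TensorProduct.ext' fun l m => ?_
    rw [AlgHom.comp_apply, prodPullback_tmul, map_mul, hfst, hsnd,
      Algebra.TensorProduct.tmul_mul_tmul, one_mul, mul_one]
    rfl
  have h2 := ker_tensorProduct_map _ _ ((congrArg (fun φ => φ t) h1).symm.trans (hΨ _ ht))
  refine tensorIdeal_pow_le _ _ n (tensorIdeal_mono (fun l hl => ?_) (fun m hm => ?_) h2)
  · have hl' : inclPullback hR Y l ∈ formalFiltration (polyFun U) Y (max q₀ n) :=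
      truncate_eq_zero.mp hl
    have h3 := locFiltration_antitone (le_max_right q₀ n) hl'
    rw [locFiltration_eq_pow (IsNoetherian.noetherian (vanishing (polyFun U) Y))] at h3
    exact mem_pow_of_bijective (inclPullback hR Y).toRingHom hbij hideal h3
  · have hm' : m.1 ∈ formalFiltration (polyFun W) ({0} : Set W) (max q₀ n) :=
      truncate_eq_zero.mp hm
    have h3 := locFiltration_antitone (le_max_left q₀ n) hm'
    rw [locFiltration_eq_pow (IsNoetherian.noetherian (vanishing (polyFun W) ({0} : Set W)))] at h3
    exact hq₀ m h3

/-- The translation of functions on `U × W` by an automorphism of `W`. -/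
def rightTranslate (h : H) : polyFun (U × W) →ₐ[ℂ] polyFun (U × W) :=
  polyPullback (LinearMap.id.prodMap h.1.toLinearMap)

theorem mapsTo_prodMap (h : W →ₗ[ℂ] W) :
    Set.MapsTo ((LinearMap.id : U →ₗ[ℂ] U).prodMap h) (Y ×ˢ ({0} : Set W))
      (Y ×ˢ ({0} : Set W)) := by
  rintro ⟨u, w⟩ ⟨hu, hw⟩
  obtain rfl : w = 0 := hw
  exact ⟨hu, map_zero h⟩

/-- The pull-back along an endomorphism of `W` near `Y × {0}`. -/
def rightPullback (Y : Set U) (h : W →ₗ[ℂ] W) :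
    FormalFunctions (polyFun (U × W)) (Y ×ˢ ({0} : Set W)) →ₐ[ℂ]
      FormalFunctions (polyFun (U × W)) (Y ×ˢ ({0} : Set W)) :=
  formalPullback ((LinearMap.id : U →ₗ[ℂ] U).prodMap h)
    (fun _ hf => polyFun_comp ((LinearMap.id : U →ₗ[ℂ] U).prodMap h) hf) (mapsTo_prodMap h)

theorem rightTranslate_fst (h : H) (f : polyFun U) :
    rightTranslate h (polyPullback (LinearMap.fst ℂ U W) f) =
      polyPullback (LinearMap.fst ℂ U W) f := rfl

theorem average_rightTranslate_tmul [Fintype H] (a : polyFun U) (b : polyFun W) :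
    average (G := H) rightTranslate (polyProd U W (a ⊗ₜ b)) =
      polyPullback (LinearMap.fst ℂ U W) a *
        polyPullback (LinearMap.snd ℂ U W) (average (G := H) polyTranslate b) := by
  have h : polyProd U W (a ⊗ₜ b) =
      polyPullback (LinearMap.snd ℂ U W) b * polyPullback (LinearMap.fst ℂ U W) a :=
    (Algebra.TensorProduct.productMap_apply_tmul _ _ a b).trans (mul_comm _ _)
  have h1 : average (G := H) rightTranslate (polyPullback (LinearMap.snd ℂ U W) b) =
      polyPullback (LinearMap.snd ℂ U W) (average (G := H) polyTranslate b) := by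
    rw [average_apply, average_apply, map_smul, map_sum]
    rfl
  rw [h, average_mul_of_fixed (G := H) rightTranslate
    (a := polyPullback (LinearMap.fst ℂ U W) a) (fun h => rightTranslate_fst h a), h1, mul_comm]

/-- The group acts only on `W`, so averaging a(u) b(w) produces a(u) times an invariant of `W`,
which visibly comes from the tensor product. -/
theorem exists_prodPullback_eq_germ_average [Fintype H]
    (hsurj : Function.Surjective (inclPullback hR Y)) (f : polyFun (U × W)) :
    ∃ t, prodPullback hR Y H t =
      germ (polyFun (U × W)) (Y ×ˢ {0}) (average (G := H) rightTranslate f) := by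
  obtain ⟨s, rfl⟩ := polyProd_surjective f
  induction s with
  | zero => exact ⟨0, by simp only [map_zero]⟩
  | add s s' hs hs' =>
    obtain ⟨t, ht⟩ := hs
    obtain ⟨t', ht'⟩ := hs'
    exact ⟨t + t', by simp only [map_add, ht, ht']⟩
  | tmul a b =>
    obtain ⟨l, hl⟩ := hsurj (germ (polyFun U) Y a)
    have hinv : germ (polyFun W) {0} (average (G := H) polyTranslate b) ∈ originInvariants H :=
      fun h hh => by
        refine (formalPullback_germ h.toLinearMap _ _ _).trans (congrArg _ ?_)
        exact action_average (G := H) polyTranslate polyTranslate_mul ⟨h, hh⟩ b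
    refine ⟨l ⊗ₜ ⟨_, hinv⟩, ?_⟩
    rw [prodPullback_tmul, hl, fstPullback_germ, sndPullback_germ, ← map_mul]
    exact congrArg _ (average_rightTranslate_tmul a b).symm

/-- Modulo each step of the filtration, functions on the formal neighbourhood of `Y × {0}` are
fractions with denominators in `𝒪(U)`. -/
theorem exists_fst_fraction (x : FormalFunctions (polyFun (U × W)) (Y ×ˢ ({0} : Set W))) (n : ℕ) :
    ∃ s ∈ nonvanishing (polyFun U) Y, ∃ p,
      germ (polyFun (U × W)) (Y ×ˢ {0}) (polyPullback (LinearMap.fst ℂ U W) s) * x -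
        germ (polyFun (U × W)) (Y ×ˢ {0}) p ∈
        formalFiltration (polyFun (U × W)) (Y ×ˢ ({0} : Set W)) n := by
  obtain ⟨τ, hτ, p, h⟩ := exists_locOf_mul_sub_mem x n
  -- The denominator τ(u, w) is to be traded for σ = τ(u, 0). As σ - τ vanishes on Y × {0}, the
  -- geometric sum `e` satisfies τ e = σ ^ n modulo the n-th power of the ideal, so e p / σ ^ n
  -- approximates `x`.
  set σ := polyPullback (LinearMap.fst ℂ U W) (restrictLeft τ) with hσ
  set e := ∑ i ∈ Finset.range n, σ ^ i * (σ - τ) ^ (n - 1 - i) with he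
  have hgeom : τ * e = σ ^ n - (σ - τ) ^ n := by
    rw [he, ← (Commute.all σ (σ - τ)).mul_geom_sum₂, sub_sub_cancel]
  have hmem : σ - τ ∈ vanishing (polyFun (U × W)) (Y ×ˢ ({0} : Set W)) := by
    rintro ⟨u, w⟩ ⟨_, hw⟩
    obtain rfl : w = 0 := hw
    exact sub_self _
  refine ⟨restrictLeft τ ^ n, fun y hy => ?_, e * p, ?_⟩
  · exact pow_ne_zero n (hτ (y, 0) ⟨hy, rfl⟩)
  · rw [map_pow, ← hσ]
    have h1 := Ideal.mul_mem_left _ (germ (polyFun (U × W)) (Y ×ˢ {0}) e) h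
    have h2 : germ (polyFun (U × W)) (Y ×ˢ ({0} : Set W)) ((σ - τ) ^ n) ∈
        formalFiltration (polyFun (U × W)) (Y ×ˢ ({0} : Set W)) n :=
      locOf_mem_of_mem (Ideal.pow_mem_pow hmem n)
    have h3 := add_mem h1 (Ideal.mul_mem_right x _ h2)
    have h4 : σ ^ n = τ * e + (σ - τ) ^ n := by rw [hgeom]; ring
    rw [h4, map_add, map_mul, map_mul]
    convert h3 using 1
    ring

theorem rightPullback_fraction (h : H) {x : FormalFunctions (polyFun (U × W)) (Y ×ˢ ({0} : Set W))}
    (hx : rightPullback Y h.1.toLinearMap x = x) {q p : polyFun (U × W)} {n : ℕ}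
    (hqp : germ (polyFun (U × W)) (Y ×ˢ {0}) q * x - germ (polyFun (U × W)) (Y ×ˢ {0}) p ∈
      formalFiltration (polyFun (U × W)) (Y ×ˢ ({0} : Set W)) n) :
    germ (polyFun (U × W)) (Y ×ˢ {0}) (rightTranslate h q) * x -
      germ (polyFun (U × W)) (Y ×ˢ {0}) (rightTranslate h p) ∈
      formalFiltration (polyFun (U × W)) (Y ×ˢ ({0} : Set W)) n :=
  formalPullback_fraction (L := (LinearMap.id : U →ₗ[ℂ] U).prodMap h.1.toLinearMap)
    (hR := fun _ hf => polyFun_comp ((LinearMap.id : U →ₗ[ℂ] U).prodMap h.1.toLinearMap) hf)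
    (hY := mapsTo_prodMap h.1.toLinearMap) hx hqp

/-- The denominator comes from `U` and is fixed by the group, so it is enough to average the
numerator. -/
theorem average_rightTranslate_fraction [Fintype H]
    {x : FormalFunctions (polyFun (U × W)) (Y ×ˢ ({0} : Set W))}
    (hx : ∀ h ∈ H, rightPullback Y h.toLinearMap x = x) {n : ℕ} {s : polyFun U}
    {p : polyFun (U × W)}
    (h : germ (polyFun (U × W)) (Y ×ˢ {0}) (polyPullback (LinearMap.fst ℂ U W) s) * x -
        germ (polyFun (U × W)) (Y ×ˢ {0}) p ∈
      formalFiltration (polyFun (U × W)) (Y ×ˢ ({0} : Set W)) n) :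
    germ (polyFun (U × W)) (Y ×ˢ {0}) (polyPullback (LinearMap.fst ℂ U W) s) * x -
      germ (polyFun (U × W)) (Y ×ˢ {0}) (average (G := H) rightTranslate p) ∈
      formalFiltration (polyFun (U × W)) (Y ×ˢ ({0} : Set W)) n :=
  sub_average_mem (G := H) rightTranslate (germ (polyFun (U × W)) (Y ×ˢ {0})) fun g => by
    have h1 := rightPullback_fraction g (hx g g.2) h
    rwa [rightTranslate_fst] at h1

/-- A denominator on `U` is already invertible in the left factor, since that factor contains all
functions on the formal neighbourhood of `Y` in `U`. -/
theorem exists_prodPullback_mul_eq (hbij : Function.Bijective (inclPullback hR Y)) {s : polyFun U}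
    (hs : s ∈ nonvanishing (polyFun U) Y) :
    ∃ a, prodPullback hR Y H a *
      germ (polyFun (U × W)) (Y ×ˢ ({0} : Set W)) (polyPullback (LinearMap.fst ℂ U W) s) = 1 := by
  obtain ⟨r, hr⟩ := (isUnit_locOf (I := vanishing (polyFun U) Y) hs).exists_left_inv
  obtain ⟨l, rfl⟩ := hbij.2 r
  refine ⟨l ⊗ₜ 1, ?_⟩
  rw [prodPullback_tmul, ← fstPullback_germ]
  have h1 : sndPullback W Y (1 : originInvariants H).1 = 1 := map_one _
  rw [h1, mul_one, ← map_mul, hr, map_one]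

/-- Density of the tensor product in the invariants: the denominator is moved to `U`, the numerator
is averaged over `H`, and the denominator is inverted in the left factor. -/
theorem exists_prodPullback_sub_mem [Finite H] (hbij : Function.Bijective (inclPullback hR Y))
    {x : FormalFunctions (polyFun (U × W)) (Y ×ˢ ({0} : Set W))}
    (hx : ∀ h ∈ H, rightPullback Y h.toLinearMap x = x) (n : ℕ) :
    ∃ t, prodPullback hR Y H t - x ∈
      formalFiltration (polyFun (U × W)) (Y ×ˢ ({0} : Set W)) n := by
  have := Fintype.ofFinite H
  obtain ⟨s, hs, p, h⟩ := exists_fst_fraction x n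
  obtain ⟨t, ht⟩ := exists_prodPullback_eq_germ_average (H := H) hbij.2 p
  obtain ⟨a, ha⟩ := exists_prodPullback_mul_eq (H := H) hbij hs
  have h1 := Ideal.mul_mem_left _ (prodPullback hR Y H a) (average_rightTranslate_fraction hx h)
  rw [mul_sub, ← mul_assoc, ha, one_mul, ← ht, ← map_mul] at h1
  refine ⟨a * t, ?_⟩
  rw [← neg_mem_iff, neg_sub]
  exact h1

end Product

/-! ### Compatibility of maps of completions with brackets and endomorphisms -/

section Completion

variable {R T : Type*} [CommRing R] [CommRing T] [Algebra ℂ R] [Algebra ℂ T] {K : Ideal T}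
  {I : Ideal R} {f : T →ₐ[ℂ] AdicCompletion I R}

theorem complLift_sub_mem (h : K ≤ (idealOfDefinition I).comap f) {x : AdicCompletion K T} {n : ℕ}
    {t : T} (ht : Ideal.Quotient.mk (K ^ n) t = AdicCompletion.evalₐ K n x) :
    complLift K I f h x - f t ∈ filtration I n := by
  rw [mem_filtration, map_sub, complLift_eval K I f h x n ht, sub_self]

theorem complLift_mem (h : K ≤ (idealOfDefinition I).comap f) {x : AdicCompletion K T} {n : ℕ}
    (hx : x ∈ filtration K n) : complLift K I f h x ∈ filtration I n := by
  have := complLift_sub_mem h (t := 0) (by rw [map_zero]; exact hx.symm)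
  rwa [map_zero, sub_zero] at this

theorem complLift_complMap {T' : Type*} [CommRing T'] [Algebra ℂ T'] {K' : Ideal T'}
    {f' : T' →ₐ[ℂ] AdicCompletion I R} (h' : K' ≤ (idealOfDefinition I).comap f')
    (h : K ≤ (idealOfDefinition I).comap f) (g : T' →ₐ[ℂ] T) (hg : K' ≤ K.comap g)
    (ψ : AdicCompletion I R →ₐ[ℂ] AdicCompletion I R)
    (hψ : ∀ n, ∀ x ∈ filtration I n, ψ x ∈ filtration I n) (hfg : ∀ t, f (g t) = ψ (f' t))
    (x : AdicCompletion K' T') :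
    complLift K I f h (complMap K' K g hg x) = ψ (complLift K' I f' h' x) :=
  AdicCompletion.ext_evalₐ fun n => by
    rw [complLift_eval K I f h _ n (complMap_eval K' K g hg x n (mk_rep K' x n)).symm, hfg,
      eq_comm, ← sub_eq_zero, ← map_sub, ← map_sub]
    exact hψ n _ (complLift_sub_mem h' (mk_rep K' x n))

theorem complLift_fixed (h : K ≤ (idealOfDefinition I).comap f)
    (ψ : AdicCompletion I R →ₐ[ℂ] AdicCompletion I R)
    (hψ : ∀ n, ∀ x ∈ filtration I n, ψ x ∈ filtration I n) (hf : ∀ t, ψ (f t) = f t)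
    (x : AdicCompletion K T) : ψ (complLift K I f h x) = complLift K I f h x :=
  AdicCompletion.ext_evalₐ fun n => by
    rw [complLift_eval K I f h x n (mk_rep K x n), ← hf, ← sub_eq_zero, ← map_sub, ← map_sub]
    exact hψ n _ (complLift_sub_mem h (mk_rep K x n))

/-- Each side at level n depends only on the arguments at level n + 1, where `x` and `y` may be
replaced by representatives in `T`. -/
theorem complLift_bracket (P : PoissonBracket T) (Q : PoissonBracket R)
    (h : K ≤ (idealOfDefinition I).comap f)
    (hf : ∀ a b, f (P.bracket a b) = (Q.completion I).bracket (f a) (f b))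
    (x y : AdicCompletion K T) :
    complLift K I f h ((P.completion K).bracket x y) =
      (Q.completion I).bracket (complLift K I f h x) (complLift K I f h y) :=
  AdicCompletion.ext_evalₐ fun n => by
    rw [complLift_eval K I f h _ n (P.eval_completion K x y n (mk_rep K x _) (mk_rep K y _)).symm,
      hf, Q.eval_completion I _ _ n (mk_rep I _ _) (mk_rep I _ _)]
    refine (Q.eval_completion I _ _ n ?_ ?_).symm
    · rw [complLift_eval K I f h x _ (mk_rep K x _), mk_rep]
    · rw [complLift_eval K I f h y _ (mk_rep K y _), mk_rep]

theorem completion_bracket_mem (Q : PoissonBracket R) (x : AdicCompletion I R) {n : ℕ}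
    {y : AdicCompletion I R} (hy : y ∈ filtration I (n + 1)) :
    (Q.completion I).bracket x y ∈ filtration I n := by
  rw [mem_filtration, Q.eval_completion I x y n (mk_rep I x _) (b := 0)
    (by rw [map_zero]; exact hy.symm), map_zero, map_zero]

theorem completion_bracket_algebraMap (Q : PoissonBracket R) (a b : R) :
    (Q.completion I).bracket (algebraMap R _ a) (algebraMap R _ b) =
      algebraMap R _ (Q.bracket a b) :=
  AdicCompletion.ext_evalₐ fun n => by
    rw [Q.eval_completion I _ _ n (a := a) (b := b) (AlgHom.commutes _ a).symm
      (AlgHom.commutes _ b).symm]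
    exact (AlgHom.commutes _ _).symm

end Completion

section LocCompletion

variable {A A' B : Type*} [CommRing A] [CommRing A'] [CommRing B] [Algebra ℂ A] [Algebra ℂ A']
  [Algebra ℂ B] {S : Submonoid A} {S' : Submonoid A'} {T : Submonoid B} {I : Ideal A}
  {I' : Ideal A'} {J : Ideal B}

theorem locBracket_locOf (P : PoissonBracket A) (a b : A) :
    (locBracket P S I).bracket (locOf S I a) (locOf S I b) = locOf S I (P.bracket a b) :=
  (completion_bracket_algebraMap (P.localization S) _ _).trans
    (congrArg (locCoe S I) (P.localization_algebraMap S a b))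

theorem locBracket_mem (P : PoissonBracket A) (x : LocCompletion S I) {n : ℕ}
    {y : LocCompletion S I} (hy : y ∈ locFiltration S I (n + 1)) :
    (locBracket P S I).bracket x y ∈ locFiltration S I n :=
  completion_bracket_mem (P.localization S) x hy

/-- A derivation along `f` of the completed localization that kills `A` is zero. -/
theorem locBracket_eq_zero {f : A →ₐ[ℂ] B} {hS : S ≤ T.comap f} {hI : I ≤ J.comap f}
    (Q : PoissonBracket B) (z : LocCompletion T J)
    (h : ∀ a, (locBracket Q T J).bracket z (locOf T J (f a)) = 0) (x : LocCompletion S I) :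
    (locBracket Q T J).bracket z (locComplMap S T I J f hS hI x) = 0 := by
  refine eq_of_forall_sub_mem_locFiltration fun n => ?_
  rw [sub_zero]
  -- The bracket with `z` lowers the filtration by one, hence `n + 1`. The Leibniz rule applied to
  -- the fraction leaves only the term with the unit `f s` as a factor.
  obtain ⟨s, hs, a, hx⟩ := exists_locOf_mul_sub_mem x (n + 1)
  have h1 := locComplMap_mem (T := T) (J := J) (f := f) (hS := hS) (hI := hI) hx
  rw [map_sub, map_mul, locComplMap_locOf, locComplMap_locOf] at h1
  have h2 := locBracket_mem Q z h1
  rw [map_sub, (locBracket Q T J).leibniz, h, h, zero_mul, zero_add, sub_zero] at h2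
  exact mem_of_isUnit_mul_mem (isUnit_locOf (hS hs)) h2

/-- A bracket with one argument fixed is a continuous derivation, so vanishing on the uncompleted
rings extends to one argument and, by skew-symmetry, to the other. -/
theorem locBracket_locComplMap_eq_zero {f : A →ₐ[ℂ] B} {hS : S ≤ T.comap f} {hI : I ≤ J.comap f}
    {f' : A' →ₐ[ℂ] B} {hS' : S' ≤ T.comap f'} {hI' : I' ≤ J.comap f'} (Q : PoissonBracket B)
    (h : ∀ a a', Q.bracket (f a) (f' a') = 0) (x : LocCompletion S I) (x' : LocCompletion S' I') :
    (locBracket Q T J).bracket (locComplMap S T I J f hS hI x)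
      (locComplMap S' T I' J f' hS' hI' x') = 0 := by
  refine locBracket_eq_zero Q _ (fun a' => ?_) x'
  rw [(locBracket Q T J).skew, neg_eq_zero]
  refine locBracket_eq_zero Q _ (fun a => ?_) x
  rw [locBracket_locOf, Q.skew, h, neg_zero, map_zero]

end LocCompletion

/-- The maps themselves may differ, as long as no function of `R'` distinguishes them. It is applied
to maps into V that differ by elements of Γ, with `R'` the invariants. -/
theorem formalPullback_congr {α β : Type*} {R : Subalgebra ℂ (α → ℂ)} {R' : Subalgebra ℂ (β → ℂ)}
    {Y : Set α} {Y' : Set β} {L L' : α → β} {hR : ∀ f ∈ R', f ∘ L ∈ R} {hY : Set.MapsTo L Y Y'}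
    {hR' : ∀ f ∈ R', f ∘ L' ∈ R} {hY' : Set.MapsTo L' Y Y'}
    (h : ∀ f : R', (f : β → ℂ) ∘ L = (f : β → ℂ) ∘ L') (x : FormalFunctions R' Y') :
    formalPullback L hR hY x = formalPullback L' hR' hY' x := by
  have : (pullback L hR : R' →ₐ[ℂ] R) = pullback L' hR' :=
    AlgHom.ext fun f => Subtype.ext (h f)
  simp only [formalPullback, this]

/-! ### Linear Poisson maps -/

section Symplectic

variable {V V' V'' : Type*} [AddCommGroup V] [Module ℂ V] [AddCommGroup V'] [Module ℂ V']
  [AddCommGroup V''] [Module ℂ V''] [FiniteDimensional ℂ V] [FiniteDimensional ℂ V']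
  [FiniteDimensional ℂ V''] {ω : LinearMap.BilinForm ℂ V} {ω' : LinearMap.BilinForm ℂ V'}
  {ω'' : LinearMap.BilinForm ℂ V''}

/-- By the chain rule the differential of f ∘ L at x is the differential of f at L x composed with
`L`. The adjoint `s` of `L` translates this to Hamiltonian vectors, by nondegeneracy. -/
theorem hamiltonianField_polyPullback (hω : IsSymplecticForm ω) (hω' : IsSymplecticForm ω')
    (L : V →ₗ[ℂ] V') (s : V' → V) (hs : ∀ ξ x, ω (s ξ) x = ω' ξ (L x)) (f : polyFun V') (x : V) :
    hamiltonianField hω (polyPullback L f) x = s (hamiltonianField hω' f (L x)) := by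
  rw [← sub_eq_zero]
  refine hω.nondegenerate.1 _ fun y => ?_
  rw [map_sub, LinearMap.sub_apply, hs, hamiltonianField_spec, hamiltonianField_spec, sub_eq_zero]
  exact differential_comp L f x y

/-- A linear map with a section adjoint to it is a Poisson map. -/
theorem polyPullback_bracket (hω : IsSymplecticForm ω) (hω' : IsSymplecticForm ω')
    (L : V →ₗ[ℂ] V') (s : V' → V) (hs : ∀ ξ x, ω (s ξ) x = ω' ξ (L x)) (hLs : ∀ ξ, L (s ξ) = ξ)
    (a b : polyFun V') :
    polyPullback L ((symplecticBracket hω').bracket a b) =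
      (symplecticBracket hω).bracket (polyPullback L a) (polyPullback L b) := by
  ext x
  rw [polyPullback_apply, symplecticBracket_apply, symplecticBracket_apply,
    hamiltonianField_polyPullback hω hω' L s hs, hamiltonianField_polyPullback hω hω' L s hs, hs,
    hLs]

/-- Moving `s` to the other side by adjunction produces L (s' ξ), which is zero: functions pulled
back from orthogonal factors Poisson-commute. -/
theorem polyPullback_bracket_eq_zero (hω : IsSymplecticForm ω) (hω' : IsSymplecticForm ω')
    (hω'' : IsSymplecticForm ω'') (L : V →ₗ[ℂ] V') (s : V' → V)
    (hs : ∀ ξ x, ω (s ξ) x = ω' ξ (L x)) (L' : V →ₗ[ℂ] V'') (s' : V'' → V)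
    (hs' : ∀ ξ x, ω (s' ξ) x = ω'' ξ (L' x)) (h : ∀ ξ, L (s' ξ) = 0) (a : polyFun V')
    (b : polyFun V'') :
    (symplecticBracket hω).bracket (polyPullback L a) (polyPullback L' b) = 0 := by
  ext x
  rw [symplecticBracket_apply, hamiltonianField_polyPullback hω hω' L s hs,
    hamiltonianField_polyPullback hω hω'' L' s' hs', hs, h, map_zero]
  rfl

/-- The pull-back of invariants along a linear Poisson map is compatible with brackets. -/
theorem pullback_quotientBracket (hω : IsSymplecticForm ω) (hω' : IsSymplecticForm ω')
    {G : Subgroup (V' ≃ₗ[ℂ] V')} (hG : Preserves ω' G) (L : V →ₗ[ℂ] V') (s : V' → V)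
    (hs : ∀ ξ x, ω (s ξ) x = ω' ξ (L x)) (hLs : ∀ ξ, L (s ξ) = ξ)
    (hR : ∀ f ∈ invariants G, f ∘ L ∈ polyFun V) (a b : invariants G) :
    pullback L hR ((quotientBracket hω' hG).bracket a b) =
      (symplecticBracket hω).bracket (pullback L hR a) (pullback L hR b) := by
  have h := PoissonBracket.induced_spec (symplecticBracket hω')
    (Subalgebra.inclusion fun _ hf => hf.1 : invariants G →ₐ[ℂ] polyFun V')
    (Subalgebra.inclusion_injective _) (fun a b => ⟨(quotientBracket hω' hG).bracket a b,
      PoissonBracket.induced_spec _ _ _ _ a b⟩) a b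
  exact (congrArg (polyPullback L) h).trans (polyPullback_bracket hω hω' L s hs hLs _ _)

end Symplectic

/-- Both algebras are identified with their common image. This produces the isomorphism of the
decomposition. -/
theorem exists_algEquiv_of_range_eq {A B C : Type*} [CommRing A] [Algebra ℂ A] [CommRing B]
    [Algebra ℂ B] [CommRing C] [Algebra ℂ C] (α : A →ₐ[ℂ] C) (β : B →ₐ[ℂ] C)
    (hα : Function.Injective α) (hβ : Function.Injective β)
    (h : ∀ z, (∃ x, α x = z) ↔ ∃ y, β y = z) :
    ∃ φ : A ≃ₐ[ℂ] B, ∀ x, β (φ x) = α x := by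
  have hr : α.range = β.range := SetLike.ext h
  refine ⟨((AlgEquiv.ofInjective α hα).trans (Subalgebra.equivOfEq _ _ hr)).trans
    (AlgEquiv.ofInjective β hβ).symm, fun x => ?_⟩
  exact congrArg Subtype.val ((AlgEquiv.ofInjective β hβ).apply_symm_apply
    (Subalgebra.equivOfEq _ _ hr (AlgEquiv.ofInjective α hα x)))

/-! ### The leaf -/

section Groups

variable {V : Type*} [AddCommGroup V] [Module ℂ V]

/-- An induced automorphism is determined by any element of `G` that induces it. -/
theorem finite_inducedGroup (G : Subgroup (V ≃ₗ[ℂ] V)) [Finite G] (U : Submodule ℂ V) :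
    Finite (inducedGroup G U) := by
  have h (k : inducedGroup G U) : ∃ g : G, ∀ u : U, (k.1 u : V) = g.1 u := by
    obtain ⟨g, hg, e⟩ := k.2
    exact ⟨⟨g, hg⟩, e⟩
  choose F hF using h
  refine Finite.of_injective F fun k k' e => Subtype.ext (LinearEquiv.ext fun u => ?_)
  exact Subtype.ext ((hF k u).trans ((congrArg (fun g : G => g.1 (u : V)) e).trans (hF k' u).symm))

theorem puncturedLineIn_eq (U : Submodule ℂ V) (u : U) :
    puncturedLineIn U (u : V) = puncturedLine u :=
  Set.ext fun _ => exists_congr fun _ => ⟨fun h => Subtype.ext h, fun h => congrArg Subtype.val h⟩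

theorem quotientPullback_injective [FiniteDimensional ℂ V] {G : Subgroup (V ≃ₗ[ℂ] V)} [Finite G]
    {v : V} (hfree : FreeOrbit G v) : Function.Injective (quotientPullback G v) := by
  rw [injective_iff_map_eq_zero]
  intro x hx
  refine eq_of_forall_sub_mem_locFiltration fun n => ?_
  obtain ⟨m, hm⟩ := quotientPullback_strict hfree n
  rw [sub_zero]
  refine hm x ?_
  rw [hx]
  exact zero_mem _

/-- With trivial stabilizer the invariance condition for descending to the quotient is empty, so the
quotient map is an isomorphism of formal neighbourhoods along the line. -/
theorem quotientPullback_bijective [FiniteDimensional ℂ V] {G : Subgroup (V ≃ₗ[ℂ] V)} [Finite G]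
    {v : V} (hfree : FreeOrbit G v) (hstab : ∀ g ∈ G, g v = v → g = 1) :
    Function.Bijective (quotientPullback G v) := by
  refine ⟨quotientPullback_injective hfree, fun x => exists_quotientPullback_eq hfree ?_⟩
  intro g hg hgv
  obtain rfl := hstab g hg hgv
  exact formalPullback_eq_self _ _ x

variable {Γ Γ₀ : Subgroup (V ≃ₗ[ℂ] V)} {v : V}

theorem leafGroup_freeOrbit (hfree : FreeOrbit Γ v) (hv : v ∈ fixedSpace Γ₀) :
    FreeOrbit (leafGroup Γ Γ₀) (⟨v, hv⟩ : fixedSpace Γ₀) := by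
  rintro c ⟨h, ⟨g, hg, e⟩, hc⟩
  exact hfree c ⟨g, hg.1, (e ⟨v, hv⟩).symm.trans (congrArg Subtype.val hc)⟩

/-- An element of Γ fixing v lies in Γ₀, and hence acts trivially on V^Γ₀. -/
theorem leafGroup_stabilizer (hΓ₀ : Γ₀ = Γ ⊓ MulAction.stabilizer (V ≃ₗ[ℂ] V) v)
    (hv : v ∈ fixedSpace Γ₀) (h : fixedSpace Γ₀ ≃ₗ[ℂ] fixedSpace Γ₀) (hh : h ∈ leafGroup Γ Γ₀)
    (hhv : h ⟨v, hv⟩ = ⟨v, hv⟩) : h = 1 := by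
  obtain ⟨g, hg, e⟩ := hh
  have h0 : g ∈ Γ₀ := by
    rw [hΓ₀]
    exact ⟨hg.1, (e ⟨v, hv⟩).symm.trans (congrArg Subtype.val hhv)⟩
  exact LinearEquiv.ext fun u => Subtype.ext ((e u).trans (u.2 g h0))

/-- The leaf group inherits freeness of the dilations at v and has trivial stabilizer there, so near
ℂˣ·v the leaf looks like V^Γ₀. -/
theorem inclPullback_leaf_bijective [FiniteDimensional ℂ V] [Finite Γ]
    (hΓ₀ : Γ₀ = Γ ⊓ MulAction.stabilizer (V ≃ₗ[ℂ] V) v) (hfree : FreeOrbit Γ v) :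
    Function.Bijective (inclPullback (R := invariants (leafGroup Γ Γ₀)) (fun _ hf => hf.1)
      (puncturedLineIn (fixedSpace Γ₀) v)) := by
  have hv : v ∈ fixedSpace Γ₀ := fun g hg => (hΓ₀.le hg).2
  have : Finite (Γ ⊓ Subgroup.normalizer (Γ₀ : Set (V ≃ₗ[ℂ] V)) : Subgroup _) :=
    finite_of_le inf_le_left
  have : Finite (leafGroup Γ Γ₀) := finite_inducedGroup _ _
  rw [puncturedLineIn_eq (fixedSpace Γ₀) ⟨v, hv⟩]
  exact quotientPullback_bijective (leafGroup_freeOrbit hfree hv) (leafGroup_stabilizer hΓ₀ hv)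

theorem mem_leafIdeal_of_inclPullback_mem (hv : v ∈ fixedSpace Γ₀) (x : LeafNbhd Γ Γ₀ v)
    (hx : inclPullback (R := invariants (leafGroup Γ Γ₀)) (fun _ hf => hf.1)
      (puncturedLineIn (fixedSpace Γ₀) v) x ∈
        formalIdeal (polyFun (fixedSpace Γ₀)) (puncturedLineIn (fixedSpace Γ₀) v)) :
    x ∈ leafIdeal Γ Γ₀ v := by
  -- The type of `x` depends on the set along which one completes, so the set is generalized before
  -- the equality is substituted.
  have key : ∀ Y, Y = puncturedLine (⟨v, hv⟩ : fixedSpace Γ₀) →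
      ∀ x, inclPullback (R := invariants (leafGroup Γ Γ₀)) (fun _ hf => hf.1) Y x ∈
        formalIdeal (polyFun (fixedSpace Γ₀)) Y →
          x ∈ formalIdeal (invariants (leafGroup Γ Γ₀)) Y := by
    rintro _ rfl x hx
    exact mem_formalIdeal_of_quotientPullback_mem hx
  exact key _ (puncturedLineIn_eq (fixedSpace Γ₀) ⟨v, hv⟩) x hx

end Groups

/-! ### Maps out of a completed tensor product -/

section Lift

variable {A B C : Type*} [CommRing A] [Algebra ℂ A] [CommRing B] [Algebra ℂ B] [CommRing C]
  [Algebra ℂ C] {I : Ideal A} {J : Ideal B} {S : Submonoid C} {K : Ideal C}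
  {f : A →ₐ[ℂ] LocCompletion S K} {g : B →ₐ[ℂ] LocCompletion S K}

/-- The continuous map from a completed tensor product to a completed localization. -/
abbrev liftLoc (f : A →ₐ[ℂ] LocCompletion S K) (g : B →ₐ[ℂ] LocCompletion S K)
    (hf : I ≤ (locFiltration S K 1).comap f) (hg : J ≤ (locFiltration S K 1).comap g) :
    CompletedTensor I J →ₐ[ℂ] LocCompletion S K :=
  CompletedTensor.lift I J (locIdeal S K) f g hf hg

variable (hf : I ≤ (locFiltration S K 1).comap f) (hg : J ≤ (locFiltration S K 1).comap g)

theorem liftLoc_strict (h : ∀ n, ∃ m, ∀ t, Algebra.TensorProduct.productMap f g t ∈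
      locFiltration S K m → t ∈ tensorIdeal I J ^ n) (n : ℕ) :
    ∃ m, ∀ x, liftLoc f g hf hg x ∈ locFiltration S K m → x ∈ CompletedTensor.filtration I J n :=
  complLift_strict _ h n

theorem liftLoc_injective (h : ∀ n, ∃ m, ∀ t, Algebra.TensorProduct.productMap f g t ∈
      locFiltration S K m → t ∈ tensorIdeal I J ^ n) : Function.Injective (liftLoc f g hf hg) :=
  complLift_injective _ h

theorem liftLoc_mem {x : CompletedTensor I J} {n : ℕ} (hx : x ∈ CompletedTensor.filtration I J n) :
    liftLoc f g hf hg x ∈ locFiltration S K n :=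
  complLift_mem _ hx

theorem exists_liftLoc_eq (h : ∀ n, ∃ m, ∀ t, Algebra.TensorProduct.productMap f g t ∈
      locFiltration S K m → t ∈ tensorIdeal I J ^ n) {x : LocCompletion S K}
    (hx : ∀ n, ∃ t, Algebra.TensorProduct.productMap f g t - x ∈ locFiltration S K n) :
    ∃ y, liftLoc f g hf hg y = x :=
  exists_complLift_eq _ h hx

theorem liftLoc_fixed (ψ : LocCompletion S K →ₐ[ℂ] LocCompletion S K)
    (hψ : ∀ n, ∀ x ∈ locFiltration S K n, ψ x ∈ locFiltration S K n)
    (h : ∀ a, ψ (f a) = f a) (h' : ∀ b, ψ (g b) = g b) (x : CompletedTensor I J) :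
    ψ (liftLoc f g hf hg x) = liftLoc f g hf hg x := by
  have e : ψ.comp (Algebra.TensorProduct.productMap f g) = Algebra.TensorProduct.productMap f g :=
    Algebra.TensorProduct.ext' fun a b => by
      rw [AlgHom.comp_apply, Algebra.TensorProduct.productMap_apply_tmul, map_mul, h, h']
  exact complLift_fixed _ ψ hψ (DFunLike.congr_fun e) x

theorem liftLoc_map (ψ : LocCompletion S K →ₐ[ℂ] LocCompletion S K)
    (hψ : ∀ n, ∀ x ∈ locFiltration S K n, ψ x ∈ locFiltration S K n) (a : A →ₐ[ℂ] A)
    (b : B →ₐ[ℂ] B) (ha : I ≤ I.comap a) (hb : J ≤ J.comap b) (h : ∀ x, f (a x) = ψ (f x))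
    (h' : ∀ x, g (b x) = ψ (g x)) (x : CompletedTensor I J) :
    liftLoc f g hf hg (CompletedTensor.map I J I J a b ha hb x) = ψ (liftLoc f g hf hg x) := by
  have e : (Algebra.TensorProduct.productMap f g).comp (Algebra.TensorProduct.map a b) =
      ψ.comp (Algebra.TensorProduct.productMap f g) :=
    Algebra.TensorProduct.ext' fun x y => by
      rw [AlgHom.comp_apply, AlgHom.comp_apply, Algebra.TensorProduct.map_tmul,
        Algebra.TensorProduct.productMap_apply_tmul, Algebra.TensorProduct.productMap_apply_tmul,
        map_mul, h, h']
  exact complLift_complMap _ _ _ _ ψ hψ (DFunLike.congr_fun e) x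

/-- When the images of the factors Poisson-commute, the Leibniz rule on pure tensors leaves exactly
the two terms of the product bracket. -/
theorem productMap_bracket {L : Type*} [CommRing L] [Algebra ℂ L] {f : A →ₐ[ℂ] L} {g : B →ₐ[ℂ] L}
    (P : PoissonBracket A) (P' : PoissonBracket B) (Q : PoissonBracket L)
    (h : ∀ a a', f (P.bracket a a') = Q.bracket (f a) (f a'))
    (h' : ∀ b b', g (P'.bracket b b') = Q.bracket (g b) (g b'))
    (h0 : ∀ a b, Q.bracket (f a) (g b) = 0) (x y : A ⊗[ℂ] B) :
    Algebra.TensorProduct.productMap f g ((P.tensor P').bracket x y) =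
      Q.bracket (Algebra.TensorProduct.productMap f g x)
        (Algebra.TensorProduct.productMap f g y) := by
  induction x with
  | zero => simp only [map_zero, LinearMap.zero_apply]
  | add x x' hx hx' => simp only [map_add, LinearMap.add_apply, hx, hx']
  | tmul a b =>
    induction y with
    | zero => simp only [map_zero]
    | add y y' hy hy' => simp only [map_add, hy, hy']
    | tmul a' b' =>
      have h1 : Q.bracket (g b) (f a') = 0 := by rw [Q.skew, h0, neg_zero]
      rw [PoissonBracket.tensor_tmul, map_add]
      simp only [Algebra.TensorProduct.productMap_apply_tmul, Q.leibniz, Q.leibniz_left, h, h', h0,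
        h1, map_mul]
      ring

theorem liftLoc_bracket (P : PoissonBracket A) (P' : PoissonBracket B) (Q : PoissonBracket C)
    (h : ∀ a a', f (P.bracket a a') = (locBracket Q S K).bracket (f a) (f a'))
    (h' : ∀ b b', g (P'.bracket b b') = (locBracket Q S K).bracket (g b) (g b'))
    (h0 : ∀ a b, (locBracket Q S K).bracket (f a) (g b) = 0) (x y : CompletedTensor I J) :
    liftLoc f g hf hg ((CompletedTensor.bracket P P' I J).bracket x y) =
      (locBracket Q S K).bracket (liftLoc f g hf hg x) (liftLoc f g hf hg y) :=
  complLift_bracket (P.tensor P') (Q.localization S) _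
    (productMap_bracket P P' (locBracket Q S K) h h' h0) x y

end Lift

/-! ### The map from the common cover to the product -/

section ProductSide

variable {V : Type*} [AddCommGroup V] [Module ℂ V] {ω : LinearMap.BilinForm ℂ V}
  {Γ Γ₀ : Subgroup (V ≃ₗ[ℂ] V)} {v : V}

/-- The restriction of `productToCover` to the uncompleted tensor product. -/
abbrev tensorToCover (ω : LinearMap.BilinForm ℂ V) (Γ Γ₀ : Subgroup (V ≃ₗ[ℂ] V)) (v : V) :
    LeafNbhd Γ Γ₀ v ⊗[ℂ] SliceFunctions ω Γ₀ →ₐ[ℂ] CoverNbhd ω Γ₀ v :=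
  Algebra.TensorProduct.productMap (leafToCover ω Γ Γ₀ v)
    ((originToCover ω Γ₀ v).comp (originInvariants (sliceGroup ω Γ₀)).val)

/-- The filtration of the functions on the common cover. -/
abbrev coverFiltration (ω : LinearMap.BilinForm ℂ V) (Γ₀ : Subgroup (V ≃ₗ[ℂ] V)) (v : V) :
    ℕ → Ideal (CoverNbhd ω Γ₀ v) :=
  formalFiltration (polyFun (fixedSpace Γ₀ × slice ω Γ₀))
    (puncturedLineIn (fixedSpace Γ₀) v ×ˢ ({0} : Set (slice ω Γ₀)))

theorem tensorToCover_eq : tensorToCover ω Γ Γ₀ v =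
    prodPullback (R := invariants (leafGroup Γ Γ₀)) (fun _ hf => hf.1)
      (puncturedLineIn (fixedSpace Γ₀) v) (sliceGroup ω Γ₀) := rfl

variable (ω Γ Γ₀ v) in
theorem leafIdeal_le : leafIdeal Γ Γ₀ v ≤ (coverFiltration ω Γ₀ v 1).comap (leafToCover ω Γ Γ₀ v) :=
  formalPullback_ideal _ _ _

variable (ω Γ₀ v) in
theorem originIdeal_le : originIdeal (sliceGroup ω Γ₀) ≤ (coverFiltration ω Γ₀ v 1).comap
    ((originToCover ω Γ₀ v).comp (originInvariants (sliceGroup ω Γ₀)).val) :=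
  fun x hx => formalPullback_ideal (R := polyFun (fixedSpace Γ₀ × slice ω Γ₀))
      (R' := polyFun (slice ω Γ₀)) (LinearMap.snd ℂ (fixedSpace Γ₀) (slice ω Γ₀))
      (fun _ hf => polyFun_comp _ hf) (fun _ hp => hp.2) (x := x.1) hx

theorem productToCover_eq : productToCover ω Γ Γ₀ v =
    liftLoc (leafToCover ω Γ Γ₀ v)
      ((originToCover ω Γ₀ v).comp (originInvariants (sliceGroup ω Γ₀)).val) (leafIdeal_le ω Γ Γ₀ v)
      (originIdeal_le ω Γ₀ v) := rfl

theorem tensorToCover_strict [FiniteDimensional ℂ V] [Finite Γ]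
    (hΓ₀ : Γ₀ = Γ ⊓ MulAction.stabilizer (V ≃ₗ[ℂ] V) v) (hfree : FreeOrbit Γ v) (n : ℕ) :
    ∃ m, ∀ t, tensorToCover ω Γ Γ₀ v t ∈ coverFiltration ω Γ₀ v m →
        t ∈ tensorIdeal (leafIdeal Γ Γ₀ v) (originIdeal (sliceGroup ω Γ₀)) ^ n := by
  have : Finite Γ₀ := finite_of_le (hΓ₀.trans_le inf_le_left)
  have : Finite (sliceGroup ω Γ₀) := finite_inducedGroup _ _
  rw [tensorToCover_eq]
  exact exists_prodPullback_strict (inclPullback_leaf_bijective hΓ₀ hfree)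
    (mem_leafIdeal_of_inclPullback_mem fun g hg => (hΓ₀.le hg).2) n

theorem exists_tensorToCover_sub_mem [FiniteDimensional ℂ V] [Finite Γ]
    (hΓ₀ : Γ₀ = Γ ⊓ MulAction.stabilizer (V ≃ₗ[ℂ] V) v) (hfree : FreeOrbit Γ v)
    {x : CoverNbhd ω Γ₀ v} (hx : ∀ h ∈ sliceGroup ω Γ₀,
      rightPullback (puncturedLineIn (fixedSpace Γ₀) v) h.toLinearMap x = x) (n : ℕ) :
    ∃ t, tensorToCover ω Γ Γ₀ v t - x ∈ coverFiltration ω Γ₀ v n := by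
  have : Finite Γ₀ := finite_of_le (hΓ₀.trans_le inf_le_left)
  have : Finite (sliceGroup ω Γ₀) := finite_inducedGroup _ _
  rw [tensorToCover_eq]
  exact exists_prodPullback_sub_mem (inclPullback_leaf_bijective hΓ₀ hfree) hx n

theorem productToCover_strict [FiniteDimensional ℂ V] [Finite Γ]
    (hΓ₀ : Γ₀ = Γ ⊓ MulAction.stabilizer (V ≃ₗ[ℂ] V) v) (hfree : FreeOrbit Γ v) (n : ℕ) :
    ∃ m, ∀ x, productToCover ω Γ Γ₀ v x ∈ coverFiltration ω Γ₀ v m →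
        x ∈ CompletedTensor.filtration (leafIdeal Γ Γ₀ v) (originIdeal (sliceGroup ω Γ₀)) n := by
  rw [productToCover_eq]
  exact liftLoc_strict (leafIdeal_le ω Γ Γ₀ v) (originIdeal_le ω Γ₀ v)
    (tensorToCover_strict hΓ₀ hfree) n

theorem productToCover_injective [FiniteDimensional ℂ V] [Finite Γ]
    (hΓ₀ : Γ₀ = Γ ⊓ MulAction.stabilizer (V ≃ₗ[ℂ] V) v) (hfree : FreeOrbit Γ v) :
    Function.Injective (productToCover ω Γ Γ₀ v) := by
  rw [productToCover_eq]
  exact liftLoc_injective (leafIdeal_le ω Γ Γ₀ v) (originIdeal_le ω Γ₀ v)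
    (tensorToCover_strict hΓ₀ hfree)

theorem productToCover_mem {x : ProductNbhd ω Γ Γ₀ v} {n : ℕ}
    (hx : x ∈ CompletedTensor.filtration (leafIdeal Γ Γ₀ v) (originIdeal (sliceGroup ω Γ₀)) n) :
    productToCover ω Γ Γ₀ v x ∈ coverFiltration ω Γ₀ v n := by
  rw [productToCover_eq]
  exact liftLoc_mem (leafIdeal_le ω Γ Γ₀ v) (originIdeal_le ω Γ₀ v) hx

/-- Density and strictness combine to surjectivity onto the invariants. Together with
`rightPullback_productToCover` this determines the image of the product side. -/
theorem exists_productToCover_eq [FiniteDimensional ℂ V] [Finite Γ]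
    (hΓ₀ : Γ₀ = Γ ⊓ MulAction.stabilizer (V ≃ₗ[ℂ] V) v) (hfree : FreeOrbit Γ v)
    {x : CoverNbhd ω Γ₀ v} (hx : ∀ h ∈ sliceGroup ω Γ₀,
      rightPullback (puncturedLineIn (fixedSpace Γ₀) v) h.toLinearMap x = x) :
    ∃ y, productToCover ω Γ Γ₀ v y = x := by
  rw [productToCover_eq]
  exact exists_liftLoc_eq (leafIdeal_le ω Γ Γ₀ v) (originIdeal_le ω Γ₀ v)
    (tensorToCover_strict hΓ₀ hfree)
    (exists_tensorToCover_sub_mem hΓ₀ hfree hx)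

end ProductSide

/-! ### Symmetries of the common cover -/

section Symmetries

variable {V : Type*} [AddCommGroup V] [Module ℂ V] {ω : LinearMap.BilinForm ℂ V}
  {Γ Γ₀ : Subgroup (V ≃ₗ[ℂ] V)} {v : V}

theorem invariants_comp {V' : Type*} [AddCommGroup V'] [Module ℂ V'] (G : Subgroup (V ≃ₗ[ℂ] V))
    (L : V' →ₗ[ℂ] V) : ∀ f ∈ invariants G, f ∘ L ∈ polyFun V' :=
  fun _ hf => polyFun_comp L hf.1

theorem mapsTo_coverDilation (U : Submodule ℂ V) (W : Type*) [AddCommGroup W] [Module ℂ W] (v : V)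
    (c : ℂˣ) : Set.MapsTo (fun p : U × W => c • p) (puncturedLineIn U v ×ˢ ({0} : Set W))
      (puncturedLineIn U v ×ˢ ({0} : Set W)) :=
  fun _ hp => ⟨puncturedLineIn_smul U v c hp.1, (congrArg (c • ·) hp.2).trans (smul_zero c)⟩

theorem rightPullback_leafToCover (h : slice ω Γ₀ →ₗ[ℂ] slice ω Γ₀) (x : LeafNbhd Γ Γ₀ v) :
    rightPullback (puncturedLineIn (fixedSpace Γ₀) v) h (leafToCover ω Γ Γ₀ v x) =
      leafToCover ω Γ Γ₀ v x :=
  formalPullback_formalPullback ((LinearMap.id : fixedSpace Γ₀ →ₗ[ℂ] fixedSpace Γ₀).prodMap h)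
    (fun _ hf => polyFun_comp
      ((LinearMap.id : fixedSpace Γ₀ →ₗ[ℂ] fixedSpace Γ₀).prodMap h) hf) (mapsTo_prodMap h)
    (LinearMap.fst ℂ (fixedSpace Γ₀) (slice ω Γ₀))
    (invariants_comp (leafGroup Γ Γ₀) (LinearMap.fst ℂ (fixedSpace Γ₀) (slice ω Γ₀)))
    (fun _ hp => hp.1) (LinearMap.fst ℂ (fixedSpace Γ₀) (slice ω Γ₀)) rfl
    (invariants_comp (leafGroup Γ Γ₀) (LinearMap.fst ℂ (fixedSpace Γ₀) (slice ω Γ₀)))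
    (fun _ hp => hp.1) x

theorem rightPullback_originToCover (h : slice ω Γ₀ →ₗ[ℂ] slice ω Γ₀)
    (x : OriginFunctions (slice ω Γ₀)) :
    rightPullback (puncturedLineIn (fixedSpace Γ₀) v) h (originToCover ω Γ₀ v x) =
      originToCover ω Γ₀ v (originPullback h x) := by
  have hp : Set.MapsTo (h ∘ₗ LinearMap.snd ℂ (fixedSpace Γ₀) (slice ω Γ₀))
      (puncturedLineIn (fixedSpace Γ₀) v ×ˢ ({0} : Set (slice ω Γ₀))) {0} :=
    fun p hp => mapsTo_zero h hp.2
  exact (formalPullback_formalPullback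
    ((LinearMap.id : fixedSpace Γ₀ →ₗ[ℂ] fixedSpace Γ₀).prodMap h)
    (fun _ hf => polyFun_comp
      ((LinearMap.id : fixedSpace Γ₀ →ₗ[ℂ] fixedSpace Γ₀).prodMap h) hf) (mapsTo_prodMap h)
    (LinearMap.snd ℂ (fixedSpace Γ₀) (slice ω Γ₀))
    (fun _ hf => polyFun_comp (LinearMap.snd ℂ (fixedSpace Γ₀) (slice ω Γ₀)) hf)
    (fun _ hp => hp.2) (h ∘ₗ LinearMap.snd ℂ (fixedSpace Γ₀) (slice ω Γ₀)) rfl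
    (fun _ hf => polyFun_comp (h ∘ₗ LinearMap.snd ℂ (fixedSpace Γ₀) (slice ω Γ₀)) hf)
    hp x).trans
    (formalPullback_formalPullback (LinearMap.snd ℂ (fixedSpace Γ₀) (slice ω Γ₀))
    (fun _ hf => polyFun_comp (LinearMap.snd ℂ (fixedSpace Γ₀) (slice ω Γ₀)) hf)
    (fun _ hp => hp.2) h (fun _ hf => polyFun_comp h hf) (mapsTo_zero h)
    (h ∘ₗ LinearMap.snd ℂ (fixedSpace Γ₀) (slice ω Γ₀)) rfl
    (fun _ hf => polyFun_comp (h ∘ₗ LinearMap.snd ℂ (fixedSpace Γ₀) (slice ω Γ₀)) hf)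
    hp x).symm

/-- It suffices to check the two factors: functions from the leaf do not see the second coordinate,
and those from the slice are invariant by definition. -/
theorem rightPullback_productToCover {h : slice ω Γ₀ ≃ₗ[ℂ] slice ω Γ₀} (hh : h ∈ sliceGroup ω Γ₀)
    (x : ProductNbhd ω Γ Γ₀ v) :
    rightPullback (puncturedLineIn (fixedSpace Γ₀) v) h.toLinearMap (productToCover ω Γ Γ₀ v x) =
      productToCover ω Γ Γ₀ v x := by
  rw [productToCover_eq]
  refine liftLoc_fixed (leafIdeal_le ω Γ Γ₀ v) (originIdeal_le ω Γ₀ v)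
    (rightPullback (puncturedLineIn (fixedSpace Γ₀) v) h.toLinearMap)
    (fun n x hx => formalPullback_mem _ _ _ hx) (rightPullback_leafToCover h.toLinearMap)
    (fun b => ?_) x
  exact (rightPullback_originToCover h.toLinearMap b.1).trans
    (congrArg (originToCover ω Γ₀ v) (b.2 h hh))

/-- The action of `c ∈ ℂˣ` on the functions on the common cover. -/
def coverDilation (ω : LinearMap.BilinForm ℂ V) (Γ₀ : Subgroup (V ≃ₗ[ℂ] V)) (v : V) (c : ℂˣ) :
    CoverNbhd ω Γ₀ v →ₐ[ℂ] CoverNbhd ω Γ₀ v :=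
  formalPullback (c • ·) (polyFun_smul c) (mapsTo_coverDilation (fixedSpace Γ₀) (slice ω Γ₀) v c)

theorem leafToCover_leafDilation (c : ℂˣ) (x : LeafNbhd Γ Γ₀ v) :
    leafToCover ω Γ Γ₀ v (leafDilation Γ Γ₀ v c x) =
      coverDilation ω Γ₀ v c (leafToCover ω Γ Γ₀ v x) := by
  have hp : Set.MapsTo (fun p : fixedSpace Γ₀ × slice ω Γ₀ => c • p.1)
      (puncturedLineIn (fixedSpace Γ₀) v ×ˢ ({0} : Set (slice ω Γ₀)))
      (puncturedLineIn (fixedSpace Γ₀) v) :=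
    fun p hp => puncturedLineIn_smul (fixedSpace Γ₀) v c hp.1
  have hR : ∀ f ∈ invariants (leafGroup Γ Γ₀),
      f ∘ (fun p : fixedSpace Γ₀ × slice ω Γ₀ => c • p.1) ∈ polyFun (fixedSpace Γ₀ × slice ω Γ₀) :=
    fun f hf => polyFun_comp (LinearMap.fst ℂ (fixedSpace Γ₀) (slice ω Γ₀))
      (polyFun_smul c f hf.1)
  exact (formalPullback_formalPullback (LinearMap.fst ℂ (fixedSpace Γ₀) (slice ω Γ₀))
    (invariants_comp (leafGroup Γ Γ₀) (LinearMap.fst ℂ (fixedSpace Γ₀) (slice ω Γ₀)))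
    (fun _ hp => hp.1) (c • ·) (invariants_smul (leafGroup Γ Γ₀) c)
    (puncturedLineIn_smul (fixedSpace Γ₀) v c) (fun p => c • p.1) rfl hR hp x).trans
    (formalPullback_formalPullback (c • ·) (polyFun_smul c)
      (mapsTo_coverDilation (fixedSpace Γ₀) (slice ω Γ₀) v c)
      (LinearMap.fst ℂ (fixedSpace Γ₀) (slice ω Γ₀))
      (invariants_comp (leafGroup Γ Γ₀) (LinearMap.fst ℂ (fixedSpace Γ₀) (slice ω Γ₀)))
      (fun _ hp => hp.1) (fun p => c • p.1) rfl hR hp x).symm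

theorem originToCover_lsmul (c : ℂˣ) (x : OriginFunctions (slice ω Γ₀)) :
    originToCover ω Γ₀ v (originPullback (LinearMap.lsmul ℂ (slice ω Γ₀) (c : ℂ)) x) =
      coverDilation ω Γ₀ v c (originToCover ω Γ₀ v x) := by
  have hp : Set.MapsTo (fun p : fixedSpace Γ₀ × slice ω Γ₀ => c • p.2)
      (puncturedLineIn (fixedSpace Γ₀) v ×ˢ ({0} : Set (slice ω Γ₀))) {0} :=
    fun p hp => (congrArg (c • ·) hp.2).trans (smul_zero c)
  have hR : ∀ f ∈ polyFun (slice ω Γ₀),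
      f ∘ (fun p : fixedSpace Γ₀ × slice ω Γ₀ => c • p.2) ∈ polyFun (fixedSpace Γ₀ × slice ω Γ₀) :=
    fun f hf => polyFun_comp (LinearMap.snd ℂ (fixedSpace Γ₀) (slice ω Γ₀))
      (polyFun_smul c f hf)
  exact (formalPullback_formalPullback (LinearMap.snd ℂ (fixedSpace Γ₀) (slice ω Γ₀))
    (fun _ hf => polyFun_comp (LinearMap.snd ℂ (fixedSpace Γ₀) (slice ω Γ₀)) hf)
    (fun _ hp => hp.2) (LinearMap.lsmul ℂ (slice ω Γ₀) (c : ℂ))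
    (fun _ hf => polyFun_comp (LinearMap.lsmul ℂ (slice ω Γ₀) (c : ℂ)) hf)
    (mapsTo_zero (LinearMap.lsmul ℂ (slice ω Γ₀) (c : ℂ))) (fun p => c • p.2) rfl hR hp x).trans
    (formalPullback_formalPullback (c • ·) (polyFun_smul c)
      (mapsTo_coverDilation (fixedSpace Γ₀) (slice ω Γ₀) v c)
      (LinearMap.snd ℂ (fixedSpace Γ₀) (slice ω Γ₀))
      (fun _ hf => polyFun_comp (LinearMap.snd ℂ (fixedSpace Γ₀) (slice ω Γ₀)) hf)
      (fun _ hp => hp.2) (fun p => c • p.2) rfl hR hp x).symm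

theorem productToCover_productDilation (c : ℂˣ) (x : ProductNbhd ω Γ Γ₀ v) :
    productToCover ω Γ Γ₀ v (productDilation ω Γ Γ₀ v c x) =
      coverDilation ω Γ₀ v c (productToCover ω Γ Γ₀ v x) := by
  rw [productToCover_eq]
  exact liftLoc_map (leafIdeal_le ω Γ Γ₀ v) (originIdeal_le ω Γ₀ v) (coverDilation ω Γ₀ v c)
    (fun n x hx => formalPullback_mem _ _ _ hx) (leafDilation Γ Γ₀ v c)
    (originDilation (sliceGroup ω Γ₀) c) (formalPullback_ideal _ _ _)
    (originDilation_ideal (sliceGroup ω Γ₀) c) (leafToCover_leafDilation c)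
    (fun y => originToCover_lsmul c y.1) x

theorem quotientToCover_quotientDilation (c : ℂˣ) (x : QuotientNbhd Γ v) :
    quotientToCover ω Γ Γ₀ v (quotientDilation Γ v c x) =
      coverDilation ω Γ₀ v c (quotientToCover ω Γ Γ₀ v x) := by
  have hp0 : Set.MapsTo ((fixedSpace Γ₀).subtype.coprod (slice ω Γ₀).subtype)
      (puncturedLineIn (fixedSpace Γ₀) v ×ˢ ({0} : Set (slice ω Γ₀))) (puncturedLine v) := by
    rintro ⟨u, w⟩ ⟨hu, hw⟩
    obtain rfl : w = 0 := hw
    simpa using (show (u : V) ∈ puncturedLine v from hu)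
  have hp : Set.MapsTo (fun p => c • (fixedSpace Γ₀).subtype.coprod (slice ω Γ₀).subtype p)
      (puncturedLineIn (fixedSpace Γ₀) v ×ˢ ({0} : Set (slice ω Γ₀))) (puncturedLine v) :=
    (puncturedLine_smul v c).comp hp0
  have hR : ∀ f ∈ invariants Γ,
      f ∘ (fun p => c • (fixedSpace Γ₀).subtype.coprod (slice ω Γ₀).subtype p) ∈
        polyFun (fixedSpace Γ₀ × slice ω Γ₀) :=
    fun f hf => polyFun_comp ((fixedSpace Γ₀).subtype.coprod (slice ω Γ₀).subtype)
      (polyFun_smul c f hf.1)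
  exact (formalPullback_formalPullback ((fixedSpace Γ₀).subtype.coprod (slice ω Γ₀).subtype)
    (invariants_comp Γ ((fixedSpace Γ₀).subtype.coprod (slice ω Γ₀).subtype))
    hp0 (c • ·) (invariants_smul Γ c) (puncturedLine_smul v c)
    (fun p => c • (fixedSpace Γ₀).subtype.coprod (slice ω Γ₀).subtype p) rfl hR hp x).trans
    (formalPullback_formalPullback (c • ·) (polyFun_smul c)
      (mapsTo_coverDilation (fixedSpace Γ₀) (slice ω Γ₀) v c)
      ((fixedSpace Γ₀).subtype.coprod (slice ω Γ₀).subtype)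
      (invariants_comp Γ ((fixedSpace Γ₀).subtype.coprod (slice ω Γ₀).subtype))
      hp0 (fun p => c • (fixedSpace Γ₀).subtype.coprod (slice ω Γ₀).subtype p)
      (funext fun p => (map_smul ((fixedSpace Γ₀).subtype.coprod (slice ω Γ₀).subtype)
        (c : ℂ) p).symm) hR hp x).symm

end Symmetries

theorem formalPullback_bracket_eq_zero {α β β' : Type*} {R : Subalgebra ℂ (α → ℂ)}
    {R₁ : Subalgebra ℂ (β → ℂ)} {R₂ : Subalgebra ℂ (β' → ℂ)} {Y : Set α} {Y₁ : Set β} {Y₂ : Set β'}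
    (L : α → β) (hR : ∀ f ∈ R₁, f ∘ L ∈ R) (hY : Set.MapsTo L Y Y₁) (L' : α → β')
    (hR' : ∀ f ∈ R₂, f ∘ L' ∈ R) (hY' : Set.MapsTo L' Y Y₂) (Q : PoissonBracket R)
    (h : ∀ a b, Q.bracket (pullback L hR a) (pullback L' hR' b) = 0)
    (x : FormalFunctions R₁ Y₁) (y : FormalFunctions R₂ Y₂) :
    (formalBracket Q Y).bracket (formalPullback L hR hY x) (formalPullback L' hR' hY' y) = 0 :=
  locBracket_locComplMap_eq_zero Q h x y

theorem originBracket_coe {W : Type*} [AddCommGroup W] [Module ℂ W] [FiniteDimensional ℂ W]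
    {ω : LinearMap.BilinForm ℂ W} (hω : IsSymplecticForm ω) {G : Subgroup (W ≃ₗ[ℂ] W)}
    (hG : Preserves ω G) (x y : originInvariants G) :
    ((originBracket hω hG).bracket x y).1 =
      (formalBracket (symplecticBracket hω) {0}).bracket x.1 y.1 := by
  unfold originBracket
  exact PoissonBracket.induced_spec _ (originInvariants G).val _ _ x y

/-! ### The Poisson bracket of the common cover -/

section CoverBracket

variable {V : Type*} [AddCommGroup V] [Module ℂ V] {ω : LinearMap.BilinForm ℂ V}
  {Γ Γ₀ : Subgroup (V ≃ₗ[ℂ] V)} {v : V}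

/-- The linear map `V^Γ₀ × (V^Γ₀)^⊥ → V`, `(u, w) ↦ u + w`. -/
abbrev coverMap (ω : LinearMap.BilinForm ℂ V) (Γ₀ : Subgroup (V ≃ₗ[ℂ] V)) :
    fixedSpace Γ₀ × slice ω Γ₀ →ₗ[ℂ] V :=
  (fixedSpace Γ₀).subtype.coprod (slice ω Γ₀).subtype

theorem coverMap_apply (p : fixedSpace Γ₀ × slice ω Γ₀) :
    coverMap ω Γ₀ p = (p.1 : V) + (p.2 : V) := LinearMap.coprod_apply _ _ _

/-- The symplectic form on `V^Γ₀ × (V^Γ₀)^⊥`. -/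
def coverForm (ω : LinearMap.BilinForm ℂ V) (Γ₀ : Subgroup (V ≃ₗ[ℂ] V)) :
    LinearMap.BilinForm ℂ (fixedSpace Γ₀ × slice ω Γ₀) :=
  ω.compl₁₂ (coverMap ω Γ₀) (coverMap ω Γ₀)

theorem coverForm_apply (p q : fixedSpace Γ₀ × slice ω Γ₀) :
    coverForm ω Γ₀ p q = ω (coverMap ω Γ₀ p) (coverMap ω Γ₀ q) := rfl

/-- Orthogonality of the two summands makes the inclusion of V^Γ₀ adjoint to the first projection,
which is the hypothesis of `polyPullback_bracket`. -/
theorem coverForm_inl (u : fixedSpace Γ₀)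
    (p : fixedSpace Γ₀ × slice ω Γ₀) :
    coverForm ω Γ₀ (LinearMap.inl ℂ _ _ u) p = ω.restrict (fixedSpace Γ₀) u p.1 := by
  have h : ω (u : V) (p.2 : V) = 0 := p.2.2 u u.2
  rw [coverForm_apply, coverMap_apply, coverMap_apply, map_add]
  simp [h]

theorem coverForm_inr (hω : IsSymplecticForm ω) (w : slice ω Γ₀)
    (p : fixedSpace Γ₀ × slice ω Γ₀) :
    coverForm ω Γ₀ (LinearMap.inr ℂ _ _ w) p = ω.restrict (slice ω Γ₀) w p.2 := by
  have h : ω (w : V) (p.1 : V) = 0 := hω.alt.isRefl _ _ (w.2 p.1 p.1.2)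
  rw [coverForm_apply, coverMap_apply, coverMap_apply, map_add]
  simp [h]

theorem mapsTo_coverMap : Set.MapsTo (coverMap ω Γ₀)
    (puncturedLineIn (fixedSpace Γ₀) v ×ˢ ({0} : Set (slice ω Γ₀))) (puncturedLine v) := by
  rintro ⟨u, w⟩ ⟨hu, hw⟩
  obtain rfl : w = 0 := hw
  simpa using (show (u : V) ∈ puncturedLine v from hu)

variable [FiniteDimensional ℂ V]

theorem isCompl_slice (hω : IsSymplecticForm ω) [Finite Γ₀] (hΓ₀ : Preserves ω Γ₀) :
    IsCompl (fixedSpace Γ₀) (slice ω Γ₀) :=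
  LinearMap.BilinForm.isCompl_orthogonal_of_restrict_nondegenerate hω.alt.isRefl
    (fixedSpace_symplectic hω hΓ₀).nondegenerate

/-- The decomposition `V = V^Γ₀ × (V^Γ₀)^⊥`. -/
def coverEquiv (hω : IsSymplecticForm ω) [Finite Γ₀] (hΓ₀ : Preserves ω Γ₀) :
    (fixedSpace Γ₀ × slice ω Γ₀) ≃ₗ[ℂ] V :=
  Submodule.prodEquivOfIsCompl _ _ (isCompl_slice hω hΓ₀)

theorem coverEquiv_apply (hω : IsSymplecticForm ω) [Finite Γ₀] (hΓ₀ : Preserves ω Γ₀)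
    (p : fixedSpace Γ₀ × slice ω Γ₀) : coverEquiv hω hΓ₀ p = coverMap ω Γ₀ p :=
  LinearMap.congr_fun (Submodule.coe_prodEquivOfIsCompl _ _ (isCompl_slice hω hΓ₀)) p

theorem coverForm_symplectic (hω : IsSymplecticForm ω) [Finite Γ₀] (hΓ₀ : Preserves ω Γ₀) :
    IsSymplecticForm (coverForm ω Γ₀) := by
  refine ⟨fun p => hω.alt _, fun p hp => ?_, fun p hp => ?_⟩ <;>
  · refine (coverEquiv hω hΓ₀).map_eq_zero_iff.mp ?_
    -- Nondegeneracy has a left and a right half, and each goal accepts only the corresponding half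
    -- for `ω`.
    first
    | refine hω.nondegenerate.1 _ fun y => ?_
      obtain ⟨q, rfl⟩ := (coverEquiv hω hΓ₀).surjective y
      rw [coverEquiv_apply, coverEquiv_apply]
      exact hp q
    | refine hω.nondegenerate.2 _ fun y => ?_
      obtain ⟨q, rfl⟩ := (coverEquiv hω hΓ₀).surjective y
      rw [coverEquiv_apply, coverEquiv_apply]
      exact hp q

/-- The Poisson bracket of the common cover. -/
def coverBracket (hω : IsSymplecticForm ω) [Finite Γ₀] (hΓ₀ : Preserves ω Γ₀) (v : V) :
    PoissonBracket (CoverNbhd ω Γ₀ v) :=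
  formalBracket (symplecticBracket (coverForm_symplectic hω hΓ₀))
    (puncturedLineIn (fixedSpace Γ₀) v ×ˢ ({0} : Set (slice ω Γ₀)))

/-- The form on the cover is the pull-back of `ω` along the isomorphism (u, w) ↦ u + w, so the
inverse isomorphism is an adjoint section of this map. -/
theorem quotientToCover_bracket (hω : IsSymplecticForm ω) [Finite Γ₀] (hΓ : Preserves ω Γ)
    (hΓ₀ : Preserves ω Γ₀) (x y : QuotientNbhd Γ v) :
    quotientToCover ω Γ Γ₀ v ((quotientNbhdBracket hω hΓ v).bracket x y) =
      (coverBracket hω hΓ₀ v).bracket (quotientToCover ω Γ Γ₀ v x)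
        (quotientToCover ω Γ Γ₀ v y) :=
  formalPullback_bracket (coverMap ω Γ₀) (invariants_comp Γ (coverMap ω Γ₀)) mapsTo_coverMap
    (quotientBracket hω hΓ) (symplecticBracket (coverForm_symplectic hω hΓ₀))
    (pullback_quotientBracket (coverForm_symplectic hω hΓ₀) hω hΓ (coverMap ω Γ₀)
      (coverEquiv hω hΓ₀).symm
      (fun ξ p => by
        rw [coverForm_apply, ← coverEquiv_apply hω hΓ₀, LinearEquiv.apply_symm_apply])
      (fun ξ => by rw [← coverEquiv_apply hω hΓ₀, LinearEquiv.apply_symm_apply])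
      (invariants_comp Γ (coverMap ω Γ₀))) x y

theorem leafToCover_bracket [Finite Γ] (hω : IsSymplecticForm ω) [Finite Γ₀] (hΓ : Preserves ω Γ)
    (h : Γ₀ ≤ Γ) (x y : LeafNbhd Γ Γ₀ v) :
    leafToCover ω Γ Γ₀ v ((leafNbhdBracket hω hΓ h v).bracket x y) =
      (coverBracket hω (hΓ.mono h) v).bracket (leafToCover ω Γ Γ₀ v x)
        (leafToCover ω Γ Γ₀ v y) :=
  formalPullback_bracket (LinearMap.fst ℂ (fixedSpace Γ₀) (slice ω Γ₀))
    (invariants_comp (leafGroup Γ Γ₀) (LinearMap.fst ℂ (fixedSpace Γ₀) (slice ω Γ₀)))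
    (fun _ hp => hp.1)
    (quotientBracket (fixedSpace_symplectic hω (hΓ.mono h)) (leafGroup_preserves hΓ Γ₀))
    (symplecticBracket (coverForm_symplectic hω (hΓ.mono h)))
    (pullback_quotientBracket (coverForm_symplectic hω (hΓ.mono h))
      (fixedSpace_symplectic hω (hΓ.mono h)) (leafGroup_preserves hΓ Γ₀)
      (LinearMap.fst ℂ (fixedSpace Γ₀) (slice ω Γ₀)) (LinearMap.inl ℂ _ _)
      (coverForm_inl) (fun _ => rfl)
      (invariants_comp (leafGroup Γ Γ₀) (LinearMap.fst ℂ (fixedSpace Γ₀) (slice ω Γ₀)))) x y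

theorem originToCover_bracket (hω : IsSymplecticForm ω) [Finite Γ₀] (hΓ₀ : Preserves ω Γ₀)
    (x y : OriginFunctions (slice ω Γ₀)) :
    originToCover ω Γ₀ v
        ((formalBracket (symplecticBracket (slice_symplectic hω hΓ₀)) {0}).bracket x y) =
      (coverBracket hω hΓ₀ v).bracket (originToCover ω Γ₀ v x) (originToCover ω Γ₀ v y) :=
  formalPullback_bracket (LinearMap.snd ℂ (fixedSpace Γ₀) (slice ω Γ₀))
    (fun _ hf => polyFun_comp (LinearMap.snd ℂ (fixedSpace Γ₀) (slice ω Γ₀)) hf)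
    (fun _ hp => hp.2) (symplecticBracket (slice_symplectic hω hΓ₀))
    (symplecticBracket (coverForm_symplectic hω hΓ₀))
    (polyPullback_bracket (coverForm_symplectic hω hΓ₀) (slice_symplectic hω hΓ₀)
      (LinearMap.snd ℂ (fixedSpace Γ₀) (slice ω Γ₀)) (LinearMap.inr ℂ _ _)
      (coverForm_inr hω) (fun _ => rfl)) x y

theorem originToCover_sliceBracket [Finite Γ] (hω : IsSymplecticForm ω) [Finite Γ₀]
    (hΓ : Preserves ω Γ) (h : Γ₀ ≤ Γ) (x y : SliceFunctions ω Γ₀) :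
    (originToCover ω Γ₀ v).comp (originInvariants (sliceGroup ω Γ₀)).val
        ((sliceBracket hω hΓ h).bracket x y) =
      (coverBracket hω (hΓ.mono h) v).bracket
        ((originToCover ω Γ₀ v).comp (originInvariants (sliceGroup ω Γ₀)).val x)
        ((originToCover ω Γ₀ v).comp (originInvariants (sliceGroup ω Γ₀)).val y) := by
  have e : ((sliceBracket hω hΓ h).bracket x y).1 =
      (formalBracket (symplecticBracket (slice_symplectic hω (hΓ.mono h))) {0}).bracket x.1 y.1 :=
    originBracket_coe (slice_symplectic hω (hΓ.mono h)) (inducedGroup_preserves (hΓ.mono h) _) x y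
  exact (congrArg (originToCover ω Γ₀ v) e).trans
    (originToCover_bracket hω (hΓ.mono h) x.1 y.1)

/-- The adjoints of the two projections are the inclusions of the factors, and projecting the second
inclusion to the first factor gives zero. -/
theorem leafToCover_originToCover_bracket (hω : IsSymplecticForm ω) [Finite Γ₀]
    (hΓ₀ : Preserves ω Γ₀) (x : LeafNbhd Γ Γ₀ v) (y : OriginFunctions (slice ω Γ₀)) :
    (coverBracket hω hΓ₀ v).bracket (leafToCover ω Γ Γ₀ v x) (originToCover ω Γ₀ v y) = 0 :=
  formalPullback_bracket_eq_zero (LinearMap.fst ℂ (fixedSpace Γ₀) (slice ω Γ₀))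
    (invariants_comp (leafGroup Γ Γ₀) (LinearMap.fst ℂ (fixedSpace Γ₀) (slice ω Γ₀)))
    (fun _ hp => hp.1) (LinearMap.snd ℂ (fixedSpace Γ₀) (slice ω Γ₀))
    (fun _ hf => polyFun_comp (LinearMap.snd ℂ (fixedSpace Γ₀) (slice ω Γ₀)) hf)
    (fun _ hp => hp.2) (symplecticBracket (coverForm_symplectic hω hΓ₀))
    (fun a b => polyPullback_bracket_eq_zero (coverForm_symplectic hω hΓ₀)
      (fixedSpace_symplectic hω hΓ₀) (slice_symplectic hω hΓ₀)
      (LinearMap.fst ℂ (fixedSpace Γ₀) (slice ω Γ₀)) (LinearMap.inl ℂ _ _) (coverForm_inl)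
      (LinearMap.snd ℂ (fixedSpace Γ₀) (slice ω Γ₀)) (LinearMap.inr ℂ _ _) (coverForm_inr hω)
      (fun _ => rfl) ⟨a.1, a.2.1⟩ b) x y

theorem productToCover_bracket [Finite Γ] (hω : IsSymplecticForm ω) [Finite Γ₀]
    (hΓ : Preserves ω Γ) (h : Γ₀ ≤ Γ) (x y : ProductNbhd ω Γ Γ₀ v) :
    productToCover ω Γ Γ₀ v ((productBracket hω hΓ h v).bracket x y) =
      (coverBracket hω (hΓ.mono h) v).bracket (productToCover ω Γ Γ₀ v x)
        (productToCover ω Γ Γ₀ v y) := by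
  rw [productToCover_eq]
  exact liftLoc_bracket (leafIdeal_le ω Γ Γ₀ v) (originIdeal_le ω Γ₀ v)
    (leafNbhdBracket hω hΓ h v) (sliceBracket hω hΓ h)
    (symplecticBracket (coverForm_symplectic hω (hΓ.mono h))) (leafToCover_bracket hω hΓ h)
    (originToCover_sliceBracket hω hΓ h)
    (fun a b => leafToCover_originToCover_bracket hω (hΓ.mono h) a b.1) x y

end CoverBracket

/-! ### The map from the common cover to the quotient -/

section QuotientSide

variable {V : Type*} [AddCommGroup V] [Module ℂ V] {ω : LinearMap.BilinForm ℂ V}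
  {Γ Γ₀ : Subgroup (V ≃ₗ[ℂ] V)} {v : V}

theorem mapsTo_coverMap_comp_prodMap (h : slice ω Γ₀ →ₗ[ℂ] slice ω Γ₀) :
    Set.MapsTo (coverMap ω Γ₀ ∘ₗ (LinearMap.id : fixedSpace Γ₀ →ₗ[ℂ] fixedSpace Γ₀).prodMap h)
      (puncturedLineIn (fixedSpace Γ₀) v ×ˢ ({0} : Set (slice ω Γ₀))) (puncturedLine v) :=
  fun _ hp => mapsTo_coverMap (mapsTo_prodMap h hp)

/-- If `h` is induced by g in Γ₀, then u + h w = g (u + w) because g fixes u, and functions on V / Γ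
do not distinguish this from u + w. -/
theorem rightPullback_quotientToCover (hΓ₀ : Γ₀ ≤ Γ) {h : slice ω Γ₀ ≃ₗ[ℂ] slice ω Γ₀}
    (hh : h ∈ sliceGroup ω Γ₀) (x : QuotientNbhd Γ v) :
    rightPullback (puncturedLineIn (fixedSpace Γ₀) v) h.toLinearMap (quotientToCover ω Γ Γ₀ v x) =
      quotientToCover ω Γ Γ₀ v x := by
  refine (formalPullback_formalPullback
    ((LinearMap.id : fixedSpace Γ₀ →ₗ[ℂ] fixedSpace Γ₀).prodMap h.toLinearMap)
    (fun _ hf => polyFun_comp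
      ((LinearMap.id : fixedSpace Γ₀ →ₗ[ℂ] fixedSpace Γ₀).prodMap h.toLinearMap) hf)
    (mapsTo_prodMap h.toLinearMap) (coverMap ω Γ₀) (invariants_comp Γ (coverMap ω Γ₀))
    mapsTo_coverMap
    (coverMap ω Γ₀ ∘ₗ (LinearMap.id : fixedSpace Γ₀ →ₗ[ℂ] fixedSpace Γ₀).prodMap h.toLinearMap) rfl
    (invariants_comp Γ (coverMap ω Γ₀ ∘ₗ
      (LinearMap.id : fixedSpace Γ₀ →ₗ[ℂ] fixedSpace Γ₀).prodMap h.toLinearMap))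
    (mapsTo_coverMap_comp_prodMap h.toLinearMap) x).trans (formalPullback_congr (fun f => ?_) x)
  obtain ⟨g, hg, e⟩ := hh
  funext p
  have h1 : coverMap ω Γ₀ (p.1, h p.2) = g (coverMap ω Γ₀ p) := by
    rw [coverMap_apply, coverMap_apply, map_add, e, p.1.2 g hg]
  exact (congrArg (f : V → ℂ) h1).trans (f.2.2 g (hΓ₀ hg) (coverMap ω Γ₀ p))

/-- The automorphism of `(V^Γ₀)^⊥` induced by an element of `Γ₀`. -/
def sliceEquiv (hΓ₀ : Preserves ω Γ₀) {g : V ≃ₗ[ℂ] V} (hg : g ∈ Γ₀) :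
    slice ω Γ₀ ≃ₗ[ℂ] slice ω Γ₀ :=
  have key : ∀ k ∈ Γ₀, ∀ w ∈ slice ω Γ₀, k w ∈ slice ω Γ₀ := fun k hk w hw u hu => by
    have h := hΓ₀ k hk u w
    rw [hu k hk] at h
    exact h.trans (hw u hu)
  LinearEquiv.ofLinearMap (g.toLinearMap.restrict (key g hg))
    (g.symm.toLinearMap.restrict (key g⁻¹ (inv_mem hg)))
    (LinearMap.ext fun w => Subtype.ext (g.apply_symm_apply w))
    (LinearMap.ext fun w => Subtype.ext (g.symm_apply_apply w))

theorem sliceEquiv_apply (hΓ₀ : Preserves ω Γ₀) {g : V ≃ₗ[ℂ] V} (hg : g ∈ Γ₀) (w : slice ω Γ₀) :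
    (sliceEquiv hΓ₀ hg w : V) = g w := rfl

theorem sliceEquiv_mem (hΓ₀ : Preserves ω Γ₀) {g : V ≃ₗ[ℂ] V} (hg : g ∈ Γ₀) :
    sliceEquiv hΓ₀ hg ∈ sliceGroup ω Γ₀ := ⟨g, hg, sliceEquiv_apply hΓ₀ hg⟩

/-- The identification of functions near `ℂˣ · v` in `V` with functions on the common cover. -/
def coverPullback (ω : LinearMap.BilinForm ℂ V) (Γ₀ : Subgroup (V ≃ₗ[ℂ] V)) (v : V) :
    FormalFunctions (polyFun V) (puncturedLine v) →ₐ[ℂ] CoverNbhd ω Γ₀ v :=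
  formalPullback (coverMap ω Γ₀) (fun _ hf => polyFun_comp (coverMap ω Γ₀) hf) mapsTo_coverMap

theorem coverPullback_quotientPullback (x : QuotientNbhd Γ v) :
    coverPullback ω Γ₀ v (quotientPullback Γ v x) = quotientToCover ω Γ Γ₀ v x :=
  formalPullback_formalPullback (coverMap ω Γ₀)
    (fun _ hf => polyFun_comp (coverMap ω Γ₀) hf) mapsTo_coverMap id
    (R'' := invariants Γ) (fun _ hf => hf.1)
    (Set.mapsTo_id _) (coverMap ω Γ₀) rfl (invariants_comp Γ (coverMap ω Γ₀)) mapsTo_coverMap x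

variable [FiniteDimensional ℂ V]

theorem mapsTo_coverEquiv_symm (hω : IsSymplecticForm ω) [Finite Γ₀] (hΓ₀ : Preserves ω Γ₀)
    (hv : v ∈ fixedSpace Γ₀) : Set.MapsTo (coverEquiv hω hΓ₀).symm (puncturedLine v)
      (puncturedLineIn (fixedSpace Γ₀) v ×ˢ ({0} : Set (slice ω Γ₀))) := by
  rintro y hy
  have h1 : y ∈ fixedSpace Γ₀ := by
    obtain ⟨c, rfl⟩ := hy
    exact (fixedSpace Γ₀).smul_mem (c : ℂ) hv
  have h2 : (coverEquiv hω hΓ₀).symm y = (⟨y, h1⟩, 0) := by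
    rw [LinearEquiv.symm_apply_eq, coverEquiv_apply, coverMap_apply]
    exact (add_zero y).symm
  rw [h2]
  exact ⟨hy, rfl⟩

/-- The inverse of `coverPullback`. -/
def coverPullbackInv (hω : IsSymplecticForm ω) [Finite Γ₀] (hΓ₀ : Preserves ω Γ₀)
    (hv : v ∈ fixedSpace Γ₀) :
    CoverNbhd ω Γ₀ v →ₐ[ℂ] FormalFunctions (polyFun V) (puncturedLine v) :=
  formalPullback (coverEquiv hω hΓ₀).symm
    (fun _ hf => polyFun_comp (coverEquiv hω hΓ₀).symm.toLinearMap hf)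
    (mapsTo_coverEquiv_symm hω hΓ₀ hv)

theorem coverPullbackInv_coverPullback (hω : IsSymplecticForm ω) [Finite Γ₀]
    (hΓ₀ : Preserves ω Γ₀) (hv : v ∈ fixedSpace Γ₀)
    (x : FormalFunctions (polyFun V) (puncturedLine v)) :
    coverPullbackInv hω hΓ₀ hv (coverPullback ω Γ₀ v x) = x :=
  (formalPullback_formalPullback (coverEquiv hω hΓ₀).symm
    (fun _ hf => polyFun_comp (coverEquiv hω hΓ₀).symm.toLinearMap hf)
    (mapsTo_coverEquiv_symm hω hΓ₀ hv) (coverMap ω Γ₀)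
    (fun _ hf => polyFun_comp (coverMap ω Γ₀) hf) mapsTo_coverMap id
    (funext fun y => by
      rw [Function.comp_apply, ← coverEquiv_apply hω hΓ₀, LinearEquiv.apply_symm_apply, id])
    (fun _ hf => hf) (Set.mapsTo_id _) x).trans (formalPullback_eq_self _ _ x)

theorem coverPullback_coverPullbackInv (hω : IsSymplecticForm ω) [Finite Γ₀]
    (hΓ₀ : Preserves ω Γ₀) (hv : v ∈ fixedSpace Γ₀) (x : CoverNbhd ω Γ₀ v) :
    coverPullback ω Γ₀ v (coverPullbackInv hω hΓ₀ hv x) = x :=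
  (formalPullback_formalPullback (coverMap ω Γ₀)
    (fun _ hf => polyFun_comp (coverMap ω Γ₀) hf) mapsTo_coverMap (coverEquiv hω hΓ₀).symm
    (fun _ hf => polyFun_comp (coverEquiv hω hΓ₀).symm.toLinearMap hf)
    (mapsTo_coverEquiv_symm hω hΓ₀ hv) id
    (funext fun y => by
      rw [Function.comp_apply, ← coverEquiv_apply hω hΓ₀, LinearEquiv.symm_apply_apply, id])
    (fun _ hf => hf) (Set.mapsTo_id _) x).trans (formalPullback_eq_self _ _ x)

theorem quotientToCover_strict (hω : IsSymplecticForm ω) [Finite Γ] [Finite Γ₀]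
    (hΓ₀ : Preserves ω Γ₀) (hv : v ∈ fixedSpace Γ₀) (hfree : FreeOrbit Γ v) (n : ℕ) :
    ∃ m, ∀ x, quotientToCover ω Γ Γ₀ v x ∈ coverFiltration ω Γ₀ v m →
      x ∈ formalFiltration (invariants Γ) (puncturedLine v) n := by
  obtain ⟨m, hm⟩ := quotientPullback_strict hfree n
  refine ⟨m, fun x hx => hm x ?_⟩
  rw [← coverPullback_quotientPullback] at hx
  rw [← coverPullbackInv_coverPullback hω hΓ₀ hv (quotientPullback Γ v x)]
  exact formalPullback_mem _ _ _ hx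

theorem quotientToCover_injective (hω : IsSymplecticForm ω) [Finite Γ] [Finite Γ₀]
    (hΓ₀ : Preserves ω Γ₀) (hv : v ∈ fixedSpace Γ₀) (hfree : FreeOrbit Γ v) :
    Function.Injective (quotientToCover ω Γ Γ₀ v) := by
  intro x y hxy
  rw [← coverPullback_quotientPullback, ← coverPullback_quotientPullback] at hxy
  refine quotientPullback_injective hfree ?_
  rw [← coverPullbackInv_coverPullback hω hΓ₀ hv (quotientPullback Γ v x), hxy,
    coverPullbackInv_coverPullback]

/-- Under V = V^Γ₀ × (V^Γ₀)^⊥ an element of Γ₀ acts as the identity on the first factor. Invariance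
on the cover thus becomes invariance under the stabilizer of v on V. -/
theorem formalPullback_coverPullbackInv (hω : IsSymplecticForm ω) [Finite Γ₀]
    (hΓ₀ : Preserves ω Γ₀) (hv : v ∈ fixedSpace Γ₀) {g : V ≃ₗ[ℂ] V} (hg : g ∈ Γ₀) (hgv : g v = v)
    (x : CoverNbhd ω Γ₀ v) :
    formalPullback g (fun _ hf => polyFun_comp g.toLinearMap hf)
      (mapsTo_puncturedLine g.toLinearMap hgv) (coverPullbackInv hω hΓ₀ hv x) =
      coverPullbackInv hω hΓ₀ hv (rightPullback (puncturedLineIn (fixedSpace Γ₀) v)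
        (sliceEquiv hΓ₀ hg).toLinearMap x) := by
  have hN : (coverEquiv hω hΓ₀).symm ∘ g =
      (LinearMap.id : fixedSpace Γ₀ →ₗ[ℂ] fixedSpace Γ₀).prodMap
        (sliceEquiv hΓ₀ hg).toLinearMap ∘ (coverEquiv hω hΓ₀).symm := by
    funext y
    obtain ⟨p, rfl⟩ := (coverEquiv hω hΓ₀).surjective y
    rw [Function.comp_apply, Function.comp_apply, LinearEquiv.symm_apply_apply,
      LinearEquiv.symm_apply_eq, coverEquiv_apply, coverEquiv_apply, coverMap_apply,
      coverMap_apply, map_add, p.1.2 g hg]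
    rfl
  have hY : Set.MapsTo ((coverEquiv hω hΓ₀).symm ∘ g) (puncturedLine v)
      (puncturedLineIn (fixedSpace Γ₀) v ×ˢ ({0} : Set (slice ω Γ₀))) :=
    (mapsTo_coverEquiv_symm hω hΓ₀ hv).comp (mapsTo_puncturedLine g.toLinearMap hgv)
  have hR : ∀ f ∈ polyFun (fixedSpace Γ₀ × slice ω Γ₀),
      f ∘ ((coverEquiv hω hΓ₀).symm ∘ g) ∈ polyFun V := fun f hf =>
    polyFun_comp ((coverEquiv hω hΓ₀).symm.toLinearMap ∘ₗ g.toLinearMap) hf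
  exact (formalPullback_formalPullback g (fun _ hf => polyFun_comp g.toLinearMap hf)
    (mapsTo_puncturedLine g.toLinearMap hgv) (coverEquiv hω hΓ₀).symm
    (fun _ hf => polyFun_comp (coverEquiv hω hΓ₀).symm.toLinearMap hf)
    (mapsTo_coverEquiv_symm hω hΓ₀ hv) ((coverEquiv hω hΓ₀).symm ∘ g) rfl hR hY x).trans
    (formalPullback_formalPullback (coverEquiv hω hΓ₀).symm
    (fun _ hf => polyFun_comp (coverEquiv hω hΓ₀).symm.toLinearMap hf)
    (mapsTo_coverEquiv_symm hω hΓ₀ hv)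
    ((LinearMap.id : fixedSpace Γ₀ →ₗ[ℂ] fixedSpace Γ₀).prodMap
      (sliceEquiv hΓ₀ hg).toLinearMap)
    (fun _ hf => polyFun_comp ((LinearMap.id : fixedSpace Γ₀ →ₗ[ℂ] fixedSpace Γ₀).prodMap
      (sliceEquiv hΓ₀ hg).toLinearMap) hf)
    (mapsTo_prodMap (sliceEquiv hΓ₀ hg).toLinearMap) ((coverEquiv hω hΓ₀).symm ∘ g) hN hR hY
    x).symm

/-- An invariant function on the cover, transported to V, is fixed by every element of Γ that fixes
v, since these form Γ₀. It therefore descends to V / Γ. -/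
theorem exists_quotientToCover_eq (hω : IsSymplecticForm ω) [Finite Γ] [Finite Γ₀]
    (hΓ : Preserves ω Γ₀) (hΓ₀ : Γ₀ = Γ ⊓ MulAction.stabilizer (V ≃ₗ[ℂ] V) v)
    (hfree : FreeOrbit Γ v) {x : CoverNbhd ω Γ₀ v} (hx : ∀ h ∈ sliceGroup ω Γ₀,
      rightPullback (puncturedLineIn (fixedSpace Γ₀) v) h.toLinearMap x = x) :
    ∃ y, quotientToCover ω Γ Γ₀ v y = x := by
  have hv : v ∈ fixedSpace Γ₀ := fun g hg => (hΓ₀.le hg).2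
  obtain ⟨y, hy⟩ := exists_quotientPullback_eq hfree (x := coverPullbackInv hω hΓ hv x)
    fun g hg hgv => by
      have h : g ∈ Γ₀ := hΓ₀.ge ⟨hg, hgv⟩
      rw [formalPullback_coverPullbackInv hω hΓ hv h hgv, hx _ (sliceEquiv_mem hΓ h)]
  refine ⟨y, ?_⟩
  rw [← coverPullback_quotientPullback, hy, coverPullback_coverPullbackInv]

end QuotientSide

end FormalQuotient

end

/-! ### The decomposition theorem -/

theorem proposition4p1 {V : Type*} [AddCommGroup V] [Module ℂ V] [FiniteDimensional ℂ V]
    (ω : LinearMap.BilinForm ℂ V) (hω : IsSymplecticForm ω)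
    (Γ : Subgroup (V ≃ₗ[ℂ] V)) [Finite Γ] (hΓ : Preserves ω Γ)
    (Γ₀ : Subgroup (V ≃ₗ[ℂ] V)) (v : V)
    (hΓ₀ : Γ₀ = Γ ⊓ MulAction.stabilizer (V ≃ₗ[ℂ] V) v)
    (hfree : ∀ c : ℂˣ, (∃ g ∈ Γ, g v = c • v) → c = 1) :
    ∃! φ : QuotientNbhd Γ v ≃ₐ[ℂ] ProductNbhd ω Γ Γ₀ v,
      FilteredContinuous (formalFiltration _ _) (CompletedTensor.filtration _ _)
        (φ : QuotientNbhd Γ v →ₐ[ℂ] ProductNbhd ω Γ Γ₀ v) ∧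
      FilteredContinuous (CompletedTensor.filtration _ _) (formalFiltration _ _)
        (φ.symm : ProductNbhd ω Γ Γ₀ v →ₐ[ℂ] QuotientNbhd Γ v) ∧
      (∀ c x, φ (quotientDilation Γ v c x) = productDilation ω Γ Γ₀ v c (φ x)) ∧
      (∀ x y, φ ((quotientNbhdBracket hω hΓ v).bracket x y) =
        (productBracket hω hΓ (hΓ₀.trans_le inf_le_left) v).bracket (φ x) (φ y)) ∧
      (∀ x, productToCover ω Γ Γ₀ v (φ x) = quotientToCover ω Γ Γ₀ v x) := by
  have hle : Γ₀ ≤ Γ := hΓ₀.trans_le inf_le_left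
  have : Finite Γ₀ := finite_of_le hle
  have hv : v ∈ fixedSpace Γ₀ := fun g hg => (hΓ₀.le hg).2
  have hinj : Function.Injective (productToCover ω Γ Γ₀ v) := productToCover_injective hΓ₀ hfree
  -- Both images in the functions on the cover are the invariants of `sliceGroup ω Γ₀`: invariance
  -- of one image is what membership in the other requires.
  obtain ⟨φ, hφ⟩ := exists_algEquiv_of_range_eq (quotientToCover ω Γ Γ₀ v)
    (productToCover ω Γ Γ₀ v) (quotientToCover_injective hω (hΓ.mono hle) hv hfree) hinj
    fun z => ⟨fun ⟨x, hx⟩ => exists_productToCover_eq hΓ₀ hfree fun h hh =>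
        hx ▸ rightPullback_quotientToCover hle hh x,
      fun ⟨y, hy⟩ => exists_quotientToCover_eq hω (hΓ.mono hle) hΓ₀ hfree fun h hh =>
        hy ▸ rightPullback_productToCover hh y⟩
  -- Equivariance and the Poisson property are tested after the injective map to the cover.
  -- Uniqueness uses only injectivity and the last condition.
  refine ⟨φ, ⟨fun n => ?_, fun n => ?_, fun c x => hinj ?_, fun x y => hinj ?_, hφ⟩,
    fun ψ hψ => AlgEquiv.ext fun x => hinj ((hψ.2.2.2.2 x).trans (hφ x).symm)⟩
  -- Continuity: an element small on one side has a small image in the cover, and strictness of the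
  -- other map makes its counterpart small. The inverse is treated with the roles exchanged.
  · obtain ⟨m, hm⟩ := productToCover_strict (ω := ω) hΓ₀ hfree n
    refine ⟨m, fun x hx => hm (φ x) ?_⟩
    rw [hφ]
    exact formalPullback_mem _ _ _ hx
  · obtain ⟨m, hm⟩ := quotientToCover_strict hω (hΓ.mono hle) hv hfree n
    refine ⟨m, fun x hx => hm (φ.symm x) ?_⟩
    rw [← hφ, φ.apply_symm_apply]
    exact productToCover_mem hx
  · rw [hφ, productToCover_productDilation, hφ, quotientToCover_quotientDilation]
  · rw [hφ, productToCover_bracket hω hΓ hle, hφ, hφ]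
    exact quotientToCover_bracket hω hΓ (hΓ.mono hle) x y
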